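/- **Notation.** Let $p,q\in\mathbb C$ with $|p|<1$, $q\neq 0$, and put $$\theta(x)=\prod_{j=0}^\infty(1-p^jx)(1-p^{j+1}/x),\qquad (x)_k=\theta(x)\theta(qx)\cdots\theta(q^{k-1}x)\quad(k\ge 0),$$ with $\theta(x_1,\dots,x_r)=\prod_i\theta(x_i)$ and $(x_1,\dots,x_r)_k=\prod_i (x_i)_k$. Write $|y|=y_1+\dots+y_n$, $zq^y=(z_1q^{y_1},\dots,z_nq^{y_n})$ and $\Delta(z)=\prod_{1\le j<k\le n}z_j\theta(z_k/z_j)$. Define the (terminating) series $$V_n^m(a;b_1,\dots,b_{m+2};c_1,\dots,c_{m+n+2};z_1,\dots,z_n)=\sum_{s_1,\dots,s_n\ge 0}\frac{\Delta(zq^s)}{\Delta(z)}q^{|s|}\prod_{i=1}^n\frac{\theta(az_iq^{s_i+|s|})}{\theta(az_i)}\cdot\frac{\prod_{i=1}^n(az_i)_{|s|}\prod_{i=1}^{m+2}(b_i)_{|s|}}{\prod_{i=1}^{m+n+2}(aq/c_i)_{|s|}}\prod_{i=1}^n\frac{\prod_{j=1}^{m+n+2}(c_jz_i)_{s_i}}{\prod_{j=1}^n(qz_i/z_j)_{s_i}\prod_{j=1}^{m+2}(aqz_i/b_j)_{s_i}},$$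 where terms whose numerator vanishes through a terminating factor are $0$. **Theorem.** Let $a,b,c,x_1,\dots,x_n$ be non-zero complex numbers and $N_1,\dots,N_n$ non-negative integers. For integer vectors $u,y$ with $0\le u_i,y_i\le N_i$ let $$f_u(y)=V_n^n\Big(\tfrac ab;\,aq^{|y|},cq^{|u|},\tfrac{aq^{1+N_1}x_1}b,\dots,\tfrac{aq^{1+N_n}x_n}b;\,1,\tfrac{aq^{1-|N|}}{b^2c},\tfrac{q^{-y_1}}{x_1},\dots,\tfrac{q^{-y_n}}{x_n},\tfrac{q^{-u_1}}{x_1},\dots,\tfrac{q^{-u_n}}{x_n};\,x_1,\dots,x_n\Big),$$ $$g_u(y)=V_n^n\Big(\tfrac{q^{-|N|}b}a;\,\tfrac{q^{-|y|-|N|}}a,\tfrac{q^{-|u|-|N|}}c,\tfrac{q^{1-|N|}b}{ax_1},\dots,\tfrac{q^{1-|N|}b}{ax_n};\,q,\tfrac{q^{|N|}b^2c}{a},q^{y_1}x_1,\dots,q^{y_n}x_n,q^{u_1}x_1,\dots,q^{u_n}x_n;\,\tfrac{q^{-N_1}}{x_1},\dots,\tfrac{q^{-N_n}}{x_n}\Big).$$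 These series terminate: only the terms with $0\le s_i\le\min(u_i,y_i)$, respectively $0\le s_i\le N_i-\max(u_i,y_i)$, contribute. Let $$w(y)=\frac{\Delta(xq^y)}{\Delta(x)}\,q^{|y|}\frac{\theta(aq^{2|y|})}{\theta(a)}\frac{(a)_{|y|}}{(aq^{1+|N|})_{|y|}}\prod_{i,j=1}^n\frac{(q^{-N_j}x_i/x_j)_{y_i}}{(qx_i/x_j)_{y_i}}\prod_{i=1}^n\frac{\theta(bq^{|y|-y_i}/x_i)\,(b/x_i)_{|y|}\,(q^{|N|}ax_i/b)_{y_i}}{\theta(b/x_i)\,(bq^{1-N_i}/x_i)_{|y|}\,(aqx_i/b)_{y_i}},$$ $$\Gamma_u=c^{|N|}q^{|N|^2-|u|}\frac{\Delta(x)}{\Delta(xq^u)}\prod_{i,j=1}^n\frac{(qx_i/x_j)_{u_i}}{(q^{-N_j}x_i/x_j)_{u_i}}\cdot\frac{(aq)_{|N|}\,(q^{-|u|-|N|}/c)_{|N|-|u|}\,(q^{1-2|u|}/c)_{|u|}}{(aq/b,\,bcq^{|N|})_{|N|}}\prod_{i=1}^n\left(\frac{\theta(q^{-|u|}ax_i/bc)}{\theta(q^{-|u|+u_i}ax_i/bc)}\frac{(x_i,\,aq^{1-|N|}x_i/b^2c)_{N_i}}{(x_i/b,\,q^{-|u|}ax_i/bc)_{N_i}}\frac{(q^{u_i+|N|}ax_i/b)_{N_i-u_i}}{(q^{1+u_i}ax_i/b)_{N_i-u_i}}\right).$$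 Let $u,v$ be integer vectors with $0\le u_i,v_i\le N_i$, and assume that the parameters are generic in the sense that none of the denominators displayed above vanishes: those of $w(y)$ and of the contributing terms of $f_u(y)$ and $g_v(y)$, for all $0\le y_i\le N_i$, and that of $\Gamma_u$. Then $$\sum_{y_1,\dots,y_n=0}^{N_1,\dots,N_n}w(y)\,f_u(y)\,g_v(y)=\delta_{u,v}\,\Gamma_u.$$ -/

import Mathlib

open scoped BigOperators

noncomputable section

namespace EllipticHyp

/-- The theta function `θ(x) = ∏_{j ≥ 0} (1 - p^j x)(1 - p^{j+1}/x)` of nome `p`. -/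
def theta (p x : ℂ) : ℂ := ∏' j : ℕ, ((1 - p ^ j * x) * (1 - p ^ (j + 1) / x))

/-- The elliptic Pochhammer symbol `(x)_k = θ(x) θ(qx) ⋯ θ(q^{k-1}x)`. -/
def poch (p q x : ℂ) (k : ℕ) : ℂ := ∏ j ∈ Finset.range k, theta p (q ^ j * x)

/-- `|y| = y_1 + ⋯ + y_n`. -/
def tot {n : ℕ} (y : Fin n → ℕ) : ℕ := ∑ i, y i

/-- `Δ(z) = ∏_{j < k} z_j θ(z_k / z_j)`. -/
def Delta {n : ℕ} (p : ℂ) (z : Fin n → ℂ) : ℂ :=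
  ∏ j : Fin n, ∏ k ∈ Finset.Ioi j, z j * theta p (z k / z j)

/-- The point `z q^y = (z_1 q^{y_1}, …, z_n q^{y_n})`. -/
def qshift {n : ℕ} (q : ℂ) (z : Fin n → ℂ) (y : Fin n → ℕ) : Fin n → ℂ :=
  fun i => z i * q ^ y i

/-- Numerator of the term with index `s` of the series `V_n^m(a; b; c; z)`. -/
def vNum {m n : ℕ} (p q a : ℂ) (b : Fin (m + 2) → ℂ) (c : Fin (m + n + 2) → ℂ)
    (z : Fin n → ℂ) (s : Fin n → ℕ) : ℂ :=
  Delta p (qshift q z s) * q ^ tot s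
    * (∏ i, theta p (a * z i * q ^ (s i + tot s)))
    * (∏ i, poch p q (a * z i) (tot s))
    * (∏ j, poch p q (b j) (tot s))
    * ∏ i, ∏ j, poch p q (c j * z i) (s i)

/-- Denominator of the term with index `s` of the series `V_n^m(a; b; c; z)`. -/
def vDen {m n : ℕ} (p q a : ℂ) (b : Fin (m + 2) → ℂ) (c : Fin (m + n + 2) → ℂ)
    (z : Fin n → ℂ) (s : Fin n → ℕ) : ℂ :=
  Delta p z
    * (∏ i, theta p (a * z i))
    * (∏ j, poch p q (a * q / c j) (tot s))
    * ∏ i, ((∏ j, poch p q (q * z i / z j) (s i)) * ∏ j, poch p q (a * q * z i / b j) (s i))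

/-- The multivariable elliptic hypergeometric series `V_n^m(a; b; c; z)`, summed over all
`s_1, …, s_n ≥ 0`. It is only used for terminating series, where all but finitely many terms have
a vanishing numerator. -/
def V {m n : ℕ} (p q a : ℂ) (b : Fin (m + 2) → ℂ) (c : Fin (m + n + 2) → ℂ)
    (z : Fin n → ℂ) : ℂ :=
  ∑' s : Fin n → ℕ, vNum p q a b c z s / vDen p q a b c z s

section System

variable {n : ℕ} (p q a b c : ℂ) (x : Fin n → ℂ) (N u y : Fin n → ℕ)

/-- The parameters `aq^{|y|}, cq^{|u|}, aq^{1+N_i}x_i/b` of `f_u(y)`. -/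
def fB : Fin (n + 2) → ℂ :=
  Matrix.vecCons (a * q ^ tot y) (Matrix.vecCons (c * q ^ tot u)
    fun i => a * q ^ (1 + N i) * x i / b)

/-- The parameters `1, aq^{1-|N|}/(b²c), q^{-y_i}/x_i, q^{-u_i}/x_i` of `f_u(y)`. -/
def fC : Fin (n + n + 2) → ℂ :=
  Matrix.vecCons 1 (Matrix.vecCons (a * q ^ (1 - (tot N : ℤ)) / (b ^ 2 * c))
    (Fin.append (fun i => q ^ (-(y i : ℤ)) / x i) (fun i => q ^ (-(u i : ℤ)) / x i)))

/-- The function `f_u(y)`. -/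
def f : ℂ := V p q (a / b) (fB q a b c x N u y) (fC q a b c x N u y) x

/-- The parameter `q^{-|N|}b/a` of `g_u(y)`. -/
def gA : ℂ := q ^ (-(tot N : ℤ)) * b / a

/-- The parameters `q^{-|y|-|N|}/a, q^{-|u|-|N|}/c, q^{1-|N|}b/(ax_i)` of `g_u(y)`. -/
def gB : Fin (n + 2) → ℂ :=
  Matrix.vecCons (q ^ (-(tot y : ℤ) - (tot N : ℤ)) / a)
    (Matrix.vecCons (q ^ (-(tot u : ℤ) - (tot N : ℤ)) / c)
      fun i => q ^ (1 - (tot N : ℤ)) * b / (a * x i))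

/-- The parameters `q, q^{|N|}b²c/a, q^{y_i}x_i, q^{u_i}x_i` of `g_u(y)`. -/
def gC : Fin (n + n + 2) → ℂ :=
  Matrix.vecCons q (Matrix.vecCons (q ^ tot N * b ^ 2 * c / a)
    (Fin.append (fun i => q ^ y i * x i) (fun i => q ^ u i * x i)))

/-- The variables `q^{-N_i}/x_i` of `g_u(y)`. -/
def gZ : Fin n → ℂ := fun i => q ^ (-(N i : ℤ)) / x i

/-- The function `g_u(y)`. -/
def g : ℂ :=
  V p q (gA q a b N) (gB q a b c x N u y) (gC q a b c x N u y) (gZ q x N)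

/-- Numerator of the weight `w(y)`. -/
def wNum : ℂ :=
  Delta p (qshift q x y) * q ^ tot y * theta p (a * q ^ (2 * tot y)) * poch p q a (tot y)
    * (∏ i, ∏ j, poch p q (q ^ (-(N j : ℤ)) * x i / x j) (y i))
    * ∏ i, (theta p (b * q ^ ((tot y : ℤ) - (y i : ℤ)) / x i) * poch p q (b / x i) (tot y)
        * poch p q (q ^ tot N * a * x i / b) (y i))

/-- Denominator of the weight `w(y)`. -/
def wDen : ℂ :=
  Delta p x * theta p a * poch p q (a * q ^ (1 + tot N)) (tot y)
    * (∏ i, ∏ j, poch p q (q * x i / x j) (y i))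
    * ∏ i, (theta p (b / x i) * poch p q (b * q ^ (1 - (N i : ℤ)) / x i) (tot y)
        * poch p q (a * q * x i / b) (y i))

/-- The weight `w(y)`. -/
def w : ℂ := wNum p q a b x N y / wDen p q a b x N y

/-- Numerator of the norm `Γ_u`. -/
def GammaNum : ℂ :=
  c ^ tot N * q ^ ((tot N : ℤ) ^ 2 - (tot u : ℤ)) * Delta p x
    * (∏ i, ∏ j, poch p q (q * x i / x j) (u i))
    * (poch p q (a * q) (tot N)
        * poch p q (q ^ (-(tot u : ℤ) - (tot N : ℤ)) / c) (tot N - tot u)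
        * poch p q (q ^ (1 - 2 * (tot u : ℤ)) / c) (tot u))
    * ∏ i, (theta p (q ^ (-(tot u : ℤ)) * a * x i / (b * c))
        * (poch p q (x i) (N i) * poch p q (a * q ^ (1 - (tot N : ℤ)) * x i / (b ^ 2 * c)) (N i))
        * poch p q (q ^ (u i + tot N) * a * x i / b) (N i - u i))

/-- Denominator of the norm `Γ_u`. -/
def GammaDen : ℂ :=
  Delta p (qshift q x u)
    * (∏ i, ∏ j, poch p q (q ^ (-(N j : ℤ)) * x i / x j) (u i))
    * (poch p q (a * q / b) (tot N) * poch p q (b * c * q ^ tot N) (tot N))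
    * ∏ i, (theta p (q ^ (-(tot u : ℤ) + (u i : ℤ)) * a * x i / (b * c))
        * (poch p q (x i / b) (N i) * poch p q (q ^ (-(tot u : ℤ)) * a * x i / (b * c)) (N i))
        * poch p q (q ^ (1 + u i) * a * x i / b) (N i - u i))

/-- The norm `Γ_u`. -/
def Gamma : ℂ := GammaNum p q a b c x N u / GammaDen p q a b c x N u

end System

end EllipticHyp

end

/-! Biorthogonality reduces to two inversions of triangular matrices. Put q = e^h, replace the other
parameters by logarithms, and replace θ by the odd function s(ξ) = e^{-ξ/2} θ(e^ξ). The series are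
balanced and the weight and norm carry suitable monomial prefactors, so all exponential factors
cancel. What remains is an identity between products of values of s.

With α = a - b (logarithms), the summand of f_u(y) factors as L_c(u,k) · W(k) · M(k) · L_a(y,k).
Here L (`lowerMat`) vanishes unless k ≤ u, W (`wpFactor`) is the very-well-poised factor and M
(`fMid`) involves neither u nor y. The summand of g_v(y), with its index reversed to t = N - s,
factors as U_c(v,t) · (W(t)/W(N)) · M'(t) · U_a(y,t). Here U (`upperFactor`) vanishes unless v ≤ t
and M' is `gMid`. Up to diagonal factors the transpose of U inverts L: the entry (t,y) of the
inverse is W(t) U(y,t) / (W(y) U(y,y) L(y,y)).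

The product w(y) W(y) U_a(y,y) L_a(y,y) does not depend on y (`weight_mul`). Hence summing over y
pairs L_a with its inverse and forces t = k. The product M(k) M'(k) does not depend on k
(`fMid_mul_gMid`), so the remaining sum over k pairs L_c with its inverse and gives δ_{u,v}. The
collected constants are Γ_u (`norm_eq`).

The inversion L · L⁻¹ = 1 says that a terminating very-well-poised multiple sum is zero unless it
consists of one term (`sum_wpTerm_eq_zero`). This goes by induction on the size |K| of the summation
box. An elliptic partial fraction identity with n + 2 points multiplies the summand by a vanishing
combination. At n + 1 of the points the resulting sum is zero, either termwise or because it is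
proportional to a smaller sum of the same kind; the last point contributes a nonzero multiple of the
sum itself. The other order of the product follows because the matrices are finite and square.

The partial fraction identity rests on the three-term relation for s. That relation holds because
θ(xy)θ(x/y) is, up to the factor x, a 2 × 2 determinant in a pair of functions of x and of y, which
is read off from the Laurent series of θ (Jacobi triple product) by splitting a double sum by
parity.

Many intermediate denominators are absent from the hypotheses. They are nonzero for generic
parameters, and the general case follows by continuity along a line on which generic points are
dense. -/

open scoped Topology
open Filter

/-! ### The Jacobi triple product and the Laurent series of theta. -/

namespace EllipticHyp

/-- `1 / (p; p)_k`, extended by `0` to negative `k`. -/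
noncomputable def qfacInv (p : ℂ) (k : ℤ) : ℂ :=
  if 0 ≤ k then (∏ j ∈ Finset.range k.toNat, (1 - p ^ (j + 1)))⁻¹ else 0

theorem one_sub_pow_ne_zero {p : ℂ} (hp : ‖p‖ < 1) (j : ℕ) : 1 - p ^ (j + 1) ≠ 0 := by
  intro h
  have h1 : ‖p ^ (j + 1)‖ = 1 := by rw [← sub_eq_zero.mp h]; simp
  rw [norm_pow] at h1
  exact absurd h1 (pow_lt_one₀ (norm_nonneg _) hp (by omega)).ne

/-- The extension by zero makes the recurrence valid at every integer: at k = 0 the factor 1 - p^0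
vanishes, in agreement with the value 0 at -1. No boundary terms appear in the finite triple
product. -/
theorem qfacInv_sub_one {p : ℂ} (hp : ‖p‖ < 1) (k : ℤ) :
    qfacInv p (k - 1) = (1 - p ^ k) * qfacInv p k := by
  rcases lt_trichotomy k 0 with h | h | h
  · simp [qfacInv, not_le.mpr h, show ¬ (1 ≤ k) by omega]
  · subst h; simp [qfacInv]
  · obtain ⟨m, rfl⟩ : ∃ m : ℕ, k = m + 1 := ⟨(k - 1).toNat, by omega⟩
    have h1 : ((m : ℤ) + 1).toNat = m + 1 := by omega
    simp only [qfacInv, add_sub_cancel_right, Int.natCast_nonneg, if_true, Int.toNat_natCast, h1,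
      show (0 : ℤ) ≤ m + 1 by omega, Finset.prod_range_succ, mul_inv]
    have h2 := one_sub_pow_ne_zero hp m
    rw [show p ^ ((m : ℤ) + 1) = p ^ (m + 1) by exact_mod_cast zpow_natCast p (m + 1)]
    field_simp

/-- The `k`-th term of the Laurent series of the theta function, up to a constant. -/
noncomputable def thetaTerm (p x : ℂ) (k : ℤ) : ℂ := (-1) ^ k * p ^ (k * (k - 1) / 2) * x ^ k

theorem thetaTerm_add_one {p x : ℂ} (hp : p ≠ 0) (hx : x ≠ 0) (k : ℤ) :
    thetaTerm p x (k + 1) = -(p ^ k * x) * thetaTerm p x k := by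
  have : (k + 1) * (k + 1 - 1) / 2 = k * (k - 1) / 2 + k := by
    rw [show (k + 1) * (k + 1 - 1) = k * (k - 1) + k * 2 by ring]
    exact Int.add_mul_ediv_right _ _ (by norm_num)
  rw [thetaTerm, thetaTerm, this, zpow_add₀ hp, zpow_add_one₀ hx, zpow_add_one₀ (by norm_num)]
  ring

theorem thetaTerm_ne_zero {p x : ℂ} (hp : p ≠ 0) (hx : x ≠ 0) (k : ℤ) : thetaTerm p x k ≠ 0 := by
  unfold thetaTerm
  have := zpow_ne_zero k hx
  have := zpow_ne_zero (k * (k - 1) / 2) hp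
  have : (-1 : ℂ) ^ k ≠ 0 := zpow_ne_zero _ (by norm_num)
  positivity

/-- The quotient of consecutive terms has modulus |p|^k |x| going up and |p|^(k+1) / |x| going down,
so both half-series pass the ratio test with limit 0. -/
theorem summable_thetaTerm {p x : ℂ} (hp : ‖p‖ < 1) (hp0 : p ≠ 0) (hx : x ≠ 0) :
    Summable (thetaTerm p x) := by
  refine Summable.of_nat_of_neg ?_ ?_
  · refine summable_of_ratio_test_tendsto_lt_one (l := 0) (by norm_num)
      (Eventually.of_forall fun n => thetaTerm_ne_zero hp0 hx _) ?_
    have h : ∀ n : ℕ, ‖thetaTerm p x ((n + 1 : ℕ) : ℤ)‖ / ‖thetaTerm p x (n : ℤ)‖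
        = ‖p‖ ^ n * ‖x‖ := fun n => by
      have := thetaTerm_ne_zero hp0 hx n
      rw [Nat.cast_add, Nat.cast_one, thetaTerm_add_one hp0 hx, norm_mul, norm_neg, norm_mul,
        norm_zpow, zpow_natCast]
      field_simp
    simp only [h]
    simpa using (tendsto_pow_atTop_nhds_zero_of_lt_one (norm_nonneg p) hp).mul_const ‖x‖
  · refine summable_of_ratio_test_tendsto_lt_one (l := 0) (by norm_num)
      (Eventually.of_forall fun n => thetaTerm_ne_zero hp0 hx _) ?_
    have h : ∀ n : ℕ, ‖thetaTerm p x (-((n + 1 : ℕ) : ℤ))‖ / ‖thetaTerm p x (-(n : ℤ))‖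
        = ‖p‖ ^ n * (‖p‖ * ‖x‖⁻¹) := fun n => by
      have h0 := thetaTerm_ne_zero hp0 hx (-(n + 1 : ℕ))
      have h1 := thetaTerm_add_one hp0 hx (-(n + 1 : ℕ))
      rw [show (-((n + 1 : ℕ) : ℤ) + 1) = -n by push_cast; ring] at h1
      rw [h1, norm_mul, norm_neg, norm_mul, norm_zpow, zpow_neg, zpow_natCast, pow_succ]
      have := norm_ne_zero_iff.mpr hp0
      have := norm_ne_zero_iff.mpr hx
      have := norm_ne_zero_iff.mpr h0
      field_simp
    simp only [h]
    simpa using (tendsto_pow_atTop_nhds_zero_of_lt_one (norm_nonneg p) hp).mul_const _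

/-- The finite form of the Jacobi triple product identity. -/
theorem hasSum_finite_tripleProduct {p x : ℂ} (hp : ‖p‖ < 1) (hp0 : p ≠ 0) (hx : x ≠ 0) (m : ℕ) :
    HasSum (fun k : ℤ => (∏ j ∈ Finset.range (2 * m), (1 - p ^ (j + 1))) * qfacInv p (m + k)
        * qfacInv p (m - k) * thetaTerm p x k)
      (∏ j ∈ Finset.range m, ((1 - p ^ j * x) * (1 - p ^ (j + 1) / x))) := by
  induction m with
  | zero =>
    convert hasSum_ite_eq (0 : ℤ) (1 : ℂ) using 2 with k
    rcases lt_trichotomy k 0 with h | h | h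
    · simp [qfacInv, not_le.mpr h, h.ne]
    · subst h; simp [qfacInv, thetaTerm]
    · simp [qfacInv, not_le.mpr h, h.ne']
    · simp
  | succ m ih =>
    have e1 := (Equiv.subRight (1 : ℤ)).hasSum_iff.mpr ih
    have e2 := (Equiv.addRight (1 : ℤ)).hasSum_iff.mpr ih
    -- The new factor expands as 1 + p^(2m+1) - p^m x - p^(m+1)/x. The copies multiplied by x and
    -- 1/x are reindexed by one, so that all terms at index k carry x^k and the coefficients can be
    -- compared.
    have key := ((ih.mul_left (1 + p ^ (2 * m + 1))).sub (e1.mul_left (p ^ m * x))).sub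
      (e2.mul_left (p ^ (m + 1) / x))
    refine Eq.mp (congrArg₂ (fun f s => HasSum f s) ?_ ?_) key
    · funext k
      symm
      simp only [Function.comp, Equiv.subRight_apply, Equiv.coe_addRight]
      have t1 := thetaTerm_add_one hp0 hx (k - 1)
      rw [sub_add_cancel] at t1
      rw [thetaTerm_add_one hp0 hx k]
      have a1 := qfacInv_sub_one hp (m + 1 + k)
      have a2 := qfacInv_sub_one hp (m + k)
      have b1 := qfacInv_sub_one hp (m + 1 - k)
      have b2 := qfacInv_sub_one hp (m - k)
      rw [show (m + 1 + k - 1 : ℤ) = m + k by ring] at a1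
      rw [show (m + 1 - k - 1 : ℤ) = m - k by ring] at b1
      push_cast
      rw [show (m + (k - 1) : ℤ) = m + k - 1 by ring, show (m - (k - 1) : ℤ) = m + 1 - k by ring,
        show (m + (k + 1) : ℤ) = m + 1 + k by ring, show (m - (k + 1) : ℤ) = m - k - 1 by ring,
        a2, b2, a1, b1, t1, show 2 * (m + 1) = 2 * m + 1 + 1 by ring, Finset.prod_range_succ,
        Finset.prod_range_succ]
      generalize qfacInv p (m + 1 + k) = A
      generalize qfacInv p (m + 1 - k) = B
      generalize thetaTerm p x (k - 1) = T
      generalize ∏ j ∈ Finset.range (2 * m), (1 - p ^ (j + 1)) = C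
      have q1 : p ^ (m + 1 + k : ℤ) = p ^ m * p * p ^ k := by
        rw [zpow_add₀ hp0, zpow_add_one₀ hp0, zpow_natCast]
      have q2 : p ^ (m + k : ℤ) = p ^ m * p ^ k := by
        rw [zpow_add₀ hp0, zpow_natCast]
      have q3 : p ^ (m + 1 - k : ℤ) = p ^ m * p / p ^ k := by
        rw [zpow_sub₀ hp0, zpow_add_one₀ hp0, zpow_natCast]
      have q4 : p ^ (m - k : ℤ) = p ^ m / p ^ k := by
        rw [zpow_sub₀ hp0, zpow_natCast]
      have q5 : p ^ (k - 1 : ℤ) = p ^ k / p := by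
        rw [zpow_sub_one₀ hp0]; rfl
      rw [q1, q2, q3, q4, q5]
      have := zpow_ne_zero k hp0
      generalize p ^ k = K at *
      field_simp
      ring
    · rw [Finset.prod_range_succ]
      field_simp
      ring_nf

theorem summable_factor {p : ℂ} (hp : ‖p‖ < 1) (x : ℂ) :
    Summable fun j : ℕ => (1 - p ^ j * x) * (1 - p ^ (j + 1) / x) - 1 := by
  have h1 : Summable fun j : ℕ => p ^ j := summable_geometric_of_norm_lt_one hp
  have h2 : Summable fun j : ℕ => (p ^ 2) ^ j :=
    summable_geometric_of_norm_lt_one (by rw [norm_pow]; exact pow_lt_one₀ (norm_nonneg _) hp (by omega))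
  -- The cross term is kept as p x / x because x = 0 is allowed.
  have := ((h1.mul_right (-x)).add (h1.mul_right (-p / x))).add (h2.mul_right (p * x / x))
  refine this.congr fun j => ?_
  rw [← pow_mul]
  ring

theorem multipliable_theta {p : ℂ} (hp : ‖p‖ < 1) (x : ℂ) :
    Multipliable fun j : ℕ => (1 - p ^ j * x) * (1 - p ^ (j + 1) / x) := by
  have := multipliable_one_add_of_summable (summable_factor hp x).norm
  simpa using this

theorem theta_ne_zero {p x : ℂ} (hp : ‖p‖ < 1)
    (h : ∀ j : ℕ, (1 - p ^ j * x) * (1 - p ^ (j + 1) / x) ≠ 0) : theta p x ≠ 0 := by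
  have := tprod_one_add_ne_zero_of_summable
    (f := fun j : ℕ => (1 - p ^ j * x) * (1 - p ^ (j + 1) / x) - 1) (by simpa using h)
    (summable_factor hp x).norm
  simpa [theta] using this

/-- The Laurent series has negative powers of p in its algebra and needs p ≠ 0, so the nome 0 is
treated by this closed form. -/
theorem theta_zero_nome (x : ℂ) : theta 0 x = 1 - x := by
  unfold theta
  rw [tprod_eq_mulSingle 0]
  · simp
  · intro j hj; simp [hj]

/-- The Jacobi triple product identity. -/
theorem theta_eq_tsum {p : ℂ} (hp : ‖p‖ < 1) (hp0 : p ≠ 0) :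
    ∃ κ : ℂ, ∀ x, x ≠ 0 → theta p x = κ * ∑' k, thetaTerm p x k := by
  have hm : Summable fun j : ℕ => ‖-p ^ (j + 1)‖ := by
    have := ((summable_geometric_of_norm_lt_one hp).mul_right p).norm
    simpa [pow_succ] using this
  have hne : ∏' j : ℕ, (1 + -p ^ (j + 1)) ≠ 0 :=
    tprod_one_add_ne_zero_of_summable
      (fun j => by simpa [sub_eq_add_neg] using one_sub_pow_ne_zero hp j) hm
  have hE := (multipliable_one_add_of_summable hm).hasProd.tendsto_prod_nat
  set E := ∏' j : ℕ, (1 + -p ^ (j + 1)) with hEdef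
  simp only [← sub_eq_add_neg] at hE
  have hq : Tendsto (qfacInv p) atTop (𝓝 E⁻¹) := by
    have tendsto_toNat : Tendsto Int.toNat atTop atTop :=
      tendsto_atTop.mpr fun b => by
        filter_upwards [eventually_ge_atTop (b : ℤ)] with k hk
        omega
    have h1 : Tendsto (fun k : ℤ => (∏ j ∈ Finset.range k.toNat, (1 - p ^ (j + 1)))⁻¹) atTop
        (𝓝 E⁻¹) := (hE.comp tendsto_toNat).inv₀ hne
    refine h1.congr' ?_
    filter_upwards [eventually_ge_atTop 0] with k hk
    simp [qfacInv, hk]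
  obtain ⟨C1, hC1⟩ : ∃ C, ∀ m, ‖∏ j ∈ Finset.range m, (1 - p ^ (j + 1))‖ ≤ C := by
    obtain ⟨C, hC⟩ := (Metric.isBounded_range_of_tendsto _ hE).exists_norm_le
    exact ⟨C, fun m => hC _ ⟨m, rfl⟩⟩
  obtain ⟨C2, hC2⟩ : ∃ C, ∀ k, ‖qfacInv p k‖ ≤ C := by
    obtain ⟨C, hC⟩ := (Metric.isBounded_range_of_tendsto _
      (hq.comp tendsto_natCast_atTop_atTop)).exists_norm_le
    refine ⟨C, fun k => ?_⟩
    have h0 := hC _ ⟨k.toNat, rfl⟩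
    by_cases hk : 0 ≤ k
    · simpa [Int.toNat_of_nonneg hk] using h0
    · simpa [qfacInv, hk] using (norm_nonneg _).trans h0
  have hC10 : 0 ≤ C1 := (norm_nonneg _).trans (hC1 0)
  have hC20 : 0 ≤ C2 := (norm_nonneg _).trans (hC2 0)
  -- The constant is the limit of (p;p)_{2m} / ((p;p)_{m+k} (p;p)_{m-k}) as m → ∞, the same for
  -- every k. These coefficients are uniformly bounded, so dominated convergence applies to the
  -- finite identity.
  refine ⟨E * E⁻¹ * E⁻¹, fun x hx => ?_⟩
  have hs := summable_thetaTerm hp hp0 hx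
  rw [← tsum_mul_left]
  refine tendsto_nhds_unique (multipliable_theta hp x).hasProd.tendsto_prod_nat ?_
  simp only [← (hasSum_finite_tripleProduct hp hp0 hx _).tsum_eq]
  refine tendsto_tsum_of_dominated_convergence (bound := fun k => C1 * C2 * C2 * ‖thetaTerm p x k‖)
    (hs.norm.mul_left _) (fun k => ?_) (Eventually.of_forall fun m k => ?_)
  · refine Tendsto.mul_const _ (Tendsto.mul (Tendsto.mul ?_ ?_) ?_)
    · exact hE.comp (tendsto_id.const_mul_atTop' (by norm_num : 0 < 2))
    · exact hq.comp (tendsto_atTop_add_const_right _ k tendsto_natCast_atTop_atTop)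
    · exact hq.comp (tendsto_atTop_add_const_right _ (-k) tendsto_natCast_atTop_atTop)
  · rw [norm_mul, norm_mul, norm_mul]
    gcongr
    · exact hC1 _
    · exact hC2 _
    · exact hC2 _

end EllipticHyp

/-! ### Products of two thetas have rank two; the odd theta function. -/

namespace EllipticHyp

/-- Pairs of integers, split by the parity of their sum. -/
def parityEquiv : (ℤ × ℤ) ⊕ (ℤ × ℤ) ≃ ℤ × ℤ where
  toFun := Sum.elim (fun r => (r.1 + r.2, r.1 - r.2)) (fun r => (r.1 + r.2 + 1, r.1 - r.2))
  invFun k := if (k.1 + k.2) % 2 = 0 then Sum.inl ((k.1 + k.2) / 2, (k.1 - k.2) / 2)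
    else Sum.inr ((k.1 + k.2) / 2, (k.1 - k.2) / 2)
  left_inv := by
    rintro (⟨r, t⟩ | ⟨r, t⟩)
    · have : (r + t + (r - t)) % 2 = 0 := by omega
      simp only [Sum.elim_inl, this, if_true, Sum.inl.injEq, Prod.mk.injEq]
      omega
    · have : ¬ (r + t + 1 + (r - t)) % 2 = 0 := by omega
      simp only [Sum.elim_inr, this, if_false, Sum.inr.injEq, Prod.mk.injEq]
      omega
  right_inv := by
    rintro ⟨k, l⟩
    by_cases h : (k + l) % 2 = 0
    · simp only [h, if_true, Sum.elim_inl, Prod.mk.injEq]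
      omega
    · simp only [h, if_false, Sum.elim_inr, Prod.mk.injEq]
      omega

/-- In the double series of θ(xy)θ(x/y), the terms with indices (r+t, r-t) separate into a function
of x and r times one of y and t, because C(r+t,2) + C(r-t,2) = (r² - r) + t². -/
theorem thetaTerm_even {p x y : ℂ} (hp : p ≠ 0) (hx : x ≠ 0) (hy : y ≠ 0) (r t : ℤ) :
    thetaTerm p (x * y) (r + t) * thetaTerm p (x / y) (r - t)
      = (p ^ (r ^ 2 - r) * x ^ (2 * r)) * (p ^ (t ^ 2) * y ^ (2 * t)) := by
  -- The integer divisions by 2 are exact since k(k-1) is even.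
  have e : (r + t) * (r + t - 1) / 2 + (r - t) * (r - t - 1) / 2 = r ^ 2 - r + t ^ 2 := by
    have h1 := Int.even_mul_pred_self (r + t)
    have h2 := Int.even_mul_pred_self (r - t)
    obtain ⟨u, hu⟩ := h1
    obtain ⟨v, hv⟩ := h2
    rw [hu, hv, show (u + u) / 2 = u by omega, show (v + v) / 2 = v by omega]
    linarith [show (u + u) + (v + v) = 2 * (r ^ 2 - r + t ^ 2) by rw [← hu, ← hv]; ring]
  have s : (-1 : ℂ) ^ (r + t) * (-1) ^ (r - t) = 1 := by
    rw [← zpow_add₀ (by norm_num), show r + t + (r - t) = 2 * r by ring, zpow_mul]; norm_num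
  have hx2 : x ^ (r + t) * x ^ (r - t) = x ^ (2 * r) := by
    rw [← zpow_add₀ hx]; congr 1; ring
  have hy2 : y ^ (r + t) * (y ^ (r - t))⁻¹ = y ^ (2 * t) := by
    rw [← zpow_neg, ← zpow_add₀ hy]; congr 1; ring
  have hp2 : p ^ ((r + t) * (r + t - 1) / 2) * p ^ ((r - t) * (r - t - 1) / 2)
      = p ^ (r ^ 2 - r) * p ^ (t ^ 2) := by
    rw [← zpow_add₀ hp, ← zpow_add₀ hp, e]
  unfold thetaTerm
  rw [mul_zpow, div_zpow, ← hx2, ← hy2]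
  linear_combination (x ^ (r + t) * x ^ (r - t) * y ^ (r + t) * (y ^ (r - t))⁻¹) *
    (p ^ ((r + t) * (r + t - 1) / 2) * p ^ ((r - t) * (r - t - 1) / 2) * s + hp2)

/-- This is the other parity class. Written in t + 1, it shows the two series of the even class with
the roles of x and y exchanged, which is the second term of the determinant. -/
theorem thetaTerm_odd {p x y : ℂ} (hp : p ≠ 0) (hx : x ≠ 0) (hy : y ≠ 0) (r t : ℤ) :
    thetaTerm p (x * y) (r + t + 1) * thetaTerm p (x / y) (r - t)
      = - ((p ^ (r ^ 2) * x ^ (2 * r)) * (p ^ ((t + 1) ^ 2 - (t + 1)) * y ^ (2 * (t + 1))))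
        * (x / y) := by
  rw [thetaTerm_add_one hp (mul_ne_zero hx hy), mul_assoc, thetaTerm_even hp hx hy,
    show (t + 1) ^ 2 - (t + 1) = t ^ 2 + t by ring, show 2 * (t + 1) = 2 * t + 2 by ring,
    zpow_add₀ hp, zpow_add₀ hp, zpow_add₀ hy, zpow_sub₀ hp]
  have := zpow_ne_zero r hp
  field_simp

/-- The product `θ(xy)θ(x/y)` has rank two as a function of `x` and `y`. -/
theorem exists_theta_mul_theta {p : ℂ} (hp : ‖p‖ < 1) :
    ∃ φ β : ℂ → ℂ, ∀ x y, x ≠ 0 → y ≠ 0 →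
      theta p (x * y) * theta p (x / y) = x * (φ x * β y - β x * φ y) := by
  rcases eq_or_ne p 0 with rfl | hp0
  -- At nome 0, (1 - xy)(1 - x/y) = x((x + 1/x) - (y + 1/y)).
  · refine ⟨fun x => x + x⁻¹, fun _ => 1, fun x y hx hy => ?_⟩
    simp only [theta_zero_nome]
    field_simp
    ring
  obtain ⟨κ, hκ⟩ := theta_eq_tsum hp hp0
  refine ⟨fun x => κ ^ 2 * (∑' r : ℤ, p ^ (r ^ 2 - r) * x ^ (2 * r)) / x,
    fun y => ∑' t : ℤ, p ^ (t ^ 2) * y ^ (2 * t), fun x y hx hy => ?_⟩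
  have hxy := mul_ne_zero hx hy
  have hxy' := div_ne_zero hx hy
  have s1 := summable_thetaTerm hp hp0 hxy
  have s2 := summable_thetaTerm hp hp0 hxy'
  have sp := summable_mul_of_summable_norm s1.norm s2.norm
  have spe := parityEquiv.summable_iff.mpr sp
  have ev := tsum_mul_tsum_of_summable_norm s1.norm s2.norm
  -- Both one-variable series are compared in norm with theta series of nome p², at x² here and at p
  -- y² below.
  have sa : ∀ x : ℂ, x ≠ 0 → Summable fun r : ℤ => ‖p ^ (r ^ 2 - r) * x ^ (2 * r)‖ := fun x hx => by
    have hp2 : ‖p ^ 2‖ < 1 := by rw [norm_pow]; exact pow_lt_one₀ (norm_nonneg _) hp (by omega)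
    refine (summable_thetaTerm hp2 (pow_ne_zero 2 hp0) (pow_ne_zero 2 hx)).norm.congr fun r => ?_
    rw [thetaTerm, norm_mul, norm_mul, norm_zpow, norm_neg, norm_one, one_zpow, one_mul,
      ← zpow_natCast p, ← zpow_natCast x, ← zpow_mul, ← zpow_mul, norm_mul]
    congr 3
    obtain ⟨v, hv⟩ := Int.even_mul_pred_self r
    rw [hv, show r ^ 2 - r = r * (r - 1) by ring, hv]
    push_cast; omega
  have sb : ∀ y : ℂ, y ≠ 0 → Summable fun t : ℤ => ‖p ^ (t ^ 2) * y ^ (2 * t)‖ := fun y hy => by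
    have hp2 : ‖p ^ 2‖ < 1 := by rw [norm_pow]; exact pow_lt_one₀ (norm_nonneg _) hp (by omega)
    refine (summable_thetaTerm hp2 (pow_ne_zero 2 hp0)
      (mul_ne_zero hp0 (pow_ne_zero 2 hy))).norm.congr fun r => ?_
    rw [thetaTerm, norm_mul, norm_mul, norm_zpow, norm_neg, norm_one, one_zpow, one_mul, mul_zpow,
      ← zpow_natCast p, ← zpow_natCast y, ← zpow_mul, ← zpow_mul, ← norm_mul, ← mul_assoc,
      ← zpow_add₀ hp0]
    congr 3
    obtain ⟨v, hv⟩ := Int.even_mul_pred_self r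
    rw [show r ^ 2 = r * (r - 1) + r by ring, hv]
    push_cast; omega
  have h1 : ∑' r : ℤ × ℤ, thetaTerm p (x * y) (r.1 + r.2) * thetaTerm p (x / y) (r.1 - r.2)
      = (∑' r : ℤ, p ^ (r ^ 2 - r) * x ^ (2 * r)) * ∑' t : ℤ, p ^ (t ^ 2) * y ^ (2 * t) := by
    rw [tsum_mul_tsum_of_summable_norm (sa x hx) (sb y hy)]
    exact tsum_congr fun r => thetaTerm_even hp0 hx hy _ _
  have h2 : ∑' r : ℤ × ℤ, thetaTerm p (x * y) (r.1 + r.2 + 1) * thetaTerm p (x / y) (r.1 - r.2)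
      = -((∑' r : ℤ, p ^ (r ^ 2) * x ^ (2 * r)) * ∑' t : ℤ, p ^ (t ^ 2 - t) * y ^ (2 * t))
        * (x / y) := by
    have := (Equiv.addRight (1 : ℤ)).tsum_eq fun t : ℤ => p ^ (t ^ 2 - t) * y ^ (2 * t)
    have sa' := (Equiv.addRight (1 : ℤ)).summable_iff.mpr (sa y hy)
    rw [← this, tsum_mul_tsum_of_summable_norm (sb x hx) sa', ← tsum_neg, ← tsum_mul_right]
    exact tsum_congr fun r => thetaTerm_odd hp0 hx hy _ _
  have h3 := (parityEquiv.tsum_eq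
    fun k : ℤ × ℤ => thetaTerm p (x * y) k.1 * thetaTerm p (x / y) k.2)
  have h4 := Summable.tsum_sum (f := fun c => thetaTerm p (x * y) (parityEquiv c).1
    * thetaTerm p (x / y) (parityEquiv c).2) (spe.comp_injective Sum.inl_injective)
    (spe.comp_injective Sum.inr_injective)
  simp only [parityEquiv, Equiv.coe_fn_mk, Sum.elim_inl, Sum.elim_inr] at h3 h4
  rw [hκ _ hxy, hκ _ hxy', mul_mul_mul_comm, ev, ← h3, h4, h1, h2]
  field_simp
  ring

/-- The odd theta function in additive notation, `σ(ξ) = e^{-ξ/2} θ(e^ξ)`. -/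
noncomputable def oddTheta (p ξ : ℂ) : ℂ := Complex.exp (-ξ / 2) * theta p (Complex.exp ξ)

theorem theta_exp (p ξ : ℂ) : theta p (Complex.exp ξ) = Complex.exp (ξ / 2) * oddTheta p ξ := by
  rw [oddTheta, ← mul_assoc, ← Complex.exp_add, show ξ / 2 + -ξ / 2 = 0 by ring, Complex.exp_zero,
    one_mul]

theorem exists_oddTheta_mul_oddTheta {p : ℂ} (hp : ‖p‖ < 1) :
    ∃ φ β : ℂ → ℂ, ∀ x y,
      oddTheta p (x + y) * oddTheta p (x - y) = φ x * β y - β x * φ y := by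
  obtain ⟨φ, β, h⟩ := exists_theta_mul_theta hp
  refine ⟨fun x => φ (Complex.exp x), fun x => β (Complex.exp x), fun x y => ?_⟩
  have := h (Complex.exp x) (Complex.exp y) (Complex.exp_ne_zero _) (Complex.exp_ne_zero _)
  rw [← Complex.exp_add, ← Complex.exp_sub] at this
  have e : Complex.exp (-(x + y) / 2) * Complex.exp (-(x - y) / 2) * Complex.exp x = 1 := by
    rw [← Complex.exp_add, ← Complex.exp_add]; ring_nf; simp
  unfold oddTheta
  linear_combination (Complex.exp (-(x + y) / 2) * Complex.exp (-(x - y) / 2)) * this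
    + (φ (Complex.exp x) * β (Complex.exp y) - β (Complex.exp x) * φ (Complex.exp y)) * e

/-- The theta function is continuous in additive notation. -/
theorem continuous_theta_exp {p : ℂ} (hp : ‖p‖ < 1) :
    Continuous fun ξ : ℂ => theta p (Complex.exp ξ) := by
  rcases eq_or_ne p 0 with rfl | hp0
  · simp only [theta_zero_nome]; fun_prop
  obtain ⟨κ, hκ⟩ := theta_eq_tsum hp hp0
  simp only [fun ξ => hκ _ (Complex.exp_ne_zero ξ)]
  refine continuous_const.mul (continuous_iff_continuousAt.mpr fun ξ₀ => ?_)
  set R : ℝ := ‖ξ₀‖ + 1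
  -- For |Re ξ| ≤ R, |e^{kξ}| is at most e^{kR} when k ≥ 0 and e^{-kR} when k ≤ 0, so the terms at
  -- the two real points ±R dominate uniformly on the ball.
  have hs : Summable fun k : ℤ => ‖thetaTerm p (Complex.exp R) k‖ + ‖thetaTerm p (Complex.exp (-R)) k‖ :=
    (summable_thetaTerm hp hp0 (Complex.exp_ne_zero _)).norm.add
      (summable_thetaTerm hp hp0 (Complex.exp_ne_zero _)).norm
  have hc : ContinuousOn (fun ξ => ∑' k, thetaTerm p (Complex.exp ξ) k) (Metric.ball ξ₀ 1) := by
    refine continuousOn_tsum (fun k => ?_) hs fun k ξ hξ => ?_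
    · simp only [thetaTerm, ← Complex.exp_int_mul]
      fun_prop
    · have h1 : ‖ξ‖ ≤ R := by
        have := norm_sub_norm_le ξ ξ₀
        rw [Metric.mem_ball, dist_eq_norm] at hξ
        simp only [R]; linarith
      have h2 : |ξ.re| ≤ R := (Complex.abs_re_le_norm ξ).trans h1
      have h3 := abs_le.mp h2
      simp only [thetaTerm, ← Complex.exp_int_mul, norm_mul, Complex.norm_exp, ← mul_add]
      refine mul_le_mul_of_nonneg_left ?_ (by positivity)
      rcases le_total 0 k with hk | hk
      · have hk' : (0 : ℝ) ≤ k := by exact_mod_cast hk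
        refine le_add_of_le_of_nonneg (Real.exp_le_exp.mpr ?_) (Real.exp_nonneg _)
        simp only [Complex.mul_re, Complex.intCast_re, Complex.intCast_im, zero_mul, sub_zero,
          Complex.ofReal_re]
        nlinarith
      · have hk' : (k : ℝ) ≤ 0 := by exact_mod_cast hk
        refine le_add_of_nonneg_of_le (Real.exp_nonneg _) (Real.exp_le_exp.mpr ?_)
        simp only [Complex.mul_re, Complex.intCast_re, Complex.intCast_im, zero_mul, sub_zero,
          Complex.ofReal_re, Complex.neg_re]
        nlinarith
  exact hc.continuousAt (Metric.ball_mem_nhds _ one_pos)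

theorem countable_exp_eq (c : ℂ) : {ξ : ℂ | Complex.exp ξ = c}.Countable := by
  rcases Set.eq_empty_or_nonempty {ξ : ℂ | Complex.exp ξ = c} with h | ⟨ξ₀, h₀⟩
  · rw [h]; exact Set.countable_empty
  refine (Set.countable_range fun n : ℤ => ξ₀ + n * (2 * Real.pi * Complex.I)).mono fun ξ hξ => ?_
  obtain ⟨n, hn⟩ := Complex.exp_eq_exp_iff_exists_int.mp (hξ.trans h₀.symm)
  exact ⟨n, hn.symm⟩

/-- A convergent product vanishes only if one of its factors does, and each factor has countably
many zeros in ξ. -/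
theorem countable_oddTheta_zeros {p : ℂ} (hp : ‖p‖ < 1) : {ξ : ℂ | oddTheta p ξ = 0}.Countable := by
  refine ((Set.countable_iUnion fun j : ℕ => countable_exp_eq (p ^ j)⁻¹).union
    (Set.countable_iUnion fun j : ℕ => countable_exp_eq (p ^ (j + 1)))).mono fun ξ hξ => ?_
  have h1 : theta p (Complex.exp ξ) = 0 := by rw [theta_exp, show oddTheta p ξ = 0 from hξ, mul_zero]
  by_contra h
  refine theta_ne_zero hp (fun j => ?_) h1
  simp only [Set.mem_union, Set.mem_iUnion, Set.mem_ofPred_eq, not_or, not_exists] at h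
  refine mul_ne_zero (fun h2 => h.1 j ?_) (fun h2 => h.2 j ?_)
  · exact eq_inv_of_mul_eq_one_right (sub_eq_zero.mp h2).symm
  · rw [sub_eq_zero, eq_div_iff (Complex.exp_ne_zero _), one_mul] at h2
    exact h2

/-- The properties of the odd theta function on which the theory rests. -/
structure IsOddSigma (s : ℂ → ℂ) : Prop where
  neg : ∀ x, s (-x) = -s x
  three_term : ∀ x y u v, s (x + y) * s (x - y) * (s (u + v) * s (u - v))
    - s (x + u) * s (x - u) * (s (y + v) * s (y - v))
    + s (x + v) * s (x - v) * (s (y + u) * s (y - u)) = 0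
  continuous : Continuous s
  countable_zeros : {x | s x = 0}.Countable

/-- Since s(x+y)s(x-y) is a determinant of the vectors (φ,β) at x and y, the three-term relation is
the Plücker relation for four vectors in a plane. Oddness comes from the same determinant:
exchanging x and y changes its sign and turns s(x-y) into s(y-x), and the common factor s(x+y) may
be chosen nonzero because the zeros are countable. -/
theorem isOddSigma_oddTheta {p : ℂ} (hp : ‖p‖ < 1) : IsOddSigma (oddTheta p) where
  countable_zeros := countable_oddTheta_zeros hp
  continuous := by
    have := continuous_theta_exp hp
    unfold oddTheta
    fun_prop
  three_term x y u v := by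
    obtain ⟨φ, β, h⟩ := exists_oddTheta_mul_oddTheta hp
    simp only [h]
    ring
  neg x := by
    obtain ⟨φ, β, h⟩ := exists_oddTheta_mul_oddTheta hp
    have hc : Continuous (oddTheta p) := by
      have := continuous_theta_exp hp
      unfold oddTheta
      fun_prop
    have key : ∀ d e, oddTheta p e * (oddTheta p (-d) + oddTheta p d) = 0 := fun d e => by
      have h1 := h ((e + d) / 2) ((e - d) / 2)
      have h2 := h ((e - d) / 2) ((e + d) / 2)
      rw [show (e + d) / 2 + (e - d) / 2 = e by ring, show (e + d) / 2 - (e - d) / 2 = d by ring] at h1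
      rw [show (e - d) / 2 + (e + d) / 2 = e by ring, show (e - d) / 2 - (e + d) / 2 = -d by ring] at h2
      rw [mul_add, h1, h2]; ring
    obtain ⟨e, he⟩ : ∃ e, oddTheta p e ≠ 0 := by
      by_contra hcon
      push Not at hcon
      exact not_countable_complex ((countable_oddTheta_zeros hp).mono fun x _ => hcon x)
    exact eq_neg_of_add_eq_zero_left ((mul_eq_zero.mp (key x e)).resolve_left he)

end EllipticHyp

/-! ### Elliptic partial fractions from the three-term relation. -/

namespace EllipticHyp

namespace IsOddSigma

variable {s : ℂ → ℂ} (hs : IsOddSigma s)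
include hs

theorem zero : s 0 = 0 := by
  have := hs.neg 0
  rw [neg_zero] at this
  linear_combination (1 / 2) * this

theorem neg_sub (x y : ℂ) : s (x - y) = -s (y - x) := by
  rw [← hs.neg, _root_.neg_sub]

theorem dense_ne_zero : Dense {x | s x ≠ 0} :=
  hs.countable_zeros.dense_compl ℂ

/-- Two continuous functions that agree whenever a shifted value of `s` is nonzero are equal. -/
theorem eq_zero_of_continuous {F : ℂ → ℂ} (hF : Continuous F) (c : ℂ)
    (h : ∀ t, s (c + t) ≠ 0 → F t = 0) (t : ℂ) : F t = 0 := by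
  have hd : Dense {t | s (c + t) ≠ 0} :=
    hs.dense_ne_zero.preimage (Homeomorph.addLeft c).isOpenMap
  exact congrFun (hF.ext_on hd continuous_const fun t ht => h t ht) t

/-- Products of two factors in a whose zeros have a fixed sum x + y span a plane. This interpolates
s(a-x)s(a-y) by the two members of the plane that vanish at a = r and at a = p. It is the three-term
relation centred at (x+y)/2. -/
theorem three_term_points (a p r x y : ℂ) :
    s (a - x) * s (a - y) * (s (p - r) * s (p + r - x - y))
      = s (p - x) * s (p - y) * (s (a - r) * s (a + r - x - y))
        - s (r - x) * s (r - y) * (s (a - p) * s (a + p - x - y)) := by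
  have h := hs.three_term (a - (x + y) / 2) ((x - y) / 2) (p - (x + y) / 2) (r - (x + y) / 2)
  have h1 := hs.neg_sub ((x - y) / 2) (p - (x + y) / 2)
  have h2 := hs.neg_sub ((x - y) / 2) (r - (x + y) / 2)
  rw [h1, h2] at h
  ring_nf at h ⊢
  linear_combination h

/-- The partial fraction identity with two points. -/
theorem partialFraction_two {a b x y : ℂ} (hab : s (a - b) ≠ 0) (h : a + b = x + y) :
    s (a - x) * s (a - y) / s (a - b) + s (b - x) * s (b - y) / s (b - a) = 0 := by
  rw [hs.neg_sub b a, show b - x = -(a - y) by linear_combination h,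
    show b - y = -(a - x) by linear_combination h, hs.neg, hs.neg]
  field_simp
  ring

/-- The elliptic partial fraction identity. -/
theorem partialFraction {ι : Type*} [DecidableEq ι] (a : ι → ℂ) (m : ℕ) :
    ∀ (S : Finset ι) (B : Multiset ℂ), S.card = m → B.card = m →
      (∀ i ∈ S, ∀ j ∈ S, i ≠ j → s (a i - a j) ≠ 0) → ∑ i ∈ S, a i = B.sum →
      ∑ k ∈ S, (B.map fun b => s (a k - b)).prod / ∏ j ∈ S.erase k, s (a k - a j) = 0 := by
  induction m with
  | zero =>
    intro S B hS hB _ _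
    rw [Finset.card_eq_zero.mp hS, Finset.sum_empty]
  | succ m ih =>
    intro S B hS hB hne hsum
    rcases m with _ | m
    -- With one point the balancing condition makes the zero equal to the point, and s 0 = 0.
    · obtain ⟨i, rfl⟩ := Finset.card_eq_one.mp hS
      obtain ⟨b, rfl⟩ := Multiset.card_eq_one.mp hB
      simp at hsum
      simp [hsum, hs.zero]
    rcases m with _ | m
    · obtain ⟨i, j, hij, rfl⟩ := Finset.card_eq_two.mp hS
      obtain ⟨x, y, rfl⟩ := Multiset.card_eq_two.mp hB
      rw [Finset.sum_pair hij] at hsum ⊢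
      have h1 : ({i, j} : Finset ι).erase i = {j} := by grind
      have h2 : ({i, j} : Finset ι).erase j = {i} := by grind
      rw [h1, h2]
      simp only [Finset.prod_singleton, Multiset.insert_eq_cons, Multiset.map_cons,
        Multiset.map_singleton, Multiset.prod_cons, Multiset.prod_singleton]
      refine hs.partialFraction_two (hne i (by simp) j (by simp) hij) ?_
      simpa using hsum
    obtain ⟨p, hp, r, hr, hpr⟩ := Finset.one_lt_card.mp (by omega : 1 < S.card)
    -- one point can be removed whenever it is also a zero
    have red : ∀ (w z : ℂ) (R : Multiset ℂ) (i : ι), i ∈ S → R.card = m + 1 →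
        ∑ i ∈ S, a i = w + z + R.sum →
        ∑ k ∈ S, s (a k - a i) * s (a k + a i - w - z) * (R.map fun b => s (a k - b)).prod
          / ∏ j ∈ S.erase k, s (a k - a j) = 0 := by
      intro w z R i hi hR hsum
      rw [← Finset.add_sum_erase S _ hi, sub_self, hs.zero, zero_mul, zero_mul, zero_div, zero_add]
      have := ih (S.erase i) ((w + z - a i) ::ₘ R) (by rw [Finset.card_erase_of_mem hi]; omega)
        (by simp [hR]) (fun i1 h1 i2 h2 => hne i1 (Finset.mem_of_mem_erase h1) i2
          (Finset.mem_of_mem_erase h2)) (by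
            rw [Multiset.sum_cons]
            rw [← Finset.add_sum_erase S _ hi] at hsum
            linear_combination hsum)
      rw [← this]
      refine Finset.sum_congr rfl fun k hk => ?_
      have hk' := Finset.mem_erase.mp hk
      have hik : i ∈ S.erase k := Finset.mem_erase.mpr ⟨hk'.1.symm, hi⟩
      rw [← Finset.mul_prod_erase _ _ hik, Finset.erase_right_comm, Multiset.map_cons,
        Multiset.prod_cons, show a k + a i - w - z = a k - (w + z - a i) by ring]
      have := hne k hk'.2 i hi hk'.1
      field_simp
    -- Interpolating the pair of zeros x, y at the points a p and a r writes the sum as a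
    -- combination of two sums, each having a point among its zeros; `red` disposes of both. The
    -- interpolation divides by s(a p - a r) s(a p + a r - x - y), hence the extra hypothesis.
    have step : ∀ (x y : ℂ) (R : Multiset ℂ), R.card = m + 1 → ∑ i ∈ S, a i = x + y + R.sum →
        s (a p + a r - x - y) ≠ 0 →
        ∑ k ∈ S, s (a k - x) * s (a k - y) * (R.map fun b => s (a k - b)).prod
          / ∏ j ∈ S.erase k, s (a k - a j) = 0 := by
      intro x y R hR hsum h0
      have h1 := red x y R r hr hR hsum
      have h2 := red x y R p hp hR hsum
      have h3 := mul_ne_zero (hne p hp r hr hpr) h0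
      refine (mul_eq_zero.mp ?_).resolve_left h3
      rw [show (0 : ℂ) = s (a p - x) * s (a p - y) * 0 - s (a r - x) * s (a r - y) * 0 by ring,
        ← h1]
      nth_rewrite 2 [← h2.trans h1.symm]
      rw [Finset.mul_sum, Finset.mul_sum, Finset.mul_sum, ← Finset.sum_sub_distrib]
      refine Finset.sum_congr rfl fun k hk => ?_
      have h4 := hs.three_term_points (a k) (a p) (a r) x y
      rw [← mul_div_assoc, ← mul_div_assoc, ← mul_div_assoc, ← sub_div]
      congr 1
      linear_combination (R.map fun b => s (a k - b)).prod * h4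
    have pop : ∀ B : Multiset ℂ, 0 < B.card → ∃ x R, B = x ::ₘ R := fun B hB => by
      obtain ⟨x, hx⟩ := Multiset.card_pos_iff_exists_mem.mp hB
      obtain ⟨R, hR⟩ := Multiset.exists_cons_of_mem hx
      exact ⟨x, R, hR⟩
    obtain ⟨x, R1, rfl⟩ := pop B (by omega)
    obtain ⟨y, R2, rfl⟩ := pop R1 (by simp only [Multiset.card_cons] at hB; omega)
    obtain ⟨z, R3, rfl⟩ := pop R2 (by simp only [Multiset.card_cons] at hB; omega)
    simp only [Multiset.card_cons] at hB
    have hs' := hs.continuous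
    -- To remove the extra hypothesis, move x to x - t and a third zero z to z + t. The balance is
    -- preserved and the hypothesis holds for a dense set of t. A third zero is needed, so one and
    -- two points were treated apart.
    have hF : Continuous fun t : ℂ => ∑ k ∈ S, s (a k - (x - t)) * s (a k - y)
        * (s (a k - (z + t)) * (R3.map fun b => s (a k - b)).prod)
          / ∏ j ∈ S.erase k, s (a k - a j) := by
      fun_prop
    have h := hs.eq_zero_of_continuous hF (a p + a r - x - y) (fun t ht => by
      have := step (x - t) y ((z + t) ::ₘ R3) (by simp; omega)
        (by rw [hsum]; simp; ring) (by rwa [show a p + a r - (x - t) - y = a p + a r - x - y + t by ring])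
      simpa using this) 0
    simpa [mul_assoc] using h

end IsOddSigma

end EllipticHyp

/-! ### Additive shifted factorials and Vandermonde products. -/

namespace EllipticHyp

/-- The additive shifted factorial `[x]_k = s(x) s(x+h) ⋯ s(x+(k-1)h)`. -/
noncomputable def bp (s : ℂ → ℂ) (h x : ℂ) (k : ℕ) : ℂ := ∏ j ∈ Finset.range k, s (x + j * h)

section bp

variable (s : ℂ → ℂ) (h : ℂ)

@[simp] theorem bp_zero (x : ℂ) : bp s h x 0 = 1 := by simp [bp]

@[simp] theorem bp_one (x : ℂ) : bp s h x 1 = s x := by simp [bp]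

theorem bp_succ (x : ℂ) (k : ℕ) : bp s h x (k + 1) = bp s h x k * s (x + k * h) :=
  Finset.prod_range_succ _ _

theorem bp_add (x : ℂ) (k m : ℕ) : bp s h x (k + m) = bp s h x k * bp s h (x + k * h) m := by
  unfold bp
  rw [Finset.prod_range_add]
  congr 1
  refine Finset.prod_congr rfl fun j _ => ?_
  push_cast; congr 1; ring

theorem bp_succ' (x : ℂ) (k : ℕ) : bp s h x (k + 1) = s x * bp s h (x + h) k := by
  rw [add_comm, bp_add, bp_one]; simp

theorem bp_shift (x : ℂ) (k : ℕ) : bp s h x k * s (x + k * h) = s x * bp s h (x + h) k := by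
  rw [← bp_succ, bp_succ']

theorem bp_ne_zero {x : ℂ} {k : ℕ} (hx : ∀ j < k, s (x + j * h) ≠ 0) : bp s h x k ≠ 0 :=
  Finset.prod_ne_zero_iff.mpr fun j hj => hx j (Finset.mem_range.mp hj)

theorem bp_eq_zero {x : ℂ} {k j : ℕ} (hj : j < k) (hx : s (x + j * h) = 0) : bp s h x k = 0 :=
  Finset.prod_eq_zero (Finset.mem_range.mpr hj) hx

variable {s}

/-- The factors of the first symbol, read backwards, are the negatives of those of the second. -/
theorem bp_reflect (hs : IsOddSigma s) {x y : ℂ} {k : ℕ} (hxy : x + y + k * h = h) :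
    bp s h x k = (-1) ^ k * bp s h y k := by
  unfold bp
  rw [← Finset.prod_range_reflect, ← Finset.card_range k, ← Finset.prod_const, Finset.card_range,
    ← Finset.prod_mul_distrib]
  refine Finset.prod_congr rfl fun j hj => ?_
  have hj' := Finset.mem_range.mp hj
  rw [show x + ((k - 1 - j : ℕ) : ℂ) * h = -(y + j * h) by
    rw [Nat.cast_sub (by omega), Nat.cast_sub (by omega)]; push_cast; linear_combination hxy,
    hs.neg]
  ring

end bp

/-- The additive Vandermonde product `∏_{j < k} s(z_k - z_j)`. -/
noncomputable def vdm {n : ℕ} (s : ℂ → ℂ) (z : Fin n → ℂ) : ℂ :=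
  ∏ j : Fin n, ∏ k ∈ Finset.Ioi j, s (z k - z j)

/-- Pairing (i,j) with (j,i) lets a full double product be compared factor by factor with a
Vandermonde product. -/
theorem prod_prod_eq_diag_mul {n : ℕ} {M : Type*} [CommMonoid M] (F : Fin n → Fin n → M) :
    ∏ i, ∏ j, F i j = (∏ i, F i i) * ∏ i, ∏ j ∈ Finset.Ioi i, F i j * F j i := by
  have h : ∀ i, ∏ j, F i j = F i i * ((∏ j ∈ Finset.Ioi i, F i j) * ∏ j ∈ Finset.Iio i, F i j) := by
    intro i
    rw [← Finset.mul_prod_erase _ _ (Finset.mem_univ i)]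
    congr 1
    rw [← Finset.prod_union]
    · refine Finset.prod_congr ?_ fun _ _ => rfl
      ext j; simp only [Finset.mem_erase, Finset.mem_univ, Finset.mem_union, Finset.mem_Ioi,
        Finset.mem_Iio, and_true]
      exact ne_comm.trans lt_or_lt_iff_ne.symm
    · rw [Finset.disjoint_left]; intro j h1 h2
      exact absurd (Finset.mem_Ioi.mp h1) (not_lt.mpr (Finset.mem_Iio.mp h2).le)
  simp only [h, Finset.prod_mul_distrib]
  congr 2
  refine Finset.prod_comm' fun i j => ?_
  simp

/-- The Vandermonde product of a shifted point. -/
theorem vdm_shift {n : ℕ} {s : ℂ → ℂ} (hs : IsOddSigma s) (h : ℂ) (x : Fin n → ℂ) (y : Fin n → ℕ) :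
    vdm s (fun i => x i + y i * h) * ∏ i, ∏ j, bp s h (x i - (x j + y j * h)) (y i)
      = (-1) ^ tot y * (vdm s x * ∏ i, ∏ j, bp s h (h + x i - x j) (y i)) := by
  rw [prod_prod_eq_diag_mul, prod_prod_eq_diag_mul, vdm, vdm, tot, ← Finset.prod_pow_eq_pow_sum]
  have h1 : ∀ i, bp s h (x i - (x i + y i * h)) (y i)
      = (-1) ^ y i * bp s h (h + x i - x i) (y i) := fun i =>
    bp_reflect h hs (by ring)
  simp only [h1, Finset.prod_mul_distrib (f := fun i => (-1 : ℂ) ^ y i)]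
  have comb : ∀ A D V P V' P' : ℂ, V * P = V' * P' → V * (A * D * P) = A * (V' * (D * P')) :=
    fun A D V P V' P' H => by linear_combination A * D * H
  apply comb
  rw [← Finset.prod_mul_distrib, ← Finset.prod_mul_distrib]
  refine Finset.prod_congr rfl fun i _ => ?_
  rw [← Finset.prod_mul_distrib, ← Finset.prod_mul_distrib]
  refine Finset.prod_congr rfl fun j _ => ?_
  rw [bp_reflect h hs (x := x i - (x j + y j * h)) (y := x j + y j * h - x i - y i * h + h) (by ring),
    bp_reflect h hs (x := h + x i - x j) (y := x j - x i - y i * h) (by ring)]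
  -- The string of y i + y j + 1 consecutive factors starting at x j - x i - y i h is cut in two
  -- ways; comparing the cuts gives the identity for the pair (i,j).
  have e1 := bp_add s h (x j - x i - y i * h) (y i) (y j + 1)
  have e2 := bp_add s h (x j - x i - y i * h) (y j) (y i + 1)
  rw [show y j + (y i + 1) = y i + (y j + 1) by ring, e1, bp_succ', bp_succ'] at e2
  rw [show x j - x i - y i * h + y i * h = x j - x i by ring,
    show x j - x i - y i * h + y j * h = x j + y j * h - (x i + y i * h) by ring,
    show x j + y j * h - (x i + y i * h) + h = x j + y j * h - x i - y i * h + h by ring,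
    show x j - x i + h = h + x j - x i by ring] at e2
  rw [show x j - (x i + y i * h) = x j - x i - y i * h by ring]
  linear_combination -(-1 : ℂ) ^ y i * e2

end EllipticHyp

/-! ### Contiguous relations for the very-well-poised summand. -/

namespace EllipticHyp

theorem prod_mul_eq_of_ne {ι : Type*} [Fintype ι] [DecidableEq ι] {f g : ι → ℂ} (i : ι) {A B : ℂ}
    (h : f i * A = g i * B) (h' : ∀ l, l ≠ i → f l = g l) : (∏ l, f l) * A = (∏ l, g l) * B := by
  rw [← Finset.mul_prod_erase _ f (Finset.mem_univ i), ← Finset.mul_prod_erase _ g (Finset.mem_univ i),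
    Finset.prod_congr rfl fun l hl => h' l (Finset.ne_of_mem_erase hl)]
  linear_combination (∏ l ∈ Finset.univ.erase i, g l) * h

theorem tot_update_succ {n : ℕ} (k : Fin n → ℕ) (i : Fin n) :
    tot (Function.update k i (k i + 1)) = tot k + 1 := by
  unfold tot
  rw [← Finset.add_sum_erase _ _ (Finset.mem_univ i), ← Finset.add_sum_erase _ k (Finset.mem_univ i),
    Finset.sum_congr rfl fun l hl => Function.update_of_ne (Finset.ne_of_mem_erase hl) _ _]
  simp; ring

/-- Genericity of the parameters of the terminating sum below. -/
structure GenericParams {n : ℕ} (s : ℂ → ℂ) (h α b : ℂ) (z : Fin n → ℂ) : Prop where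
  step : ∀ {x : ℂ} (m : ℤ), m ≠ 0 → x = m * h → s x ≠ 0
  base : ∀ {x : ℂ} (i) (m : ℤ), x = α + z i + m * h → s x ≠ 0
  upper : ∀ {x : ℂ} (m : ℤ), x = b + m * h → s x ≠ 0
  lower : ∀ {x : ℂ} (i) (m : ℤ), x = α + z i - b + m * h → s x ≠ 0
  diff : ∀ {x : ℂ} (i j) (m : ℤ), i ≠ j → x = z i - z j + m * h → s x ≠ 0

/-- The summand of a terminating very-well-poised multiple series, up to normalization. -/
noncomputable def wpTerm {n : ℕ} (s : ℂ → ℂ) (h α b e : ℂ) (z U : Fin n → ℂ) (k : Fin n → ℕ) : ℂ :=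
  vdm s (fun i => z i + k i * h) * (∏ i, s (α + (z i + k i * h) + tot k * h))
    * ((∏ i, bp s h (α + z i) (tot k)) / ∏ i, bp s h (α + h + U i) (tot k))
    * (bp s h b (tot k) / bp s h (α + h - e) (tot k))
    * ((∏ i, bp s h (e + z i) (k i)) / ∏ i, bp s h (α + h + z i - b) (k i))
    * ((∏ i, ∏ j, bp s h (z i - U j) (k i)) / ∏ i, ∏ j, bp s h (h + z i - z j) (k i))

variable {n : ℕ} {s : ℂ → ℂ} {h α b e : ℂ} {z U : Fin n → ℂ}

/-- Field algebra only, separated so that the large products enter as opaque atoms. The same holds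
for `raise_aux`. -/
theorem lower_aux {V W A Q u u₂ β B β₂ c E D X₂ X₁ M Y R N : ℂ} (h1 : u ≠ 0) (h2 : u₂ ≠ 0)
    (h3 : β₂ ≠ 0) (h4 : D ≠ 0) (h5 : R ≠ 0) (h6 : X₂ ≠ 0) (h7 : X₁ ≠ 0) (h8 : Q ≠ 0) :
    V * W * (A / (Q * u / u₂)) * (β * B / β₂ / c) * (E / D) * (M * Y / R / N)
      = β * X₁ / (u * R) * (u₂ * Y / (β₂ * X₂))
        * (V * W * (A / Q) * (B / c) * (E / (X₁ * D / X₂)) * (M / N)) := by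
  field_simp

theorem raise_aux {V W A A₁ A₂ P₁ P₂ u B B₂ c c₂ E E₂ D X₂ X₁ x M M₂ N Y N₂ N₃ : ℂ}
    (h1 : u ≠ 0) (h2 : B₂ ≠ 0) (h3 : D ≠ 0) (h4 : X₂ ≠ 0) (h5 : N ≠ 0) (h6 : Y ≠ 0) (h7 : N₂ ≠ 0)
    (h8 : N₃ ≠ 0) (h9 : X₁ ≠ 0) (h10 : x ≠ 0) :
    V * W * (A * A₁ * A₂ / u / (P₁ * P₂)) * (B * B₂ / (c * c₂)) * (E * E₂ / D) * (M * M₂ / N)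
      * (u * Y / (B₂ * X₂))
      = A₁ * A₂ / P₂ / c * E₂ / (X₁ * x) * M₂ * N₃ / N₂
        * (V * W * (A / P₁) * (B / c₂) * (E / (D * X₂ / (X₁ * x))) * (M / (N * N₃ / (Y * N₂)))) := by
  have e1 : E / (D * X₂ / (X₁ * x)) = E / D * (X₁ * x) / X₂ := by field_simp
  have e2 : M / (N * N₃ / (Y * N₂)) = M / N * (Y * N₂) / N₃ := by field_simp
  have e3 : A * A₁ * A₂ / u / (P₁ * P₂) = A / P₁ * (A₁ * A₂ / P₂) / u := by
    rw [div_mul_div_comm, div_right_comm, mul_assoc]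
  have e4 : B * B₂ / (c * c₂) = B / c₂ * B₂ / c := by
    rw [div_mul_eq_mul_div, div_div, mul_comm c₂]
  rw [e1, e2, e3, e4]
  rw [show E * E₂ / D = E / D * E₂ by ring]
  generalize A / P₁ = a
  generalize B / c₂ = b
  generalize E / D = e
  generalize A₁ * A₂ / P₂ = a'
  rw [show M * M₂ / N = M / N * M₂ by ring]
  generalize M / N = m
  rw [show V * W * (a * a' / u) * (b * B₂ / c) * (e * E₂) * (m * M₂) * (u * Y / (B₂ * X₂))
    = V * W * (a * a' / c) * b * (e * E₂) * m * M₂ * Y / X₂ * (u / u) * (B₂ / B₂) by ring,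
    div_self h1, div_self h2]
  field_simp

/-- Each affected factorial telescopes, and the k-dependent part of the quotient is exactly the
contribution of the point U j in the partial fraction identity used below. Multiplying the summand
by that contribution thus gives a constant times a summand with smaller box and b replaced by b - h.
-/
theorem wpTerm_lower (k : Fin n → ℕ) (j : Fin n)
    (h1 : s (α + U j) ≠ 0) (h2 : s (α + U j + tot k * h) ≠ 0)
    (h3 : s (b - h + tot k * h) ≠ 0) (h4 : ∀ i, bp s h (α + h + z i - b) (k i) ≠ 0)
    (h5 : ∀ i, s (z i - U j) ≠ 0) (h6 : ∀ i, bp s h (α + h + z i - b + h) (k i) ≠ 0)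
    (h7 : ∀ i, s (α + h + z i - b + k i * h) ≠ 0)
    (h8 : ∀ i, s (α + h + z i - b) ≠ 0) (h9 : ∀ i, bp s h (α + h + U i) (tot k) ≠ 0) :
    wpTerm s h α (b - h) e z (Function.update U j (U j - h)) k
      = (s (b - h) * (∏ i, s (α + h + z i - b)) / (s (α + U j) * ∏ i, s (z i - U j)))
        * (s (α + U j + tot k * h) * (∏ i, s (z i + k i * h - U j))
          / (s (b - h + tot k * h) * ∏ i, s (α + h + z i - b + k i * h)))
        * wpTerm s h α b e z U k := by
  have f1 : (∏ i, bp s h (α + h + Function.update U j (U j - h) i) (tot k)) * s (α + U j + tot k * h)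
      = (∏ i, bp s h (α + h + U i) (tot k)) * s (α + U j) := by
    refine prod_mul_eq_of_ne j ?_ fun l hl => by rw [Function.update_of_ne hl]
    rw [Function.update_self]
    have := bp_shift s h (α + U j) (tot k)
    rw [show α + h + (U j - h) = α + U j by ring, this, show α + h + U j = α + U j + h by ring]
    ring
  have f2 := bp_shift s h (b - h) (tot k)
  rw [sub_add_cancel] at f2
  have f3 : (∏ i, bp s h (α + h + z i - b) (k i)) * ∏ i, s (α + h + z i - b + k i * h)
      = (∏ i, s (α + h + z i - b)) * ∏ i, bp s h (α + h + z i - (b - h)) (k i) := by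
    rw [← Finset.prod_mul_distrib, ← Finset.prod_mul_distrib]
    refine Finset.prod_congr rfl fun i _ => ?_
    rw [bp_shift, show α + h + z i - (b - h) = α + h + z i - b + h by ring]
  have f4 : (∏ i, ∏ l, bp s h (z i - Function.update U j (U j - h) l) (k i)) * ∏ i, s (z i - U j)
      = (∏ i, ∏ l, bp s h (z i - U l) (k i)) * ∏ i, s (z i + k i * h - U j) := by
    rw [← Finset.prod_mul_distrib, ← Finset.prod_mul_distrib]
    refine Finset.prod_congr rfl fun i _ => ?_
    refine prod_mul_eq_of_ne j ?_ fun l hl => by rw [Function.update_of_ne hl]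
    rw [Function.update_self, show z i - (U j - h) = z i - U j + h by ring, mul_comm, ← bp_shift,
      show z i - U j + k i * h = z i + k i * h - U j by ring]
  have g3 : (∏ i, bp s h (α + h + z i - (b - h)) (k i)) ≠ 0 :=
    Finset.prod_ne_zero_iff.mpr fun i _ => by
      rw [show α + h + z i - (b - h) = α + h + z i - b + h by ring]; exact h6 i
  have g4 := Finset.prod_ne_zero_iff.mpr fun i (_ : i ∈ Finset.univ) => h4 i
  have g5 := Finset.prod_ne_zero_iff.mpr fun i (_ : i ∈ Finset.univ) => h5 i
  have g7 := Finset.prod_ne_zero_iff.mpr fun i (_ : i ∈ Finset.univ) => h7 i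
  have g8 := Finset.prod_ne_zero_iff.mpr fun i (_ : i ∈ Finset.univ) => h8 i
  have g9 := Finset.prod_ne_zero_iff.mpr fun i (_ : i ∈ Finset.univ) => h9 i
  rw [← eq_div_iff h2] at f1
  rw [← eq_div_iff h3] at f2
  rw [← eq_div_iff g7] at f3
  rw [← eq_div_iff g5] at f4
  unfold wpTerm
  rw [f1, f2, f3, f4]
  exact lower_aux h1 h2 h3 g3 g5 g7 g8 g9

/-- The analogue for the point z i: multiplying by its contribution and advancing k i by one gives a
constant times a summand with α + h, z i + h and the same U. The constant is independent of k, and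
its value is never needed. -/
theorem wpTerm_raise (i : Fin n) (G : GenericParams s h α b z) (he : ∀ m : ℤ, s (α - e + m * h) ≠ 0)
    (hU : ∀ l (m : ℤ), s (α + U l + m * h) ≠ 0) :
    ∃ C, ∀ k : Fin n → ℕ,
      wpTerm s h α b e z U (Function.update k i (k i + 1))
        * (s (α + z i + (tot k + 1) * h)
            * (∏ l, s (z l + (Function.update k i (k i + 1) l : ℕ) * h - z i))
          / (s (b + tot k * h) * ∏ l, s (α + h + z l - b + (Function.update k i (k i + 1) l : ℕ) * h)))
      = C * wpTerm s h (α + h) b e (Function.update z i (z i + h)) U k := by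
  refine ⟨(∏ l, s (α + z l)) * s (α + h + z i) / (∏ l, s (α + h + U l)) / s (α + h - e)
    * s (e + z i) / ((∏ l, s (α + h + z l - b)) * s (α + h + z i - b + h))
    * (∏ j, s (z i - U j)) * (∏ l, if l = i then 1 else s (z l - z i))
    / (∏ j, if j = i then 1 else s (h + z i - z j)), fun k => ?_⟩
  set K := Function.update k i (k i + 1) with hK
  set Z := Function.update z i (z i + h) with hZ
  have Ki : K i = k i + 1 := Function.update_self ..
  have Kl : ∀ l, l ≠ i → K l = k l := fun l hl => Function.update_of_ne hl ..
  have Zi : Z i = z i + h := Function.update_self ..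
  have Zl : ∀ l, l ≠ i → Z l = z l := fun l hl => Function.update_of_ne hl ..
  have tK : tot K = tot k + 1 := tot_update_succ k i
  have hy : ∀ l, Z l + k l * h = z l + K l * h := fun l => by
    by_cases hl : l = i
    · subst hl; rw [Zi, Ki]; push_cast; ring
    · rw [Zl l hl, Kl l hl]
  have f0 : ∏ l, s (α + h + (Z l + k l * h) + tot k * h) = ∏ l, s (α + (z l + K l * h) + tot K * h) :=
    Finset.prod_congr rfl fun l _ => by rw [hy, tK]; push_cast; congr 1; ring
  have f1 : (∏ l, bp s h (α + h + Z l) (tot k)) * (∏ l, s (α + z l)) * s (α + h + z i)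
      = (∏ l, bp s h (α + z l) (tot K)) * s (α + z i + (tot k + 1) * h) := by
    rw [← Finset.prod_mul_distrib]
    refine prod_mul_eq_of_ne i ?_ fun l hl => ?_
    · rw [Zi, tK, mul_assoc, show α + h + (z i + h) = α + z i + h + h by ring,
        show α + h + z i = α + z i + h by ring, mul_left_comm, mul_comm (bp _ _ _ _), ← bp_succ',
        ← bp_succ', bp_succ s h _ (tot k + 1)]
      push_cast; ring
    · rw [Zl l hl, tK, bp_succ', show α + h + z l = α + z l + h by ring, mul_comm]
  have f2 : (∏ l, bp s h (α + h + h + U l) (tot k)) * (∏ l, s (α + h + U l))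
      = ∏ l, bp s h (α + h + U l) (tot K) := by
    rw [← Finset.prod_mul_distrib]
    refine Finset.prod_congr rfl fun l _ => ?_
    rw [tK, bp_succ', mul_comm, show α + h + U l + h = α + h + h + U l by ring]
  have f3 : bp s h b (tot K) = bp s h b (tot k) * s (b + tot k * h) := by rw [tK, bp_succ]
  have f4 : bp s h (α + h - e) (tot K) = s (α + h - e) * bp s h (α + h + h - e) (tot k) := by
    rw [tK, bp_succ', show α + h - e + h = α + h + h - e by ring]
  have f5 : (∏ l, bp s h (e + Z l) (k l)) * s (e + z i) = ∏ l, bp s h (e + z l) (K l) := by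
    rw [← mul_one (∏ l, bp s h (e + z l) (K l))]
    refine prod_mul_eq_of_ne i ?_ fun l hl => ?_
    · rw [Zi, Ki, bp_succ', show e + (z i + h) = e + z i + h by ring]; ring
    · rw [Zl l hl, Kl l hl]
  have f6 : (∏ l, bp s h (α + h + h + Z l - b) (k l)) * (∏ l, s (α + h + z l - b))
        * s (α + h + z i - b + h)
      = (∏ l, bp s h (α + h + z l - b) (K l)) * ∏ l, s (α + h + z l - b + K l * h) := by
    rw [← Finset.prod_mul_distrib, ← Finset.prod_mul_distrib,
      ← mul_one (∏ l, bp s h (α + h + z l - b) (K l) * _)]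
    refine prod_mul_eq_of_ne i ?_ fun l hl => ?_
    · rw [Zi, Ki, mul_assoc, show α + h + h + (z i + h) - b = α + h + z i - b + h + h by ring,
        mul_left_comm, mul_comm (bp _ _ _ _), ← bp_succ', ← bp_succ', bp_succ s h _ (k i + 1),
        mul_one]
    · rw [Zl l hl, Kl l hl, bp_shift, mul_comm, show α + h + h + z l - b = α + h + z l - b + h by ring]
  have f7 : (∏ l, ∏ j, bp s h (Z l - U j) (k l)) * (∏ j, s (z i - U j))
      = ∏ l, ∏ j, bp s h (z l - U j) (K l) := by
    rw [← mul_one (∏ l, ∏ j, bp s h (z l - U j) (K l))]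
    refine prod_mul_eq_of_ne i ?_ fun l hl => ?_
    · rw [Zi, Ki, ← Finset.prod_mul_distrib, mul_one]
      refine Finset.prod_congr rfl fun j _ => ?_
      rw [bp_succ', mul_comm, show z i - U j + h = z i + h - U j by ring]
    · rw [Zl l hl, Kl l hl]
  -- Moving z i by h shifts row i and column i in opposite directions. The diagonal entry keeps its
  -- base point h and changes only its length, so the corrections are 1 at the index i.
  have f8 : (∏ l, ∏ j, bp s h (h + Z l - Z j) (k l)) * (∏ l, s (z l + K l * h - z i))
        * (∏ j, if j = i then 1 else s (h + z i - z j))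
      = (∏ l, ∏ j, bp s h (h + z l - z j) (K l)) * ∏ l, if l = i then 1 else s (z l - z i) := by
    generalize hC : (∏ j, if j = i then 1 else s (h + z i - z j)) = C
    rw [← Finset.prod_mul_distrib, ← Finset.prod_mul_distrib, ← mul_one (∏ l, _ * ite _ _ _)]
    refine prod_mul_eq_of_ne i ?_ fun l hl => ?_
    · rw [← hC, if_pos rfl, mul_one, mul_one, mul_right_comm, ← Finset.prod_mul_distrib,
        ← mul_one (∏ j, bp s h (h + z i - z j) (K i))]
      refine prod_mul_eq_of_ne i ?_ fun j hj => ?_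
      · rw [if_pos rfl, Ki, bp_succ, Nat.cast_succ, mul_one, mul_one,
          show h + Z i - Z i = h + z i - z i by ring,
          show z i + (k i + 1) * h - z i = h + z i - z i + k i * h by ring]
      · rw [if_neg hj, Zi, Zl j hj, Ki, bp_succ', mul_comm,
          show h + z i - z j + h = h + (z i + h) - z j by ring]
    · rw [if_neg hl, Kl l hl]
      refine prod_mul_eq_of_ne i ?_ fun j hj => ?_
      · rw [Zl l hl, Zi, show h + z l - (z i + h) = z l - z i by ring,
          show z l + k l * h - z i = z l - z i + k l * h by ring, bp_shift,
          show h + z l - z i = z l - z i + h by ring, mul_comm]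
      · rw [Zl l hl, Zl j hj]
  have n2 : ∏ l, bp s h (α + h + h + U l) (tot k) ≠ 0 :=
    Finset.prod_ne_zero_iff.mpr fun l _ => bp_ne_zero s h fun j _ => by
      convert hU l (2 + j) using 2; push_cast; ring
  have n2' : ∏ l, s (α + h + U l) ≠ 0 :=
    Finset.prod_ne_zero_iff.mpr fun l _ => by
      convert hU l 1 using 2; push_cast; ring
  have n3 : s (b + tot k * h) ≠ 0 := G.upper (tot k) (by push_cast; ring)
  have n4 : s (α + h - e) ≠ 0 := by convert he 1 using 2; push_cast; ring
  have n6 : ∏ l, bp s h (α + h + h + Z l - b) (k l) ≠ 0 :=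
    Finset.prod_ne_zero_iff.mpr fun l _ => bp_ne_zero s h fun j _ => by
      by_cases hl : l = i
      · subst hl; rw [Zi]; exact G.lower l (3 + j) (by push_cast; ring)
      · rw [Zl l hl]; exact G.lower l (2 + j) (by push_cast; ring)
  have n6a : ∏ l, bp s h (α + h + z l - b) (K l) ≠ 0 :=
    Finset.prod_ne_zero_iff.mpr fun l _ => bp_ne_zero s h fun j _ =>
      G.lower l (1 + j) (by push_cast; ring)
  have n6b : ∏ l, s (α + h + z l - b) ≠ 0 :=
    Finset.prod_ne_zero_iff.mpr fun l _ => G.lower l 1 (by push_cast; ring)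
  have n6c : ∏ l, s (α + h + z l - b + K l * h) ≠ 0 :=
    Finset.prod_ne_zero_iff.mpr fun l _ => G.lower l (1 + K l) (by push_cast; ring)
  have n6d : s (α + h + z i - b + h) ≠ 0 := G.lower i 2 (by push_cast; ring)
  have n8a : ∏ l, ∏ j, bp s h (h + z l - z j) (K l) ≠ 0 :=
    Finset.prod_ne_zero_iff.mpr fun l _ => Finset.prod_ne_zero_iff.mpr fun j _ =>
      bp_ne_zero s h fun m _ => by
        by_cases hl : l = j
        · subst hl; exact G.step (1 + m) (by omega) (by push_cast; ring)
        · exact G.diff l j (1 + m) hl (by push_cast; ring)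
  have n8b : ∏ l, s (z l + K l * h - z i) ≠ 0 :=
    Finset.prod_ne_zero_iff.mpr fun l _ => by
      by_cases hl : l = i
      · subst hl; exact G.step (K l) (by rw [Ki]; omega) (by push_cast; ring)
      · exact G.diff l i (K l) hl (by push_cast; ring)
  have n8c : (∏ j, if j = i then 1 else s (h + z i - z j)) ≠ 0 :=
    Finset.prod_ne_zero_iff.mpr fun l _ => by
      split_ifs with hl
      · exact one_ne_zero
      · exact G.diff i l 1 (Ne.symm hl) (by push_cast; ring)
  have n8d : (∏ l, if l = i then 1 else s (z l - z i)) ≠ 0 :=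
    Finset.prod_ne_zero_iff.mpr fun l _ => by
      split_ifs with hl
      · exact one_ne_zero
      · exact G.diff l i 0 hl (by push_cast; ring)
  have n1 : s (α + z i + (tot k + 1) * h) ≠ 0 := G.base i (tot k + 1) (by push_cast; ring)
  unfold wpTerm
  rw [f0, ← f2, f3, f4, ← f5, ← f7, funext hy]
  rw [mul_assoc, ← eq_div_iff (mul_ne_zero n8b n8c)] at f8
  rw [mul_assoc, ← eq_div_iff (mul_ne_zero n6b n6d)] at f6
  rw [eq_comm, ← eq_div_iff n1] at f1
  rw [f8, f6, f1]
  exact raise_aux n1 n3 n6a n6c n8a n8b n8c n8d n6b n6d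

end EllipticHyp

/-! ### Vanishing of the terminating very-well-poised sum. -/

namespace EllipticHyp

variable {n : ℕ} {s : ℂ → ℂ} {h α b e : ℂ} {z U : Fin n → ℂ}

theorem exists_update_succ {K : Fin n → ℕ} {i : Fin n} (hi : K i ≠ 0) :
    ∃ K' : Fin n → ℕ, K = Function.update K' i (K' i + 1) := by
  refine ⟨Function.update K i (K i - 1), ?_⟩
  rw [Function.update_self, Function.update_idem, Nat.sub_add_cancel (by omega),
    Function.update_eq_self]

namespace GenericParams

theorem lower_shift (G : GenericParams s h α b z) : GenericParams s h α (b - h) z where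
  step := G.step
  base := G.base
  upper m hx := G.upper (m - 1) (by rw [hx]; push_cast; ring)
  lower i m hx := G.lower i (m + 1) (by rw [hx]; push_cast; ring)
  diff := G.diff

theorem raise_shift (G : GenericParams s h α b z) (i : Fin n) :
    GenericParams s h (α + h) b (Function.update z i (z i + h)) where
  step := G.step
  base l m hx := by
    by_cases hl : l = i
    · subst hl; rw [Function.update_self] at hx
      exact G.base l (m + 2) (by rw [hx]; push_cast; ring)
    · rw [Function.update_of_ne hl] at hx
      exact G.base l (m + 1) (by rw [hx]; push_cast; ring)
  upper := G.upper
  lower l m hx := by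
    by_cases hl : l = i
    · subst hl; rw [Function.update_self] at hx
      exact G.lower l (m + 2) (by rw [hx]; push_cast; ring)
    · rw [Function.update_of_ne hl] at hx
      exact G.lower l (m + 1) (by rw [hx]; push_cast; ring)
  diff l j m hlj hx := by
    by_cases hl : l = i
    · subst hl
      rw [Function.update_self, Function.update_of_ne hlj.symm] at hx
      exact G.diff l j (m + 1) hlj (by rw [hx]; push_cast; ring)
    · by_cases hj : j = i
      · subst hj
        rw [Function.update_self, Function.update_of_ne hl] at hx
        exact G.diff l j (m - 1) hlj (by rw [hx]; push_cast; ring)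
      · rw [Function.update_of_ne hl, Function.update_of_ne hj] at hx
        exact G.diff l j m hlj hx

end GenericParams

theorem wpTerm_eq_zero (hs : IsOddSigma s) {k : Fin n → ℕ} {l : Fin n} {m : ℕ} (hm : m < k l)
    (hU : U l = z l + m * h) : wpTerm s h α b e z U k = 0 := by
  have : ∏ i, ∏ j, bp s h (z i - U j) (k i) = 0 :=
    Finset.prod_eq_zero (Finset.mem_univ l) (Finset.prod_eq_zero (Finset.mem_univ l)
      (bp_eq_zero s h hm (by rw [hU, show z l - (z l + m * h) + m * h = 0 by ring, hs.zero])))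
  rw [wpTerm, this, zero_div, mul_zero]

/-- The choice U = z + Kh truncates the sum at K by itself. Hence the smaller sums of the induction
may be taken over the box of the larger one. -/
theorem sum_wpTerm_subset (hs : IsOddSigma s) {K B : Fin n → ℕ} (hKB : K ≤ B) :
    ∑ k ∈ Finset.Icc 0 K, wpTerm s h α b e z (fun i => z i + K i * h) k
      = ∑ k ∈ Finset.Icc 0 B, wpTerm s h α b e z (fun i => z i + K i * h) k := by
  refine Finset.sum_subset (Finset.Icc_subset_Icc_right hKB) fun k _ hk => ?_
  obtain ⟨l, hl⟩ : ∃ l, K l < k l := by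
    by_contra hcon
    push Not at hcon
    exact hk (Finset.mem_Icc.mpr ⟨zero_le, hcon⟩)
  exact wpTerm_eq_zero hs hl rfl

theorem tot_zero : tot (0 : Fin n → ℕ) = 0 := by simp [tot]

theorem wpTerm_zero : wpTerm s h α b e z U 0 = vdm s z * ∏ i, s (α + z i) := by
  simp [wpTerm, tot_zero]

/-- Only the indices 0 and K occur. With e = α + h - b the factors in b and e cancel, and the two
terms are opposite by the Vandermonde shift `vdm_shift` with sign (-1)^1. -/
theorem sum_wpTerm_single (hs : IsOddSigma s) (G : GenericParams s h α b z) (i : Fin n)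
    {K : Fin n → ℕ} (hK : K = Function.update (0 : Fin n → ℕ) i 1) :
    ∑ k ∈ Finset.Icc 0 K, wpTerm s h α b (α + h - b) z (fun i => z i + K i * h) k = 0 := by
  have hKi : K i = 1 := by rw [hK, Function.update_self]
  have hKl : ∀ l, l ≠ i → K l = 0 := fun l hl => by rw [hK, Function.update_of_ne hl]; rfl
  have htot : tot K = 1 := by
    have := tot_update_succ (0 : Fin n → ℕ) i
    rw [tot_zero] at this
    rw [hK]; exact this
  have h0K : (0 : Fin n → ℕ) ≠ K := fun h0 => by
    have := congrFun h0 i; rw [hKi] at this; exact absurd this (by simp)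
  have hI : Finset.Icc 0 K = {0, K} := by
    ext k
    simp only [Finset.mem_Icc, zero_le, true_and, Finset.mem_insert, Finset.mem_singleton]
    constructor
    · intro hk
      have h1 := hk i
      rw [hKi] at h1
      rcases Nat.le_one_iff_eq_zero_or_eq_one.mp h1 with h2 | h2
      · left; funext l
        by_cases hl : l = i
        · subst hl; exact h2
        · have := hk l; rw [hKl l hl] at this; exact Nat.le_zero.mp this
      · right; funext l
        by_cases hl : l = i
        · subst hl; rw [h2, hKi]
        · have := hk l; rw [hKl l hl] at this ⊢; exact Nat.le_zero.mp this
    · rintro (rfl | rfl)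
      · exact zero_le
      · exact le_rfl
  rw [hI, Finset.sum_pair h0K, wpTerm_zero]
  have hv := vdm_shift hs h z K
  rw [htot, pow_one] at hv
  have c1 : ∀ l, s (α + (z l + K l * h) + (1 : ℕ) * h) = bp s h (α + h + (z l + K l * h)) 1 := fun l => by
    rw [bp_one]; congr 1; push_cast; ring
  have n1 : ∏ l, bp s h (α + h + (z l + K l * h)) 1 ≠ 0 :=
    Finset.prod_ne_zero_iff.mpr fun l _ => by
      rw [bp_one]; exact G.base l (1 + K l) (by push_cast; ring)
  have n2 : bp s h b 1 ≠ 0 := by rw [bp_one]; exact G.upper 0 (by push_cast; ring)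
  have n3 : ∏ l, bp s h (α + h + z l - b) (K l) ≠ 0 :=
    Finset.prod_ne_zero_iff.mpr fun l _ => bp_ne_zero s h fun j _ =>
      G.lower l (1 + j) (by push_cast; ring)
  have n4 : ∏ l, ∏ j, bp s h (h + z l - z j) (K l) ≠ 0 :=
    Finset.prod_ne_zero_iff.mpr fun l _ => Finset.prod_ne_zero_iff.mpr fun j _ =>
      bp_ne_zero s h fun m _ => by
        by_cases hl : l = j
        · subst hl; exact G.step (1 + m) (by omega) (by push_cast; ring)
        · exact G.diff l j (1 + m) hl (by push_cast; ring)
  unfold wpTerm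
  simp only [htot]
  rw [Finset.prod_congr rfl fun l _ => c1 l, show α + h - (α + h - b) = b by ring, div_self n2]
  simp only [show ∀ l, α + h - b + z l = α + h + z l - b from fun l => by ring]
  rw [div_self n3, Finset.prod_congr rfl fun l _ => bp_one s h (α + z l)]
  generalize ∏ l, bp s h (α + h + (z l + K l * h)) 1 = P at *
  generalize ∏ l, ∏ j, bp s h (h + z l - z j) (K l) = Q at *
  generalize ∏ i, ∏ j, bp s h (z i - (z j + K j * h)) (K i) = R at *
  field_simp
  linear_combination (∏ l, s (α + z l)) * hv

/-- The terminating very-well-poised sum vanishes unless it is empty. -/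
theorem sum_wpTerm_eq_zero (hs : IsOddSigma s) (N : ℕ) :
    ∀ (K : Fin n → ℕ) (z : Fin n → ℂ) (α b : ℂ), tot K = N + 1 → GenericParams s h α b z →
      ∑ k ∈ Finset.Icc 0 K, wpTerm s h α b (α + (N + 1) * h - b) z (fun i => z i + K i * h) k
        = 0 := by
  induction N with
  | zero =>
    intro K z α b hK G
    obtain ⟨i, hi⟩ : ∃ i, K i ≠ 0 := by
      by_contra hcon
      push Not at hcon
      simp [tot, hcon] at hK
    obtain ⟨K', hK'⟩ := exists_update_succ hi
    have h0 : tot K' = 0 := by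
      have := tot_update_succ K' i
      rw [← hK', hK] at this
      omega
    have h1 : K' = 0 := by
      funext l
      exact (Finset.sum_eq_zero_iff.mp h0) l (Finset.mem_univ l)
    subst h1
    have := sum_wpTerm_single hs G i (K := K) hK'
    simpa using this
  | succ N ih =>
    intro K z α b hK G
    obtain ⟨i, hi⟩ : ∃ i, K i ≠ 0 := by
      by_contra hcon
      push Not at hcon
      simp [tot, hcon] at hK
    -- Both reductions lower |K| by one and keep e: b becomes b - h in the first, α becomes α + h in
    -- the second.
    set e := α + ((N + 1 : ℕ) + 1) * h - b with he
    set U : Fin n → ℂ := fun i => z i + K i * h with hU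
    -- The free zero Z is determined by the balancing condition of the partial fraction. Since |k|
    -- cancels there and |K| = N + 2, it is independent of k.
    set Z := z i + b + (N + 1) * h with hZ
    -- This is the numerator at the point b - α - h, up to sign and without the factor containing Z.
    -- Dividing by it makes the contribution of that point constant in k.
    set D : (Fin n → ℕ) → ℂ := fun k =>
      s (b - h + tot k * h) * ∏ l, s (α + h + z l - b + k l * h) with hD
    have hD0 : ∀ k, D k ≠ 0 := fun k =>
      mul_ne_zero (G.upper (tot k - 1) (by push_cast; ring))
        (Finset.prod_ne_zero_iff.mpr fun l _ => G.lower l (1 + k l) (by push_cast; ring))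
    -- the contributions that reduce to smaller sums
    have hlow : ∀ j, ∑ k ∈ Finset.Icc 0 K,
        s (α + U j + tot k * h) * (∏ l, s (z l + k l * h - U j)) / D k * wpTerm s h α b e z U k = 0 := by
      intro j
      by_cases hj : K j = 0
      · refine Finset.sum_eq_zero fun k hk => ?_
        have hkj : k j = 0 := Nat.le_zero.mp (hj ▸ (Finset.mem_Icc.mp hk).2 j)
        rw [Finset.prod_eq_zero (Finset.mem_univ j) (by simp only [hU, hj, hkj, sub_self, hs.zero])]
        simp
      · obtain ⟨K', hK'⟩ := exists_update_succ hj
        have htot : tot K' = N + 1 := by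
          have := tot_update_succ K' j
          rw [← hK', hK] at this
          omega
        have hle : K' ≤ K := fun l => by
          rw [hK']
          by_cases hl : l = j
          · subst hl; simp
          · rw [Function.update_of_ne hl]
        have h1 := ih K' z α (b - h) htot G.lower_shift
        rw [sum_wpTerm_subset hs hle] at h1
        have hU' : (fun i => z i + K' i * h) = Function.update U j (U j - h) := by
          funext l
          by_cases hl : l = j
          · subst hl
            rw [Function.update_self]
            simp only [hU]
            rw [hK', Function.update_self]; push_cast; ring
          · rw [Function.update_of_ne hl]
            simp only [hU]
            rw [hK', Function.update_of_ne hl]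
        have he' : α + (N + 1) * h - (b - h) = e := by rw [he]; push_cast; ring
        have n5 : ∀ l, s (z l - U j) ≠ 0 := fun l => by
          by_cases hl : l = j
          · subst hl; exact G.step (-(K l : ℤ)) (by omega) (by simp only [hU]; push_cast; ring)
          · exact G.diff l j (-(K j : ℤ)) hl (by simp only [hU]; push_cast; ring)
        rw [hU', he', Finset.sum_congr rfl fun k _ => wpTerm_lower k j
          (G.base j (K j) (by simp only [hU]; push_cast; ring))
          (G.base j (K j + tot k) (by simp only [hU]; push_cast; ring))
          (G.upper (tot k - 1) (by push_cast; ring))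
          (fun l => bp_ne_zero s h fun m _ => G.lower l (1 + m) (by push_cast; ring))
          n5 (fun l => bp_ne_zero s h fun m _ => G.lower l (2 + m) (by push_cast; ring))
          (fun l => G.lower l (1 + k l) (by push_cast; ring))
          (fun l => G.lower l 1 (by push_cast; ring))
          (fun l => bp_ne_zero s h fun m _ => G.base l (1 + K l + m) (by
            simp only [hU]; push_cast; ring))] at h1
        simp only [mul_assoc] at h1
        rw [← Finset.mul_sum] at h1
        refine Eq.trans (Finset.sum_congr rfl fun k _ => ?_) ((mul_eq_zero.mp h1).resolve_left ?_)
        · ring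
        · refine div_ne_zero (mul_ne_zero (G.upper (-1) (by push_cast; ring)) ?_)
            (mul_ne_zero (G.base j (K j) (by simp only [hU]; push_cast; ring)) ?_)
          · exact Finset.prod_ne_zero_iff.mpr fun l _ => G.lower l 1 (by push_cast; ring)
          · exact Finset.prod_ne_zero_iff.mpr fun l _ => n5 l
    have hraise : ∑ k ∈ Finset.Icc 0 K,
        s (α + z i + tot k * h) * (∏ l, s (z l + k l * h - z i)) / D k * wpTerm s h α b e z U k = 0 := by
      obtain ⟨K', hK'⟩ := exists_update_succ hi
      have htot : tot K' = N + 1 := by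
        have := tot_update_succ K' i
        rw [← hK', hK] at this
        omega
      have h1 := ih K' (Function.update z i (z i + h)) (α + h) b htot (G.raise_shift i)
      have hU' : (fun l => Function.update z i (z i + h) l + K' l * h) = U := by
        funext l
        simp only [hU]
        by_cases hl : l = i
        · subst hl
          rw [hK', Function.update_self, Function.update_self]; push_cast; ring
        · rw [hK', Function.update_of_ne hl, Function.update_of_ne hl]
      have he' : α + h + (N + 1) * h - b = e := by rw [he]; push_cast; ring
      rw [hU', he'] at h1
      obtain ⟨C, hC⟩ := wpTerm_raise (U := U) (e := e) i G
        (fun m => G.upper (m - N - 2) (by rw [he]; push_cast; ring))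
        (fun l m => G.base l (m + K l) (by simp only [hU]; push_cast; ring))
      have h2 := congrArg (fun x => C * x) h1
      simp only [mul_zero] at h2
      rw [Finset.mul_sum] at h2
      rw [← h2]
      symm
      -- Indices with k i = 0 are killed by the factor s(z i + k i h - z i); the others are
      -- successors in direction i.
      refine Finset.sum_of_injOn (fun k => Function.update k i (k i + 1)) ?_ ?_ ?_ ?_
      · intro k _ k' _ hkk
        funext l
        have := congrFun hkk l
        by_cases hl : l = i
        · subst hl; simpa using this
        · simpa [Function.update_of_ne hl] using this
      · intro k hk
        have hk' := (Finset.mem_Icc.mp hk).2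
        refine Finset.mem_coe.mpr (Finset.mem_Icc.mpr ⟨zero_le, fun l => ?_⟩)
        rw [hK']
        by_cases hl : l = i
        · subst hl; simpa using hk' l
        · simpa [Function.update_of_ne hl] using hk' l
      · intro k hk hk'
        have hki : k i = 0 := by
          by_contra hne
          obtain ⟨k', rfl⟩ := exists_update_succ hne
          refine hk' ⟨k', Finset.mem_coe.mpr (Finset.mem_Icc.mpr ⟨zero_le, fun l => ?_⟩), rfl⟩
          have := (Finset.mem_Icc.mp hk).2 l
          rw [hK'] at this
          by_cases hl : l = i
          · subst hl; simpa using this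
          · simpa [Function.update_of_ne hl] using this
        rw [Finset.prod_eq_zero (Finset.mem_univ i) (by simp [hki, hs.zero])]
        simp
      · intro k _
        rw [← hC]
        simp only [hD, tot_update_succ]
        push_cast
        rw [show b - h + (tot k + 1) * h = b + tot k * h by ring]
        ring
    -- the partial fraction identity
    let a : Option (Option (Fin n)) → ℂ :=
      fun o => o.elim (b - α - h) fun o => o.elim (z i) U
    -- The points z i and U i would coincide if K i = 0, which the choice of i excludes.
    have hne : ∀ u ∈ (Finset.univ : Finset (Option (Option (Fin n)))), ∀ v ∈ Finset.univ,
        u ≠ v → s (a u - a v) ≠ 0 := by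
      have anti : ∀ x y, s (x - y) ≠ 0 → s (y - x) ≠ 0 := fun x y hxy => by
        rw [hs.neg_sub]; exact neg_ne_zero.mpr hxy
      have e1 : s (z i - (b - α - h)) ≠ 0 := G.lower i 1 (by push_cast; ring)
      have e2 : ∀ j, s (U j - (b - α - h)) ≠ 0 := fun j =>
        G.lower j (K j + 1) (by simp only [hU]; push_cast; ring)
      have e3 : ∀ j, s (U j - z i) ≠ 0 := fun j => by
        by_cases hj : j = i
        · subst hj; exact G.step (K j) (by omega) (by simp only [hU]; push_cast; ring)
        · exact G.diff j i (K j) hj (by simp only [hU]; push_cast; ring)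
      rintro (_ | _ | j) - (_ | _ | l) - huv
      · exact absurd rfl huv
      · exact anti _ _ e1
      · exact anti _ _ (e2 l)
      · exact e1
      · exact absurd rfl huv
      · exact anti _ _ (e3 l)
      · exact e2 j
      · exact e3 j
      · have hjl : j ≠ l := fun h0 => huv (by rw [h0])
        exact G.diff j l (K j - K l) hjl (by simp only [a, hU, Option.elim]; push_cast; ring)
    set d : Option (Option (Fin n)) → ℂ := fun u => ∏ v ∈ Finset.univ.erase u, s (a u - a v) with hd
    have hdP : d none ≠ 0 := Finset.prod_ne_zero_iff.mpr fun v hv =>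
      hne _ (Finset.mem_univ _) _ (Finset.mem_univ _) (Finset.ne_of_mem_erase hv).symm
    -- The n + 2 zeros are -α - |k|h, Z and the z l + k l h.
    have hpf : ∀ k : Fin n → ℕ,
        s (b - h + tot k * h) * (s (b - α - h - Z) * ∏ l, s (b - α - h - (z l + k l * h))) / d none
        + (s (z i + α + tot k * h) * (s (z i - Z) * ∏ l, s (z i - (z l + k l * h))) / d (some none)
        + ∑ j, s (U j + α + tot k * h) * (s (U j - Z) * ∏ l, s (U j - (z l + k l * h)))
            / d (some (some j))) = 0 := by
      intro k
      have := hs.partialFraction a (n + 2) Finset.univ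
        ((-α - tot k * h) ::ₘ Z ::ₘ (Finset.univ.val.map fun l => z l + k l * h))
        (by simp) (by simp) hne (by
          have hK2 : (∑ l, (K l : ℂ)) = N + 2 := by
            rw [← Nat.cast_sum, show ∑ l, K l = tot K from rfl, hK]; push_cast; ring
          have hk2 : (∑ l, (k l : ℂ)) = tot k := by rw [← Nat.cast_sum]; rfl
          rw [Fintype.sum_option, Fintype.sum_option, Multiset.sum_cons, Multiset.sum_cons,
            ← Finset.sum_eq_multiset_sum]
          simp only [a, Option.elim, hU, Finset.sum_add_distrib, ← Finset.sum_mul, hK2, hk2, hZ]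
          ring)
      rw [Fintype.sum_option, Fintype.sum_option] at this
      simp only [Multiset.map_cons, Multiset.prod_cons, Multiset.map_map, Function.comp] at this
      simp only [← Finset.prod_eq_multiset_prod] at this
      rw [← this]
      simp only [hd, a, Option.elim]
      have r1 : b - α - h - (-α - tot k * h) = b - h + tot k * h := by ring
      have r2 : ∀ w, w - (-α - tot k * h) = w + α + tot k * h := fun w => by ring
      rw [r1, r2]
      simp only [r2]
    have flip : ∀ (w : ℂ) (k : Fin n → ℕ), ∏ l, s (w - (z l + k l * h))
        = (-1) ^ n * ∏ l, s (z l + k l * h - w) := fun w k => by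
      rw [Finset.prod_congr rfl fun l _ => hs.neg_sub w (z l + k l * h), Finset.prod_neg]
      simp
    have hterm : ∀ k : Fin n → ℕ, s (b - α - h - Z) / d none * wpTerm s h α b e z U k
        + s (z i - Z) / d (some none) * (s (α + z i + tot k * h) * (∏ l, s (z l + k l * h - z i)) / D k
            * wpTerm s h α b e z U k)
        + ∑ j, s (U j - Z) / d (some (some j)) * (s (α + U j + tot k * h)
            * (∏ l, s (z l + k l * h - U j)) / D k * wpTerm s h α b e z U k) = 0 := by
      intro k
      have h1 := hpf k
      simp only [flip] at h1
      have h2 : (∏ l, s (z l + k l * h - (b - α - h))) = ∏ l, s (α + h + z l - b + k l * h) :=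
        Finset.prod_congr rfl fun l _ => by congr 1; ring
      rw [h2] at h1
      have h3 := congrArg (fun x => (-1) ^ n * wpTerm s h α b e z U k / D k * x) h1
      simp only [mul_zero, mul_add, Finset.mul_sum] at h3
      have hsq : ((-1 : ℂ) ^ n) * (-1) ^ n = 1 := by rw [← mul_pow]; simp
      have hDk := hD0 k
      have hDe : D k = s (b - h + tot k * h) * ∏ l, s (α + h + z l - b + k l * h) := rfl
      rw [← h3, ← add_assoc]
      congr 1
      · congr 1
        · rw [show s (b - α - h - Z) / d none * wpTerm s h α b e z U k
            = s (b - α - h - Z) / d none * wpTerm s h α b e z U k * (D k / D k)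
              * ((-1) ^ n * (-1) ^ n) by rw [div_self hDk, hsq]; ring]
          nth_rewrite 1 [hDe]
          ring
        · rw [show z i + α + tot k * h = α + z i + tot k * h by ring]
          linear_combination -(s (z i - Z) / d (some none) * (s (α + z i + tot k * h)
            * (∏ l, s (z l + k l * h - z i)) / D k * wpTerm s h α b e z U k)) * hsq
      · refine Finset.sum_congr rfl fun j _ => ?_
        rw [show U j + α + tot k * h = α + U j + tot k * h by ring]
        linear_combination -(s (U j - Z) / d (some (some j)) * (s (α + U j + tot k * h)
            * (∏ l, s (z l + k l * h - U j)) / D k * wpTerm s h α b e z U k)) * hsq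
    -- Summed over k, the contributions of z i and of all U j vanish, which leaves a constant times
    -- the original sum.
    have hsum := Finset.sum_congr rfl fun k (_ : k ∈ Finset.Icc 0 K) => hterm k
    rw [Finset.sum_const_zero, Finset.sum_add_distrib, Finset.sum_add_distrib, ← Finset.mul_sum,
      ← Finset.mul_sum, hraise, Finset.sum_comm] at hsum
    simp only [← Finset.mul_sum, hlow, mul_zero, Finset.sum_const_zero, add_zero] at hsum
    -- That constant is nonzero: Z turns b - α - h - Z into -(α + z i + (N+2)h), which genericity
    -- covers.
    refine (mul_eq_zero.mp hsum).resolve_left (div_ne_zero ?_ hdP)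
    rw [show b - α - h - Z = -(α + z i + ((N + 2 : ℕ) : ℤ) * h) by rw [hZ]; push_cast; ring, hs.neg]
    exact neg_ne_zero.mpr (G.base i _ rfl)

end EllipticHyp

/-! ### The triangular matrices and their inverses. -/

namespace EllipticHyp

variable {n : ℕ}

section Matrices

variable (s : ℂ → ℂ) (h α c : ℂ) (x : Fin n → ℂ) (N : Fin n → ℕ)

/-- The very-well-poised factor of the point `x + sh`. -/
noncomputable def wpFactor (k : Fin n → ℕ) : ℂ :=
  vdm s (fun i => x i + k i * h) * ∏ i, s (α + (x i + k i * h) + tot k * h)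

/-- The lower triangular matrix whose product with its transpose expands `f_u(y)`. -/
noncomputable def lowerMat (u k : Fin n → ℕ) : ℂ :=
  (bp s h (c + tot u * h) (tot k) * ∏ i, ∏ j, bp s h (x i - (x j + u j * h)) (k i))
    / ((∏ i, bp s h (α + h + (x i + u i * h)) (tot k))
      * ∏ i, bp s h (α + h - tot u * h + x i - c) (k i))

/-- The part of the summand of `g_v(y)` that depends on `v`; the summation index is `N - k`. -/
noncomputable def upperFactor (v k : Fin n → ℕ) : ℂ :=
  (bp s h (-(tot v * h) - tot N * h - c) (tot N - tot k)
      * ∏ i, ∏ j, bp s h (x j + v j * h - (x i + N i * h)) (N i - k i))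
    / ((∏ i, bp s h (h - tot N * h - α - (x i + v i * h)) (tot N - tot k))
      * ∏ i, bp s h (h - α - (x i + N i * h) + tot v * h + c) (N i - k i))

open Classical in
/-- The inverse of `lowerMat`. -/
noncomputable def lowerInv (k v : Fin n → ℕ) : ℂ :=
  if v ≤ k then wpFactor s h α x k * upperFactor s h α c x N v k
    / (wpFactor s h α x v * upperFactor s h α c x N v v * lowerMat s h α c x v v) else 0

end Matrices

theorem tot_add (u v : Fin n → ℕ) : tot (u + v) = tot u + tot v := by
  simp [tot, Finset.sum_add_distrib]

theorem tot_mono {u v : Fin n → ℕ} (huv : u ≤ v) : tot u ≤ tot v :=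
  Finset.sum_le_sum fun i _ => huv i

variable {s : ℂ → ℂ} {h α c : ℂ} {x : Fin n → ℂ} {N : Fin n → ℕ}

/-- The last r factors of the symbol of length P, reversed and negated, form the symbol at z. This
turns factorials of length N - k into factorials of length k. -/
theorem bp_reverse (hs : IsOddSigma s) {y z : ℂ} {P r : ℕ} (hr : r ≤ P) (hyz : z + y + P * h = h) :
    bp s h y (P - r) * bp s h z r = (-1) ^ r * bp s h y P := by
  obtain ⟨m, rfl⟩ := Nat.exists_eq_add_of_le hr
  rw [Nat.add_sub_cancel_left, add_comm r m, bp_add,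
    bp_reflect h hs (x := y + m * h) (y := z) (by push_cast at hyz; linear_combination hyz)]
  have : ((-1 : ℂ) ^ r) * (-1) ^ r = 1 := by rw [← mul_pow]; simp
  linear_combination (-(bp s h y m * bp s h z r)) * this

theorem lowerMat_eq_zero (hs : IsOddSigma s) {u k : Fin n → ℕ} (huk : ¬ k ≤ u) :
    lowerMat s h α c x u k = 0 := by
  obtain ⟨l, hl⟩ : ∃ l, u l < k l := by
    by_contra hcon
    push Not at hcon
    exact huk hcon
  have : ∏ i, ∏ j, bp s h (x i - (x j + u j * h)) (k i) = 0 :=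
    Finset.prod_eq_zero (Finset.mem_univ l) (Finset.prod_eq_zero (Finset.mem_univ l)
      (bp_eq_zero s h hl (by rw [show x l - (x l + u l * h) + u l * h = 0 by ring, hs.zero])))
  rw [lowerMat, this, mul_zero, zero_div]

namespace GenericParams

variable (G : GenericParams s h α c x)
include G

theorem shift (v : Fin n → ℕ) (M : ℕ) :
    GenericParams s h (α + tot v * h) (c + M * h) (fun i => x i + v i * h) where
  step := G.step
  base i m hx := G.base i (m + tot v + v i) (by rw [hx]; push_cast; ring)
  upper m hx := G.upper (m + M) (by rw [hx]; push_cast; ring)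
  lower i m hx := G.lower i (m + tot v + v i - M) (by rw [hx]; push_cast; ring)
  diff i j m hij hx := G.diff i j (m + v i - v j) hij (by rw [hx]; push_cast; ring)

theorem vdm_ne_zero (k : Fin n → ℕ) : vdm s (fun i => x i + k i * h) ≠ 0 :=
  Finset.prod_ne_zero_iff.mpr fun j _ => Finset.prod_ne_zero_iff.mpr fun i hi =>
    G.diff i j (k i - k j) (Finset.mem_Ioi.mp hi).ne' (by push_cast; ring)

theorem wpFactor_ne_zero (k : Fin n → ℕ) : wpFactor s h α x k ≠ 0 :=
  mul_ne_zero (G.vdm_ne_zero k) (Finset.prod_ne_zero_iff.mpr fun i _ =>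
    G.base i (k i + tot k) (by push_cast; ring))

theorem lowerMat_self_ne_zero (v : Fin n → ℕ) : lowerMat s h α c x v v ≠ 0 := by
  refine div_ne_zero (mul_ne_zero ?_ ?_) (mul_ne_zero ?_ ?_)
  · exact bp_ne_zero s h fun j _ => G.upper (tot v + j) (by push_cast; ring)
  · refine Finset.prod_ne_zero_iff.mpr fun i _ => Finset.prod_ne_zero_iff.mpr fun j _ =>
      bp_ne_zero s h fun m hm => ?_
    by_cases hij : i = j
    · subst hij
      exact G.step (m - v i) (by omega) (by push_cast; ring)
    · exact G.diff i j (m - v j) hij (by push_cast; ring)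
  · exact Finset.prod_ne_zero_iff.mpr fun i _ => bp_ne_zero s h fun j _ =>
      G.base i (1 + v i + j) (by push_cast; ring)
  · exact Finset.prod_ne_zero_iff.mpr fun i _ => bp_ne_zero s h fun j _ =>
      G.lower i (1 - tot v + j) (by push_cast; ring)

theorem upperFactor_ne_zero (hs : IsOddSigma s) {v k : Fin n → ℕ} (hvk : v ≤ k) :
    upperFactor s h α c x N v k ≠ 0 := by
  have neg : ∀ w, s (-w) ≠ 0 → s w ≠ 0 := fun w hw h0 => hw (by rw [hs.neg, h0, neg_zero])
  refine div_ne_zero (mul_ne_zero ?_ ?_) (mul_ne_zero ?_ ?_)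
  · exact bp_ne_zero s h fun j _ => neg _ (G.upper (tot v + tot N - j) (by push_cast; ring))
  · refine Finset.prod_ne_zero_iff.mpr fun i _ => Finset.prod_ne_zero_iff.mpr fun j _ =>
      bp_ne_zero s h fun m hm => ?_
    by_cases hij : i = j
    · subst hij
      have : v i ≤ k i := hvk i
      -- Here m < N i - k i ≤ N i - v i, so the multiple of h is strictly negative; this is where v
      -- ≤ k is used.
      exact G.step (m + v i - N i) (by omega) (by push_cast; ring)
    · exact G.diff j i (m + v j - N i) (Ne.symm hij) (by push_cast; ring)
  · exact Finset.prod_ne_zero_iff.mpr fun i _ => bp_ne_zero s h fun j _ =>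
      neg _ (G.base i (-1 + tot N + v i - j) (by push_cast; ring))
  · exact Finset.prod_ne_zero_iff.mpr fun i _ => bp_ne_zero s h fun j _ =>
      neg _ (G.lower i (-1 + N i - tot v - j) (by push_cast; ring))

/-- Reversing the order of the factors in `upperFactor`. -/
theorem upperFactor_add (hs : IsOddSigma s) {v k : Fin n → ℕ} (hvk : v + k ≤ N) :
    upperFactor s h α c x N v (v + k) * (bp s h (c + 2 * tot v * h + h) (tot k)
        * ∏ i, ∏ j, bp s h (h + (x i + v i * h) - (x j + v j * h)) (k i))
      = upperFactor s h α c x N v v * ((∏ i, bp s h (α + tot v * h + (x i + v i * h)) (tot k))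
        * ∏ i, bp s h (α - tot v * h - c + (x i + v i * h)) (k i)) := by
  have htot := tot_mono hvk
  rw [tot_add] at htot
  have hi : ∀ i, v i + k i ≤ N i := fun i => hvk i
  have c1 : ((tot N - tot v : ℕ) : ℂ) = tot N - tot v := Nat.cast_sub (by omega)
  have c2 : ∀ i, ((N i - v i : ℕ) : ℂ) = N i - v i := fun i => Nat.cast_sub (by have := hi i; omega)
  have f1 := bp_reverse (h := h) hs (y := -(tot v * h) - tot N * h - c) (z := c + 2 * tot v * h + h)
    (P := tot N - tot v) (r := tot k) (by omega) (by rw [c1]; ring)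
  have f2 : ∀ i j, bp s h (x j + v j * h - (x i + N i * h)) (N i - v i - k i)
      * bp s h (h + (x i + v i * h) - (x j + v j * h)) (k i)
      = (-1) ^ k i * bp s h (x j + v j * h - (x i + N i * h)) (N i - v i) := fun i j =>
    bp_reverse hs (by have := hi i; omega) (by rw [c2]; ring)
  have f3 : ∀ i, bp s h (h - tot N * h - α - (x i + v i * h)) (tot N - tot v - tot k)
      * bp s h (α + tot v * h + (x i + v i * h)) (tot k)
      = (-1) ^ tot k * bp s h (h - tot N * h - α - (x i + v i * h)) (tot N - tot v) := fun i =>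
    bp_reverse hs (by omega) (by rw [c1]; ring)
  have f4 : ∀ i, bp s h (h - α - (x i + N i * h) + tot v * h + c) (N i - v i - k i)
      * bp s h (α - tot v * h - c + (x i + v i * h)) (k i)
      = (-1) ^ k i * bp s h (h - α - (x i + N i * h) + tot v * h + c) (N i - v i) := fun i =>
    bp_reverse hs (by have := hi i; omega) (by rw [c2]; ring)
  have g2 := Finset.prod_congr rfl fun i (_ : i ∈ Finset.univ) =>
    Finset.prod_congr rfl fun j (_ : j ∈ Finset.univ) => f2 i j
  have g3 := Finset.prod_congr rfl fun i (_ : i ∈ Finset.univ) => f3 i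
  have g4 := Finset.prod_congr rfl fun i (_ : i ∈ Finset.univ) => f4 i
  simp only [Finset.prod_mul_distrib, Finset.prod_const, Finset.card_univ, Fintype.card_fin,
    Finset.prod_pow_eq_pow_sum, Finset.prod_pow] at g2 g3 g4
  rw [show ∑ i, k i = tot k from rfl] at g2 g4
  have neg : ∀ w, s (-w) ≠ 0 → s w ≠ 0 := fun w hw h0 => hw (by rw [hs.neg, h0, neg_zero])
  have n3 : ∀ m, ∏ i, bp s h (h - tot N * h - α - (x i + v i * h)) m ≠ 0 := fun m =>
    Finset.prod_ne_zero_iff.mpr fun i _ => bp_ne_zero s h fun j _ =>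
      neg _ (G.base i (-1 + tot N + v i - j) (by push_cast; ring))
  have n4 : ∀ m : Fin n → ℕ, ∏ i, bp s h (h - α - (x i + N i * h) + tot v * h + c) (m i) ≠ 0 :=
    fun m => Finset.prod_ne_zero_iff.mpr fun i _ => bp_ne_zero s h fun j _ =>
      neg _ (G.lower i (-1 + N i - tot v - j) (by push_cast; ring))
  have n3a := n3 (tot N - tot v - tot k)
  have n3b := n3 (tot N - tot v)
  have n4a := n4 (fun i => N i - v i - k i)
  have n4b := n4 (fun i => N i - v i)
  unfold upperFactor
  simp only [tot_add, Pi.add_apply, Nat.sub_add_eq]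
  rw [div_mul_eq_mul_div, div_mul_eq_mul_div, div_eq_div_iff (mul_ne_zero n3a n4a)
    (mul_ne_zero n3b n4b)]
  have sq : ((-1 : ℂ) ^ tot k) * (-1) ^ tot k = 1 := by rw [← mul_pow]; simp
  have sq' : (((-1 : ℂ) ^ tot k) ^ n) * ((-1) ^ tot k) ^ n = 1 := by rw [← mul_pow, sq, one_pow]
  calc _ = (bp s h (-(tot v * h) - tot N * h - c) (tot N - tot v - tot k)
          * bp s h (c + 2 * tot v * h + h) (tot k))
        * ((∏ i, ∏ j, bp s h (x j + v j * h - (x i + N i * h)) (N i - v i - k i))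
          * ∏ i, ∏ j, bp s h (h + (x i + v i * h) - (x j + v j * h)) (k i))
        * ((∏ i, bp s h (h - tot N * h - α - (x i + v i * h)) (tot N - tot v))
          * ∏ i, bp s h (h - α - (x i + N i * h) + tot v * h + c) (N i - v i)) := by ring
    _ = (bp s h (-(tot v * h) - tot N * h - c) (tot N - tot v)
          * ∏ i, ∏ j, bp s h (x j + v j * h - (x i + N i * h)) (N i - v i))
        * (((∏ i, bp s h (h - tot N * h - α - (x i + v i * h)) (tot N - tot v - tot k))
            * ∏ i, bp s h (α + tot v * h + (x i + v i * h)) (tot k))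
          * ((∏ i, bp s h (h - α - (x i + N i * h) + tot v * h + c) (N i - v i - k i))
            * ∏ i, bp s h (α - tot v * h - c + (x i + v i * h)) (k i))) := by
      rw [f1, g2, g3, g4]; ring
    _ = _ := by ring

/-- The entries of `lowerMat` and `lowerInv` multiply to the summand of the vanishing sum. -/
theorem lowerMat_mul_lowerInv (hs : IsOddSigma s) {u v k : Fin n → ℕ} (hvu : v ≤ u)
    (hvk : v + k ≤ N) :
    lowerMat s h α c x u (v + k) * lowerInv s h α c x N (v + k) v
      = lowerMat s h α c x u v / (wpFactor s h α x v * lowerMat s h α c x v v)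
        * wpTerm s h (α + tot v * h) (c + (tot u + tot v : ℕ) * h)
          (α + tot v * h + (tot u - tot v : ℕ) * h - (c + (tot u + tot v : ℕ) * h))
          (fun i => x i + v i * h) (fun i => x i + u i * h) k := by
  have hv0 := G.wpFactor_ne_zero v
  have hl0 := G.lowerMat_self_ne_zero v
  have hg0 := G.upperFactor_ne_zero (N := N) hs (le_refl v)
  have hadd := G.upperFactor_add hs hvk
  have hc : ((tot u - tot v : ℕ) : ℂ) = tot u - tot v := Nat.cast_sub (tot_mono hvu)
  have nA : bp s h (c + 2 * tot v * h + h) (tot k)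
        * ∏ i, ∏ j, bp s h (h + (x i + v i * h) - (x j + v j * h)) (k i) ≠ 0 := by
    refine mul_ne_zero (bp_ne_zero s h fun j _ => G.upper (2 * tot v + 1 + j) (by push_cast; ring))
      (Finset.prod_ne_zero_iff.mpr fun i _ => Finset.prod_ne_zero_iff.mpr fun j _ =>
      bp_ne_zero s h fun m hm => ?_)
    by_cases hij : i = j
    · subst hij
      exact G.step (1 + m) (by omega) (by push_cast; ring)
    · exact G.diff i j (1 + m + v i - v j) hij (by push_cast; ring)
  rw [← eq_div_iff nA] at hadd
  -- Cutting every factorial at v leaves the value at v times a summand with base point x + vh, α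
  -- shifted by |v|h and c shifted by (|u| + |v|)h. The same shifts come out of the inverse.
  have hL : lowerMat s h α c x u (v + k) = lowerMat s h α c x u v
      * ((bp s h (c + (tot u + tot v : ℕ) * h) (tot k)
        * ∏ i, ∏ j, bp s h (x i + v i * h - (x j + u j * h)) (k i))
        / ((∏ i, bp s h (α + tot v * h + h + (x i + u i * h)) (tot k))
          * ∏ i, bp s h (α + tot v * h + h + (x i + v i * h) - (c + (tot u + tot v : ℕ) * h)) (k i))) := by
    unfold lowerMat
    simp only [tot_add, Pi.add_apply, bp_add, Finset.prod_mul_distrib]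
    rw [show c + tot u * h + tot v * h = c + (tot u + tot v : ℕ) * h by push_cast; ring]
    simp only [show ∀ i j, x i - (x j + u j * h) + v i * h = x i + v i * h - (x j + u j * h) from
      fun i j => by ring, show ∀ i, α + h + (x i + u i * h) + tot v * h
        = α + tot v * h + h + (x i + u i * h) from fun i => by ring,
      show ∀ i, α + h - tot u * h + x i - c + v i * h
        = α + tot v * h + h + (x i + v i * h) - (c + (tot u + tot v : ℕ) * h) from
      fun i => by push_cast; ring]
    rw [div_mul_div_comm]
    congr 1 <;> ring
  have hW : wpFactor s h α x (v + k)
      = vdm s (fun i => x i + v i * h + k i * h)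
        * ∏ i, s (α + tot v * h + (x i + v i * h + k i * h) + tot k * h) := by
    unfold wpFactor
    simp only [tot_add, Pi.add_apply]
    push_cast
    simp only [show ∀ i, x i + ((v i : ℂ) + k i) * h = x i + v i * h + k i * h from fun i => by ring]
    congr 1
    exact Finset.prod_congr rfl fun i _ => by congr 1; ring
  rw [lowerInv, if_pos le_self_add, hadd, hL, hW]
  unfold wpTerm
  rw [hc]
  simp only [show α + tot v * h + h
      - (α + tot v * h + ((tot u : ℂ) - tot v) * h - (c + (tot u + tot v : ℕ) * h))
      = c + 2 * tot v * h + h by push_cast; ring,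
    show ∀ i, α + tot v * h + ((tot u : ℂ) - tot v) * h - (c + (tot u + tot v : ℕ) * h)
      + (x i + v i * h) = α - tot v * h - c + (x i + v i * h) from fun i => by push_cast; ring]
  generalize upperFactor s h α c x N v v = g₀ at *
  generalize wpFactor s h α x v = w₀ at *
  generalize lowerMat s h α c x v v = l₀ at *
  generalize lowerMat s h α c x u v = l₁
  generalize vdm s (fun i => x i + v i * h + k i * h) = V
  generalize (∏ i, s (α + tot v * h + (x i + v i * h + k i * h) + tot k * h)) = W
  rw [← div_mul_div_comm (bp s h (c + (tot u + tot v : ℕ) * h) (tot k))]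
  simp only [div_eq_mul_inv, mul_inv]
  refine Eq.trans (b := _ * (g₀ * g₀⁻¹)) ?_ (by rw [mul_inv_cancel₀ hg0, mul_one])
  ring

/-- Triangularity confines the sum to v ≤ k ≤ u. After translation by v it is the vanishing sum for
the box u - v, which for u = v has the single term 1. -/
theorem sum_lowerMat_mul_lowerInv (hs : IsOddSigma s) {u v : Fin n → ℕ} (hu : u ≤ N) :
    ∑ k ∈ Finset.Icc 0 N, lowerMat s h α c x u k * lowerInv s h α c x N k v
      = if u = v then 1 else 0 := by
  by_cases hvu : v ≤ u
  · have h1 : ∑ k ∈ Finset.Icc 0 (u - v),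
        lowerMat s h α c x u (v + k) * lowerInv s h α c x N (v + k) v
        = ∑ k ∈ Finset.Icc 0 N, lowerMat s h α c x u k * lowerInv s h α c x N k v := by
      refine Finset.sum_of_injOn (fun k => v + k) (fun _ _ _ _ hkk => add_left_cancel hkk) ?_ ?_
        fun _ _ => rfl
      · intro k hk
        refine Finset.mem_coe.mpr (Finset.mem_Icc.mpr ⟨zero_le, fun i => ?_⟩)
        have h1 : k i ≤ u i - v i := (Finset.mem_Icc.mp hk).2 i
        have h2 : u i ≤ N i := hu i
        have h3 : v i ≤ u i := hvu i
        show v i + k i ≤ N i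
        omega
      · intro k _ hk'
        by_cases hku : k ≤ u
        · by_cases hvk : v ≤ k
          · refine absurd ⟨k - v, Finset.mem_coe.mpr (Finset.mem_Icc.mpr ⟨zero_le, ?_⟩), ?_⟩ hk'
            · exact tsub_le_tsub_right hku v
            · exact add_tsub_cancel_of_le hvk
          · rw [lowerInv, if_neg hvk, mul_zero]
        · rw [lowerMat_eq_zero hs hku, zero_mul]
    have hk : ∀ k ∈ Finset.Icc 0 (u - v), v + k ≤ N := fun k hk i => by
      have h1 : k i ≤ u i - v i := (Finset.mem_Icc.mp hk).2 i
      have h2 : u i ≤ N i := hu i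
      have h3 : v i ≤ u i := hvu i
      show v i + k i ≤ N i
      omega
    rw [← h1, Finset.sum_congr rfl fun k hk' => G.lowerMat_mul_lowerInv hs hvu (hk k hk'),
      ← Finset.mul_sum]
    by_cases huv : u = v
    · subst huv
      rw [if_pos rfl, tsub_self, Finset.Icc_self, Finset.sum_singleton, wpTerm_zero]
      have hw := G.wpFactor_ne_zero u
      have hl := G.lowerMat_self_ne_zero u
      have : wpFactor s h α x u = vdm s (fun i => x i + u i * h)
          * ∏ i, s (α + tot u * h + (x i + u i * h)) := by
        unfold wpFactor
        congr 1
        exact Finset.prod_congr rfl fun i _ => by congr 1; ring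
      rw [← this]
      field_simp
    · rw [if_neg huv]
      obtain ⟨M, hM⟩ : ∃ M, tot (u - v) = M + 1 := by
        refine Nat.exists_eq_succ_of_ne_zero fun h0 => huv ?_
        funext i
        have h1 : u i - v i = 0 := (Finset.sum_eq_zero_iff.mp h0) i (Finset.mem_univ i)
        have h3 : v i ≤ u i := hvu i
        omega
      have htot : tot u = tot v + (M + 1) := by
        rw [← hM, ← tot_add, add_tsub_cancel_of_le hvu]
      have h2 := sum_wpTerm_eq_zero hs M (u - v) (fun i => x i + v i * h) (α + tot v * h)
        (c + (tot u + tot v : ℕ) * h) hM (G.shift v _)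
      have hU : (fun i => x i + v i * h + ((u - v : Fin n → ℕ) i : ℕ) * h) = fun i => x i + u i * h := by
        funext i
        rw [Pi.sub_apply, Nat.cast_sub (hvu i)]; ring
      rw [hU] at h2
      have he : ((tot u - tot v : ℕ) : ℂ) = M + 1 := by
        rw [htot, Nat.add_sub_cancel_left]; push_cast; ring
      rw [he, h2, mul_zero]
  · have huv : u ≠ v := fun h0 => hvu h0.ge
    rw [if_neg huv]
    refine Finset.sum_eq_zero fun k _ => ?_
    by_cases hvk : v ≤ k
    · rw [lowerMat_eq_zero hs fun hku => hvu (hvk.trans hku), zero_mul]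
    · rw [lowerInv, if_neg hvk, mul_zero]

/-- On the finite box [0, N] a one-sided inverse of a square matrix is two-sided. The
biorthogonality needs this order for the parameter a and the other one for c. -/
theorem sum_lowerInv_mul_lowerMat (hs : IsOddSigma s) {t k : Fin n → ℕ} (ht : t ≤ N) (hk : k ≤ N) :
    ∑ y ∈ Finset.Icc 0 N, lowerInv s h α c x N t y * lowerMat s h α c x y k
      = if t = k then 1 else 0 := by
  let A : Matrix (Finset.Icc (0 : Fin n → ℕ) N) (Finset.Icc (0 : Fin n → ℕ) N) ℂ := fun u k => lowerMat s h α c x u.1 k.1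
  let B : Matrix (Finset.Icc (0 : Fin n → ℕ) N) (Finset.Icc (0 : Fin n → ℕ) N) ℂ := fun k v => lowerInv s h α c x N k.1 v.1
  have hAB : A * B = 1 := by
    ext u v
    rw [Matrix.mul_apply, Matrix.one_apply]
    have := G.sum_lowerMat_mul_lowerInv hs (v := v.1) (Finset.mem_Icc.mp u.2).2
    rw [← Finset.sum_coe_sort] at this
    simp only [Subtype.ext_iff]
    exact this
  have hBA' : B * A = 1 := mul_eq_one_comm.mp hAB
  have hBA := congrFun (congrFun hBA' ⟨t, Finset.mem_Icc.mpr ⟨zero_le, ht⟩⟩)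
    ⟨k, Finset.mem_Icc.mpr ⟨zero_le, hk⟩⟩
  rw [Matrix.mul_apply, Matrix.one_apply] at hBA
  rw [← Finset.sum_coe_sort]
  simp only [Subtype.mk.injEq] at hBA
  exact hBA

end GenericParams

end EllipticHyp

/-! ### Additive form of the system; factorization of the two series. -/

namespace EllipticHyp

section AdditiveSeries

variable {m n : ℕ} (s : ℂ → ℂ) (h A : ℂ) (B : Fin (m + 2) → ℂ) (C : Fin (m + n + 2) → ℂ)
  (z : Fin n → ℂ) (k : Fin n → ℕ)

/-- Numerator of the summand of `V_n^m` in additive notation. -/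
noncomputable def addNum : ℂ :=
  vdm s (fun i => z i + k i * h) * (∏ i, s (A + z i + (k i + tot k) * h))
    * (∏ i, bp s h (A + z i) (tot k)) * (∏ j, bp s h (B j) (tot k))
    * ∏ i, ∏ j, bp s h (C j + z i) (k i)

/-- Denominator of the summand of `V_n^m` in additive notation. -/
noncomputable def addDen : ℂ :=
  vdm s z * (∏ i, s (A + z i)) * (∏ j, bp s h (A + h - C j) (tot k))
    * ∏ i, ((∏ j, bp s h (h + z i - z j) (k i)) * ∏ j, bp s h (A + h + z i - B j) (k i))

end AdditiveSeries

section AdditiveSystem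

variable {n : ℕ} (s : ℂ → ℂ) (h a b c : ℂ) (x : Fin n → ℂ) (N u y : Fin n → ℕ)

/-- The upper parameters of `f_u(y)` in additive notation. -/
noncomputable def addFB : Fin (n + 2) → ℂ :=
  Matrix.vecCons (a + tot y * h) (Matrix.vecCons (c + tot u * h)
    fun i => a + (1 + N i) * h + x i - b)

/-- The lower parameters of `f_u(y)` in additive notation. -/
noncomputable def addFC : Fin (n + n + 2) → ℂ :=
  Matrix.vecCons 0 (Matrix.vecCons (a + (1 - tot N) * h - (2 * b + c))
    (Fin.append (fun i => -(y i * h) - x i) (fun i => -(u i * h) - x i)))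

/-- The base parameter of `g_u(y)` in additive notation. -/
noncomputable def addGA : ℂ := -(tot N * h) + b - a

/-- The upper parameters of `g_u(y)` in additive notation. -/
noncomputable def addGB : Fin (n + 2) → ℂ :=
  Matrix.vecCons ((-tot y - tot N) * h - a) (Matrix.vecCons ((-tot u - tot N) * h - c)
    fun i => (1 - tot N) * h + b - (a + x i))

/-- The lower parameters of `g_u(y)` in additive notation. -/
noncomputable def addGC : Fin (n + n + 2) → ℂ :=
  Matrix.vecCons h (Matrix.vecCons (tot N * h + 2 * b + c - a)
    (Fin.append (fun i => y i * h + x i) (fun i => u i * h + x i)))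

/-- The variables of `g_u(y)` in additive notation. -/
noncomputable def addGZ : Fin n → ℂ := fun i => -(N i * h) - x i

/-- The function `f_u(y)` in additive notation. -/
noncomputable def addF : ℂ := ∑ k ∈ Finset.Icc 0 (u ⊓ y),
  addNum s h (a - b) (addFB h a b c x N u y) (addFC h a b c x N u y) x k
    / addDen s h (a - b) (addFB h a b c x N u y) (addFC h a b c x N u y) x k

/-- The function `g_u(y)` in additive notation. -/
noncomputable def addG : ℂ := ∑ k ∈ Finset.Icc 0 (N - u ⊔ y),
  addNum s h (addGA h a b N) (addGB h a b c x N u y) (addGC h a b c x N u y) (addGZ h x N) k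
    / addDen s h (addGA h a b N) (addGB h a b c x N u y) (addGC h a b c x N u y) (addGZ h x N) k

/-- Numerator of the weight `w(y)` in additive notation. -/
noncomputable def addWNum : ℂ :=
  vdm s (fun i => x i + y i * h) * s (a + 2 * tot y * h) * bp s h a (tot y)
    * (∏ i, ∏ j, bp s h (-(N j * h) + x i - x j) (y i))
    * ∏ i, (s (b + (tot y - y i) * h - x i) * bp s h (b - x i) (tot y)
        * bp s h (tot N * h + a + x i - b) (y i))

/-- Denominator of the weight `w(y)` in additive notation. -/
noncomputable def addWDen : ℂ :=
  vdm s x * s a * bp s h (a + (1 + tot N) * h) (tot y)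
    * (∏ i, ∏ j, bp s h (h + x i - x j) (y i))
    * ∏ i, (s (b - x i) * bp s h (b + (1 - N i) * h - x i) (tot y)
        * bp s h (a + h + x i - b) (y i))

/-- Numerator of the norm `Γ_u` in additive notation. -/
noncomputable def addGammaNum : ℂ :=
  vdm s x * (∏ i, ∏ j, bp s h (h + x i - x j) (u i))
    * (bp s h (a + h) (tot N) * bp s h ((-tot u - tot N) * h - c) (tot N - tot u)
        * bp s h ((1 - 2 * tot u) * h - c) (tot u))
    * ∏ i, (s (-(tot u * h) + a + x i - (b + c))
        * (bp s h (x i) (N i) * bp s h (a + (1 - tot N) * h + x i - (2 * b + c)) (N i))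
        * bp s h ((u i + tot N) * h + a + x i - b) (N i - u i))

/-- Denominator of the norm `Γ_u` in additive notation. -/
noncomputable def addGammaDen : ℂ :=
  vdm s (fun i => x i + u i * h) * (∏ i, ∏ j, bp s h (-(N j * h) + x i - x j) (u i))
    * (bp s h (a + h - b) (tot N) * bp s h (b + c + tot N * h) (tot N))
    * ∏ i, (s ((-tot u + u i) * h + a + x i - (b + c))
        * (bp s h (x i - b) (N i) * bp s h (-(tot u * h) + a + x i - (b + c)) (N i))
        * bp s h ((1 + u i) * h + a + x i - b) (N i - u i))

/-- The part of the summand of `f_u(y)` that depends on neither `u` nor `y`, without its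
very-well-poised factor. -/
noncomputable def fMid (k : Fin n → ℕ) : ℂ :=
  (1 / (vdm s x * ∏ i, s (a - b + x i)))
    * (((∏ i, bp s h (a - b + x i) (tot k)) * ∏ i, bp s h (a - b + h + (x i + N i * h)) (tot k))
      / (bp s h (a - b + h) (tot k) * bp s h (b + c + tot N * h) (tot k)))
    * (((∏ i, bp s h (x i) (k i)) * ∏ i, bp s h (a + (1 - tot N) * h - (2 * b + c) + x i) (k i))
      / ((∏ i, ∏ j, bp s h (h + x i - x j) (k i))
        * ∏ i, ∏ j, bp s h (x i - (x j + N j * h)) (k i)))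

/-- The part of the summand of `g_u(y)` with index `N - k` that depends on neither `u` nor `y`,
without its very-well-poised factor. -/
noncomputable def gMid (k : Fin n → ℕ) : ℂ :=
  (((∏ i, bp s h (-(tot N * h) - (a - b) - (x i + N i * h)) (tot N - tot k))
      * ∏ i, bp s h (h - tot N * h - (a - b) - x i) (tot N - tot k))
      / (bp s h (-(tot N * h) - (a - b)) (tot N - tot k)
        * bp s h (h - 2 * tot N * h - (b + c)) (tot N - tot k)))
    * (((∏ i, bp s h (h - (x i + N i * h)) (N i - k i))
        * ∏ i, bp s h (tot N * h + 2 * b + c - a - (x i + N i * h)) (N i - k i))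
      / ((∏ i, ∏ j, bp s h (h - (x i + N i * h) + (x j + N j * h)) (N i - k i))
        * ∏ i, ∏ j, bp s h (x j - (x i + N i * h)) (N i - k i)))

end AdditiveSystem

theorem prod_fin_add_two {n : ℕ} {M : Type*} [CommMonoid M] (f : ℂ → M) (p q : ℂ) (r : Fin n → ℂ) :
    ∏ j, f (Matrix.vecCons p (Matrix.vecCons q r) j) = f p * (f q * ∏ i, f (r i)) := by
  rw [Fin.prod_univ_succ, Fin.prod_univ_succ]
  simp

theorem prod_fin_append {n m : ℕ} {M : Type*} [CommMonoid M] (f : ℂ → M) (r : Fin n → ℂ)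
    (t : Fin m → ℂ) : ∏ j, f (Fin.append r t j) = (∏ i, f (r i)) * ∏ i, f (t i) := by
  rw [Fin.prod_univ_add]
  simp

variable {n : ℕ} {s : ℂ → ℂ} {h a b c : ℂ} {x : Fin n → ℂ} {N u y : Fin n → ℕ}

/-- This exhibits f as a matrix product: a lower triangular matrix in u, a diagonal matrix, and the
transpose of the same matrix with c replaced by a, in y. -/
theorem f_term_eq (k : Fin n → ℕ) :
    addNum s h (a - b) (addFB h a b c x N u y) (addFC h a b c x N u y) x k
      / addDen s h (a - b) (addFB h a b c x N u y) (addFC h a b c x N u y) x k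
    = lowerMat s h (a - b) c x u k * (wpFactor s h (a - b) x k * fMid s h a b c x N k)
      * lowerMat s h (a - b) a x y k := by
  unfold addNum addDen addFB addFC lowerMat wpFactor fMid
  have p1 := prod_fin_add_two (fun w => bp s h w (tot k)) (a + tot y * h) (c + tot u * h)
    fun i => a + (1 + N i) * h + x i - b
  have p2 := fun i => prod_fin_add_two (n := n + n) (fun w => bp s h (w + x i) (k i)) 0
    (a + (1 - tot N) * h - (2 * b + c))
    (Fin.append (fun i => -(y i * h) - x i) (fun i => -(u i * h) - x i))
  have p3 := prod_fin_add_two (n := n + n) (fun w => bp s h (a - b + h - w) (tot k)) 0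
    (a + (1 - tot N) * h - (2 * b + c))
    (Fin.append (fun i => -(y i * h) - x i) (fun i => -(u i * h) - x i))
  have p4 := fun i => prod_fin_add_two (fun w => bp s h (a - b + h + x i - w) (k i))
    (a + tot y * h) (c + tot u * h) fun i => a + (1 + N i) * h + x i - b
  have p5 := fun i => prod_fin_append (fun w => bp s h (w + x i) (k i))
    (fun i => -(y i * h) - x i) (fun i => -(u i * h) - x i)
  have p6 := prod_fin_append (fun w => bp s h (a - b + h - w) (tot k))
    (fun i => -(y i * h) - x i) (fun i => -(u i * h) - x i)
  beta_reduce at p1 p2 p3 p4 p5 p6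
  simp only [p1, p2, p3, p4, p5, p6, Finset.prod_mul_distrib]
  simp only [show ∀ i, a - b + x i + ((k i : ℂ) + tot k) * h = a - b + (x i + k i * h) + tot k * h from
      fun i => by ring,
    show ∀ i j, -((y j : ℂ) * h) - x j + x i = x i - (x j + y j * h) from fun i j => by ring,
    show ∀ i j, -((u j : ℂ) * h) - x j + x i = x i - (x j + u j * h) from fun i j => by ring,
    show ∀ i, a + (1 + (N i : ℂ)) * h + x i - b = a - b + h + (x i + N i * h) from fun i => by ring,
    show ∀ i j, a - b + h + x i - (a - b + h + (x j + N j * h)) = x i - (x j + N j * h) from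
      fun i j => by ring,
    show a - b + h - (a + (1 - (tot N : ℂ)) * h - (2 * b + c)) = b + c + tot N * h by ring,
    show ∀ i, a - b + h - (-((y i : ℂ) * h) - x i) = a - b + h + (x i + y i * h) from
      fun i => by ring,
    show ∀ i, a - b + h - (-((u i : ℂ) * h) - x i) = a - b + h + (x i + u i * h) from
      fun i => by ring,
    show ∀ i, a - b + h + x i - (a + (tot y : ℂ) * h) = a - b + h - tot y * h + x i - a from
      fun i => by ring,
    show ∀ i, a - b + h + x i - (c + (tot u : ℂ) * h) = a - b + h - tot u * h + x i - c from
      fun i => by ring, zero_add, sub_zero]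
  simp only [div_eq_mul_inv, mul_inv, one_mul]
  ring

theorem vdm_neg (hs : IsOddSigma s) (z : Fin n → ℂ) :
    vdm s (fun i => -z i) = (∏ j : Fin n, ∏ _k ∈ Finset.Ioi j, (-1)) * vdm s z := by
  unfold vdm
  simp only [← Finset.prod_mul_distrib]
  refine Finset.prod_congr rfl fun j _ => Finset.prod_congr rfl fun k _ => ?_
  rw [show -z k - -z j = -(z k - z j) by ring, hs.neg]
  ring

/-- Reversing the index replaces the point z + sh by -(x + kh). The resulting signs occur equally in
the very-well-poised numerator and its normalization, so a quotient of two values of `wpFactor`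
remains. -/
theorem g_term_eq (hs : IsOddSigma s) {k : Fin n → ℕ} (hk : k ≤ N) :
    addNum s h (addGA h a b N) (addGB h a b c x N u y) (addGC h a b c x N u y) (addGZ h x N) (N - k)
      / addDen s h (addGA h a b N) (addGB h a b c x N u y) (addGC h a b c x N u y) (addGZ h x N)
          (N - k)
    = upperFactor s h (a - b) c x N u k
      * (wpFactor s h (a - b) x k / wpFactor s h (a - b) x N * gMid s h a b c x N k)
      * upperFactor s h (a - b) a x N y k := by
  have htot : tot (N - k) = tot N - tot k := by
    have := tot_add (N - k) k
    rw [tsub_add_cancel_of_le hk] at this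
    omega
  have c1 : ((tot N - tot k : ℕ) : ℂ) = tot N - tot k := Nat.cast_sub (tot_mono hk)
  have c2 : ∀ i, ((N i - k i : ℕ) : ℂ) = N i - k i := fun i => Nat.cast_sub (hk i)
  have hW : wpFactor s h (a - b) x k / wpFactor s h (a - b) x N
      = vdm s (fun i => addGZ h x N i + (N - k) i * h)
        * (∏ i, s (addGA h a b N + addGZ h x N i + ((N - k) i + tot (N - k)) * h))
        / (vdm s (addGZ h x N) * ∏ i, s (addGA h a b N + addGZ h x N i)) := by
    have e1 : (fun i => addGZ h x N i + ((N - k) i : ℕ) * h) = fun i => -(x i + k i * h) := by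
      funext i; rw [addGZ, Pi.sub_apply, c2]; ring
    have e2 : addGZ h x N = fun i => -(x i + N i * h) := by
      funext i; rw [addGZ]; ring
    have e3 : ∀ i, s (addGA h a b N + addGZ h x N i + (((N - k) i : ℕ) + tot (N - k)) * h)
        = -s (a - b + (x i + k i * h) + tot k * h) := fun i => by
      rw [← hs.neg, addGZ, addGA, Pi.sub_apply, c2, htot, c1]; congr 1; ring
    have e4 : ∀ i, s (addGA h a b N + addGZ h x N i) = -s (a - b + (x i + N i * h) + tot N * h) :=
      fun i => by rw [← hs.neg, addGZ, addGA]; congr 1; ring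
    simp only [e3, e4]
    rw [e1, e2, vdm_neg hs, vdm_neg hs, Finset.prod_neg, Finset.prod_neg, wpFactor, wpFactor]
    have n1 : (∏ j : Fin n, ∏ _k ∈ Finset.Ioi j, (-1 : ℂ)) ≠ 0 := by
      simp [Finset.prod_eq_zero_iff]
    have n2 : ((-1 : ℂ)) ^ (Finset.univ : Finset (Fin n)).card ≠ 0 := by simp
    generalize (∏ j : Fin n, ∏ _k ∈ Finset.Ioi j, (-1 : ℂ)) = e at *
    generalize ((-1 : ℂ)) ^ (Finset.univ : Finset (Fin n)).card = d at *
    rw [mul_mul_mul_comm e (vdm s fun i => x i + k i * h) d,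
      mul_mul_mul_comm e (vdm s fun i => x i + N i * h) d, mul_div_mul_left _ _ (mul_ne_zero n1 n2)]
  rw [hW]
  unfold addNum addDen upperFactor gMid
  generalize vdm s (fun i => addGZ h x N i + ((N - k) i : ℕ) * h) = V1
  generalize vdm s (addGZ h x N) = V2
  generalize (∏ i, s (addGA h a b N + addGZ h x N i + (((N - k) i : ℕ) + tot (N - k)) * h)) = W1
  generalize (∏ i, s (addGA h a b N + addGZ h x N i)) = W2
  unfold addGB addGC
  have p1 := prod_fin_add_two (fun w => bp s h w (tot (N - k))) ((-tot y - tot N) * h - a)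
    ((-tot u - tot N) * h - c) fun i => (1 - tot N) * h + b - (a + x i)
  have p2 := fun i => prod_fin_add_two (n := n + n)
    (fun w => bp s h (w + addGZ h x N i) ((N - k) i)) h (tot N * h + 2 * b + c - a)
    (Fin.append (fun i => y i * h + x i) (fun i => u i * h + x i))
  have p3 := prod_fin_add_two (n := n + n)
    (fun w => bp s h (addGA h a b N + h - w) (tot (N - k))) h (tot N * h + 2 * b + c - a)
    (Fin.append (fun i => y i * h + x i) (fun i => u i * h + x i))
  have p4 := fun i => prod_fin_add_two
    (fun w => bp s h (addGA h a b N + h + addGZ h x N i - w) ((N - k) i))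
    ((-tot y - tot N) * h - a) ((-tot u - tot N) * h - c)
    fun i => (1 - tot N) * h + b - (a + x i)
  have p5 := fun i => prod_fin_append (fun w => bp s h (w + addGZ h x N i) ((N - k) i))
    (fun i => y i * h + x i) (fun i => u i * h + x i)
  have p6 := prod_fin_append (fun w => bp s h (addGA h a b N + h - w) (tot (N - k)))
    (fun i => y i * h + x i) (fun i => u i * h + x i)
  beta_reduce at p1 p2 p3 p4 p5 p6
  simp only [p1, p2, p3, p4, p5, p6, Finset.prod_mul_distrib]
  clear p1 p2 p3 p4 p5 p6
  unfold addGA addGZ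
  simp only [htot, Pi.sub_apply]
  simp only [
    show ∀ i, -((tot N : ℂ) * h) + b - a + (-((N i : ℂ) * h) - x i)
      = -(tot N * h) - (a - b) - (x i + N i * h) from fun i => by ring,
    show ∀ i, (1 - (tot N : ℂ)) * h + b - (a + x i) = h - tot N * h - (a - b) - x i from
      fun i => by ring,
    show -((tot N : ℂ) * h) + b - a + h - h = -(tot N * h) - (a - b) by ring,
    show -((tot N : ℂ) * h) + b - a + h - (tot N * h + 2 * b + c - a)
      = h - 2 * tot N * h - (b + c) by ring,
    show ∀ i, h + (-((N i : ℂ) * h) - x i) = h - (x i + N i * h) from fun i => by ring,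
    show ∀ i, (tot N : ℂ) * h + 2 * b + c - a + (-((N i : ℂ) * h) - x i)
      = tot N * h + 2 * b + c - a - (x i + N i * h) from fun i => by ring,
    show ∀ i j, h - (x i + (N i : ℂ) * h) - (-((N j : ℂ) * h) - x j)
      = h - (x i + N i * h) + (x j + N j * h) from fun i j => by ring,
    show ∀ i j, -((tot N : ℂ) * h) + b - a + h + (-((N i : ℂ) * h) - x i)
      - (h - tot N * h - (a - b) - x j) = x j - (x i + N i * h) from fun i j => by ring,
    show ∀ i j, (y j : ℂ) * h + x j + (-((N i : ℂ) * h) - x i) = x j + y j * h - (x i + N i * h) from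
      fun i j => by ring,
    show ∀ i j, (u j : ℂ) * h + x j + (-((N i : ℂ) * h) - x i) = x j + u j * h - (x i + N i * h) from
      fun i j => by ring,
    show ∀ i, -((tot N : ℂ) * h) + b - a + h - ((y i : ℂ) * h + x i)
      = h - tot N * h - (a - b) - (x i + y i * h) from fun i => by ring,
    show ∀ i, -((tot N : ℂ) * h) + b - a + h - ((u i : ℂ) * h + x i)
      = h - tot N * h - (a - b) - (x i + u i * h) from fun i => by ring,
    show ∀ i, -((tot N : ℂ) * h) + b - a + h + (-((N i : ℂ) * h) - x i)
      - (-((tot y : ℂ) * h) - tot N * h - a)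
      = h - (a - b) - (x i + N i * h) + tot y * h + a from fun i => by ring,
    show ∀ i, -((tot N : ℂ) * h) + b - a + h + (-((N i : ℂ) * h) - x i)
      - (-((tot u : ℂ) * h) - tot N * h - c)
      = h - (a - b) - (x i + N i * h) + tot u * h + c from fun i => by ring,
    show (-(tot y : ℂ) - tot N) * h - a = -(tot y * h) - tot N * h - a by ring,
    show (-(tot u : ℂ) - tot N) * h - c = -(tot u * h) - tot N * h - c by ring]
  simp only [div_eq_mul_inv, mul_inv]
  ring

end EllipticHyp

/-! ### The weight normalizes the diagonal of the triangular factors. -/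

namespace EllipticHyp

variable {n : ℕ} {s : ℂ → ℂ} {h a b c : ℂ} {x : Fin n → ℂ} {N u y : Fin n → ℕ}

theorem neg_one_pow_mul_self (k : ℕ) : ((-1 : ℂ) ^ k) * (-1) ^ k = 1 := by
  rw [← mul_pow]; simp

/-- Cut both long symbols at the shorter length; the two extra pieces are reflections of one another
up to a shift by h, which the factor s(d + mh) absorbs. -/
theorem bp_pair_le (hs : IsOddSigma s) (d : ℂ) (p m q P : ℕ) :
    s (d + m * h) * (bp s h (d - P * h) (P + m) * bp s h (-d - (p + m + q : ℕ) * h) (p + q))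
      = (-1) ^ p * (-1) ^ (p + m) * (s d * (bp s h (d - P * h) P
        * bp s h (-d - (p + m + q : ℕ) * h) (p + m + q))) := by
  have h1 := bp_add s h (d - P * h) P m
  have h2 := bp_add s h (-d - (p + m + q : ℕ) * h) (p + q) m
  rw [sub_add_cancel] at h1
  rw [show -d - ((p + m + q : ℕ) : ℂ) * h + (p + q : ℕ) * h = -d - m * h by push_cast; ring,
    bp_reflect h hs (x := -d - m * h) (y := d + h) (by ring), show p + q + m = p + m + q by ring] at h2
  rw [h1, h2, pow_add]
  have h3 := bp_shift s h d m
  have s1 := neg_one_pow_mul_self p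
  have s2 := neg_one_pow_mul_self m
  generalize bp s h (-d - (p + m + q : ℕ) * h) (p + q) = R
  generalize bp s h (d - P * h) P = T
  generalize (-1 : ℂ) ^ p = e at *
  generalize (-1 : ℂ) ^ m = f at *
  linear_combination T * R * h3 - s d * T * R * bp s h (d + h) m * (f * f * s1 + s2)

/-- The contribution of one pair i < j to `vdm_complement`, with d = x j - x i. The case r ≤ p is
the case p ≤ r for -d, with the two symbols exchanged. -/
theorem bp_pair (hs : IsOddSigma s) (d : ℂ) {p r P Q : ℕ} (hp : p ≤ P) (hr : r ≤ Q) :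
    s (d + (r - p) * h) * (bp s h (d - P * h) (r + (P - p)) * bp s h (-d - Q * h) (p + (Q - r)))
      = (-1) ^ p * (-1) ^ r * (s d * (bp s h (d - P * h) P * bp s h (-d - Q * h) Q)) := by
  rcases le_total p r with hpr | hpr
  · obtain ⟨m, rfl⟩ := Nat.exists_eq_add_of_le hpr
    obtain ⟨q, rfl⟩ := Nat.exists_eq_add_of_le hr
    have := bp_pair_le (h := h) hs d p m q P
    rw [show p + m + (P - p) = P + m by omega, show p + (p + m + q - (p + m)) = p + q by omega,
      show d + (((p + m : ℕ) : ℂ) - p) * h = d + m * h by push_cast; ring]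
    exact this
  · obtain ⟨m, rfl⟩ := Nat.exists_eq_add_of_le hpr
    obtain ⟨q, rfl⟩ := Nat.exists_eq_add_of_le hp
    have := bp_pair_le (h := h) hs (-d) r m q Q
    rw [hs.neg, neg_neg, show -d + m * h = -(d - m * h) by ring, hs.neg] at this
    rw [show r + m + (Q - r) = Q + m by omega, show r + (r + m + q - (r + m)) = r + q by omega,
      show d + ((r : ℂ) - (r + m : ℕ)) * h = d - m * h by push_cast; ring]
    linear_combination -this

/-- Up to sign, the dependence of the Vandermonde product on y is compensated by these factorials.
The weight and the norm both need this. -/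
theorem vdm_complement (hs : IsOddSigma s) (hy : y ≤ N) :
    vdm s (fun i => x i + y i * h)
        * ∏ i, ∏ j, bp s h (x j - (x i + N i * h)) (y j + (N i - y i))
      = (∏ i, ∏ _j : Fin n, (-1) ^ y i) * (∏ i, (-1) ^ y i)
        * (vdm s x * ∏ i, ∏ j, bp s h (x j - (x i + N i * h)) (N i)) := by
  have hd : ∀ i, bp s h (x i - (x i + N i * h)) (y i + (N i - y i))
      = bp s h (x i - (x i + N i * h)) (N i) := fun i => by
    rw [Nat.add_sub_cancel' (hy i)]
  rw [prod_prod_eq_diag_mul (fun i j => bp s h (x j - (x i + N i * h)) (y j + (N i - y i))),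
    prod_prod_eq_diag_mul (fun i j => bp s h (x j - (x i + N i * h)) (N i)),
    prod_prod_eq_diag_mul (fun i (_ : Fin n) => (-1 : ℂ) ^ y i), Finset.prod_congr rfl fun i _ => hd i]
  have sq : (∏ i, (-1 : ℂ) ^ y i) * (∏ i, (-1) ^ y i) = 1 := by
    rw [← Finset.prod_mul_distrib]
    exact Finset.prod_eq_one fun i _ => neg_one_pow_mul_self _
  have comb : ∀ V D P e E V' P' : ℂ, e * e = 1 → V * P = E * (V' * P') →
      V * (D * P) = e * E * e * (V' * (D * P')) := fun V D P e E V' P' he H => by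
    linear_combination D * H - E * V' * D * P' * he
  refine comb _ _ _ _ _ _ _ sq ?_
  unfold vdm
  rw [← Finset.prod_mul_distrib, ← Finset.prod_mul_distrib, ← Finset.prod_mul_distrib]
  refine Finset.prod_congr rfl fun i _ => ?_
  rw [← Finset.prod_mul_distrib, ← Finset.prod_mul_distrib, ← Finset.prod_mul_distrib]
  refine Finset.prod_congr rfl fun j _ => ?_
  have := bp_pair (h := h) hs (x j - x i) (hy i) (hy j)
  rw [show x j - x i + ((y j : ℂ) - y i) * h = x j + y j * h - (x i + y i * h) by ring,
    show x j - x i - N i * h = x j - (x i + N i * h) by ring,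
    show -(x j - x i) - N j * h = x i - (x j + N j * h) by ring] at this
  exact this

theorem vdm_complement' (hs : IsOddSigma s) (hy : y ≤ N) :
    vdm s (fun i => x i + y i * h) * ((∏ i, ∏ j, bp s h (x i - (x j + N j * h)) (y i))
        * ∏ i, ∏ j, bp s h (x j + y j * h - (x i + N i * h)) (N i - y i))
      = ((-1) ^ tot y) ^ n * (-1) ^ tot y
        * (vdm s x * ∏ i, ∏ j, bp s h (x j - (x i + N i * h)) (N i)) := by
  have := vdm_complement (x := x) (h := h) hs hy
  simp only [bp_add, Finset.prod_mul_distrib, Finset.prod_const, Finset.card_univ,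
    Fintype.card_fin, Finset.prod_pow, Finset.prod_pow_eq_pow_sum] at this
  rw [Finset.prod_comm (f := fun i j => bp s h (x i - (x j + N j * h)) (y i))]
  simp only [show ∀ i j, x j + (y j : ℂ) * h - (x i + N i * h) = x j - (x i + N i * h) + y j * h from
    fun i j => by ring]
  exact this

/-- The factors of the weight and of the diagonal entries fall into groups according to their base:
a here, a - b + x i in `weight_aux_base`, b - x i in `weight_aux_b`. Within a group both sides are
cuttings of the same strings of consecutive factors. -/
theorem weight_aux_a (hs : IsOddSigma s) {r M : ℕ} (hr : r ≤ M) :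
    s (a + 2 * r * h) * bp s h a r * bp s h (-(r * h) - M * h - a) (M - r) * bp s h (a + r * h) r
      = (-1) ^ r * (s a * bp s h (-(M * h) - a) M * bp s h (a + (1 + M) * h) r) := by
  obtain ⟨m, rfl⟩ := Nat.exists_eq_add_of_le hr
  rw [Nat.add_sub_cancel_left,
    bp_reflect h hs (x := -(r * h) - (r + m : ℕ) * h - a) (y := a + h + (r + r : ℕ) * h)
      (by push_cast; ring),
    bp_reflect h hs (x := -((r + m : ℕ) * h) - a) (y := a + h) (by push_cast; ring),
    show a + (1 + ((r + m : ℕ) : ℂ)) * h = a + h + (r + m : ℕ) * h by ring]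
  have e1 := bp_add s h a r r
  have e2 := bp_shift s h a (r + r)
  have e3 := bp_add s h (a + h) (r + r) m
  have e4 := bp_add s h (a + h) (r + m) r
  rw [show r + m + r = r + r + m by ring, e3] at e4
  rw [e1, show a + ((r + r : ℕ) : ℂ) * h = a + 2 * r * h by push_cast; ring] at e2
  have s1 := neg_one_pow_mul_self r
  rw [pow_add]
  generalize (-1 : ℂ) ^ r = e at *
  generalize bp s h (a + h + (r + r : ℕ) * h) m = R1 at *
  linear_combination (-1) ^ m * R1 * e2 + (-1) ^ m * s a * e4
    - (-1) ^ m * s a * bp s h (a + h) (r + m) * bp s h (a + h + (r + m : ℕ) * h) r * s1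

theorem weight_aux_base (hs : IsOddSigma s) (κ : ℂ) (p : ℕ) {r M : ℕ} (hr : r ≤ M) :
    s (κ + p * h + r * h) * bp s h (M * h + κ) p * bp s h (h - M * h - κ) M
      = (-1) ^ r * (s κ * bp s h (κ + h) p * bp s h (h - M * h - (κ + p * h)) (M - r)
        * bp s h (h + (κ + p * h)) r) := by
  obtain ⟨m, rfl⟩ := Nat.exists_eq_add_of_le hr
  rw [Nat.add_sub_cancel_left, bp_reflect h hs (x := h - (r + m : ℕ) * h - κ) (y := κ) (by ring),
    bp_reflect h hs (x := h - (r + m : ℕ) * h - (κ + p * h)) (y := κ + p * h + r * h)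
      (by push_cast; ring)]
  have e1 := bp_shift s h κ p
  have e2 := bp_shift s h (κ + p * h) r
  have e3 := bp_add s h (κ + p * h) r m
  have e4 := bp_add s h κ p (r + m)
  have e5 := bp_add s h κ (r + m) p
  rw [show r + m + p = p + (r + m) by ring, e4, e3, add_comm κ ((r + m : ℕ) * h)] at e5
  rw [add_comm h (κ + p * h), pow_add]
  generalize bp s h (κ + p * h + r * h) m = R1 at *
  linear_combination (-(-1) ^ r * (-1) ^ m * s (κ + p * h + r * h)) * e5
    + (-1) ^ r * (-1) ^ m * R1 * bp s h κ p * e2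
    + (-1) ^ r * (-1) ^ m * R1 * bp s h (κ + p * h + h) r * e1

theorem weight_aux_b (hs : IsOddSigma s) (β : ℂ) {p r P : ℕ} (hp : p ≤ P) (hr : p ≤ r) :
    s (β + (r - p) * h) * bp s h β r * bp s h (h + β - P * h) P
      = (-1) ^ p * (s β * bp s h (β + (1 - P) * h) r * bp s h (h + β - P * h + r * h) (P - p)
        * bp s h (h - r * h - β) p) := by
  obtain ⟨q, rfl⟩ := Nat.exists_eq_add_of_le hr
  rw [bp_reflect h hs (x := h - (p + q : ℕ) * h - β) (y := β + q * h) (by push_cast; ring),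
    show β + (1 - (P : ℂ)) * h = h + β - P * h by ring,
    show β + (((p + q : ℕ) : ℂ) - p) * h = β + q * h by push_cast; ring]
  have e1 := bp_add s h (h + β - P * h) (p + q) (P - p)
  have e2 := bp_add s h (h + β - P * h) P q
  rw [show p + q + (P - p) = P + q by omega, e2, show h + β - P * h + P * h = β + h by ring] at e1
  have e3 := bp_shift s h β q
  have e4 := bp_add s h β q p
  have s1 := neg_one_pow_mul_self p
  rw [add_comm p q, e4]
  rw [add_comm p q] at e1
  generalize (-1 : ℂ) ^ p = e at *
  generalize bp s h (h + β - P * h) P = T at *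
  generalize bp s h (β + q * h) p = R at *
  linear_combination T * R * e3 + s β * R * e1
    - bp s h (h + β - P * h) (q + p) * bp s h (h + β - P * h + (q + p : ℕ) * h) (P - p) * R * s β * s1

/-- Genericity of the parameters of the biorthogonal system. -/
structure GenericSystem (s : ℂ → ℂ) (h a b c : ℂ) (x : Fin n → ℂ) : Prop where
  step : ∀ {w : ℂ} (m : ℤ), m ≠ 0 → w = m * h → s w ≠ 0
  base : ∀ {w : ℂ} (i) (m : ℤ), w = a - b + x i + m * h → s w ≠ 0
  diff : ∀ {w : ℂ} (i j) (m : ℤ), i ≠ j → w = x i - x j + m * h → s w ≠ 0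
  ne_a : ∀ {w : ℂ} (m : ℤ), w = a + m * h → s w ≠ 0
  ne_c : ∀ {w : ℂ} (m : ℤ), w = c + m * h → s w ≠ 0
  ne_ab : ∀ {w : ℂ} (m : ℤ), w = a - b + m * h → s w ≠ 0
  ne_bc : ∀ {w : ℂ} (m : ℤ), w = b + c + m * h → s w ≠ 0
  ne_xb : ∀ {w : ℂ} (i) (m : ℤ), w = x i - b + m * h → s w ≠ 0
  ne_xc : ∀ {w : ℂ} (i) (m : ℤ), w = a - b + x i - c + m * h → s w ≠ 0

namespace GenericSystem

variable (G : GenericSystem s h a b c x)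
include G

theorem params_c : GenericParams s h (a - b) c x where
  step := G.step
  base := G.base
  diff := G.diff
  upper := G.ne_c
  lower := G.ne_xc

theorem params_a : GenericParams s h (a - b) a x where
  step := G.step
  base := G.base
  diff := G.diff
  upper := G.ne_a
  lower i m hx := G.ne_xb i m (by rw [hx]; ring)

end GenericSystem

theorem le_tot (y : Fin n → ℕ) (i : Fin n) : y i ≤ tot y :=
  Finset.single_le_sum (f := y) (fun _ _ => Nat.zero_le _) (Finset.mem_univ i)

theorem wpFactor_zero {α : ℂ} : wpFactor s h α x 0 = vdm s x * ∏ i, s (α + x i) := by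
  simp [wpFactor, tot_zero]

theorem upperFactor_zero {α : ℂ} : upperFactor s h α c x N 0 0
    = (bp s h (-(tot N * h) - c) (tot N) * ∏ i, ∏ j, bp s h (x j - (x i + N i * h)) (N i))
      / ((∏ i, bp s h (h - tot N * h - α - x i) (tot N))
        * ∏ i, bp s h (h - α - (x i + N i * h) + c) (N i)) := by
  simp [upperFactor, tot_zero]

theorem weight_alg {V S A₁ X₁ sb B₁ P V₀ s₀ A₃ X₂ sb₀ B₂ Q W A₄ X₃ D Db A₅ X₄ D₂ Db₂ W₀ R₁ R₄ R₂ R₃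
      e f : ℂ} (he : e * e = 1) (hf : f * f = 1)
    (ha : S * A₁ * A₄ * A₅ = e * (s₀ * R₁ * A₃)) (hα : W * P * R₂ = f * (W₀ * Q * D * D₂))
    (hb : sb * B₁ * R₃ = e * (sb₀ * B₂ * Db * Db₂))
    (hx : V * X₁ * (V * X₃) * X₄ = f * (V₀ * X₂ * (V₀ * R₄)))
    (h1 : V₀ * s₀ * A₃ * X₂ * (sb₀ * B₂ * Q) ≠ 0) (h2 : D * Db ≠ 0) (h3 : D₂ * Db₂ ≠ 0)
    (h4 : R₂ * R₃ ≠ 0) :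
    V * S * A₁ * X₁ * (sb * B₁ * P) / (V₀ * s₀ * A₃ * X₂ * (sb₀ * B₂ * Q)) * (V * W)
      * (A₄ * X₃ / (D * Db)) * (A₅ * X₄ / (D₂ * Db₂)) = V₀ * W₀ * (R₁ * R₄ / (R₂ * R₃)) := by
  rw [div_mul_eq_mul_div, div_mul_div_comm, div_mul_div_comm, ← mul_div_assoc,
    div_eq_div_iff (mul_ne_zero (mul_ne_zero h1 h2) h3) h4]
  calc _ = (S * A₁ * A₄ * A₅) * (W * P * R₂) * (sb * B₁ * R₃) * (V * X₁ * (V * X₃) * X₄) := by ring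
    _ = (e * e) * (f * f) * ((s₀ * R₁ * A₃) * (W₀ * Q * D * D₂) * (sb₀ * B₂ * Db * Db₂)
        * (V₀ * X₂ * (V₀ * R₄))) := by rw [ha, hα, hb, hx]; ring
    _ = _ := by rw [he, hf]; ring

/-- The weight in terms of the diagonal entries of the triangular factors. -/
theorem weight_mul (hs : IsOddSigma s) (G : GenericSystem s h a b c x) (hy : y ≤ N) :
    addWNum s h a b x N y / addWDen s h a b x N y * wpFactor s h (a - b) x y
        * upperFactor s h (a - b) a x N y y * lowerMat s h (a - b) a x y y
      = wpFactor s h (a - b) x 0 * upperFactor s h (a - b) a x N 0 0 := by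
  have ht := tot_mono hy
  have neg : ∀ w, s (-w) ≠ 0 → s w ≠ 0 := fun w hw h0 => hw (by rw [hs.neg, h0, neg_zero])
  have ha := weight_aux_a (a := a) (h := h) hs ht
  have hα := Finset.prod_congr rfl fun i (_ : i ∈ Finset.univ) =>
    weight_aux_base (h := h) hs (a - b + x i) (y i) ht
  have hb := Finset.prod_congr rfl fun i (_ : i ∈ Finset.univ) =>
    weight_aux_b (h := h) hs (b - x i) (hy i) (le_tot y i)
  simp only [Finset.prod_mul_distrib, Finset.prod_const, Finset.card_univ,
    Fintype.card_fin, Finset.prod_pow_eq_pow_sum] at hα hb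
  have hx1 := vdm_complement' (x := x) (h := h) hs hy
  have hx2 := vdm_shift hs h x y
  have sq := neg_one_pow_mul_self (tot y)
  have sq' : (((-1 : ℂ) ^ tot y) ^ n) * ((-1) ^ tot y) ^ n = 1 := by rw [← mul_pow, sq, one_pow]
  -- The squared Vandermonde product is used up once by the complement identity and once by the
  -- shift identity.
  have hx : vdm s (fun i => x i + y i * h) * (∏ i, ∏ j, bp s h (x i - (x j + N j * h)) (y i))
      * (vdm s (fun i => x i + y i * h)
        * ∏ i, ∏ j, bp s h (x j + y j * h - (x i + N i * h)) (N i - y i))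
      * (∏ i, ∏ j, bp s h (x i - (x j + y j * h)) (y i))
      = ((-1) ^ tot y) ^ n * (vdm s x * (∏ i, ∏ j, bp s h (h + x i - x j) (y i))
        * (vdm s x * ∏ i, ∏ j, bp s h (x j - (x i + N i * h)) (N i))) := by
    calc _ = (vdm s (fun i => x i + y i * h) * ((∏ i, ∏ j, bp s h (x i - (x j + N j * h)) (y i))
          * ∏ i, ∏ j, bp s h (x j + y j * h - (x i + N i * h)) (N i - y i)))
        * (vdm s (fun i => x i + y i * h) * ∏ i, ∏ j, bp s h (x i - (x j + y j * h)) (y i)) := by ring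
      _ = ((-1) ^ tot y * (-1) ^ tot y) * (((-1) ^ tot y) ^ n * (vdm s x
          * (∏ i, ∏ j, bp s h (h + x i - x j) (y i))
          * (vdm s x * ∏ i, ∏ j, bp s h (x j - (x i + N i * h)) (N i)))) := by
        rw [hx1, hx2]; ring
      _ = _ := by rw [sq, one_mul]
  rw [wpFactor_zero, upperFactor_zero]
  unfold addWNum addWDen wpFactor upperFactor lowerMat
  simp only [Finset.prod_mul_distrib]
  simp only [
    show ∀ i j, -((N j : ℂ) * h) + x i - x j = x i - (x j + N j * h) from fun i j => by ring,
    show ∀ i, b + ((tot y : ℂ) - y i) * h - x i = b - x i + (tot y - y i) * h from fun i => by ring,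
    show ∀ i, (tot N : ℂ) * h + a + x i - b = tot N * h + (a - b + x i) from fun i => by ring,
    show ∀ i, b + (1 - (N i : ℂ)) * h - x i = b - x i + (1 - N i) * h from fun i => by ring,
    show ∀ i, a + h + x i - b = a - b + x i + h from fun i => by ring,
    show ∀ i, a - b + (x i + (y i : ℂ) * h) = a - b + x i + y i * h from fun i => by ring,
    show ∀ i, h - (tot N : ℂ) * h - (a - b) - (x i + (y i : ℂ) * h)
      = h - tot N * h - (a - b + x i + y i * h) from fun i => by ring,
    show ∀ i, h - (tot N : ℂ) * h - (a - b) - x i = h - tot N * h - (a - b + x i) from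
      fun i => by ring,
    show ∀ i, h - (a - b) - (x i + (N i : ℂ) * h) + tot y * h + a
      = h + (b - x i) - N i * h + tot y * h from fun i => by ring,
    show ∀ i, h - (a - b) - (x i + (N i : ℂ) * h) + a = h + (b - x i) - N i * h from
      fun i => by ring,
    show ∀ i, a - b + h + (x i + (y i : ℂ) * h) = h + (a - b + x i + y i * h) from
      fun i => by ring,
    show ∀ i, a - b + h - (tot y : ℂ) * h + x i - a = h - tot y * h - (b - x i) from
      fun i => by ring]
  refine weight_alg sq sq' ha hα hb hx ?_ ?_ ?_ ?_
  · refine mul_ne_zero (mul_ne_zero (mul_ne_zero (mul_ne_zero ?_ ?_) ?_) ?_)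
      (mul_ne_zero (mul_ne_zero ?_ ?_) ?_)
    · simpa using G.params_a.vdm_ne_zero 0
    · exact G.ne_a 0 (by push_cast; ring)
    · exact bp_ne_zero s h fun j _ => G.ne_a (1 + tot N + j) (by push_cast; ring)
    · refine Finset.prod_ne_zero_iff.mpr fun i _ => Finset.prod_ne_zero_iff.mpr fun j _ =>
        bp_ne_zero s h fun m hm => ?_
      by_cases hij : i = j
      · subst hij
        exact G.step (1 + m) (by omega) (by push_cast; ring)
      · exact G.diff i j (1 + m) hij (by push_cast; ring)
    · exact Finset.prod_ne_zero_iff.mpr fun i _ => neg _ (G.ne_xb i 0 (by push_cast; ring))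
    · exact Finset.prod_ne_zero_iff.mpr fun i _ => bp_ne_zero s h fun j _ =>
        neg _ (G.ne_xb i (-1 + N i - j) (by push_cast; ring))
    · exact Finset.prod_ne_zero_iff.mpr fun i _ => bp_ne_zero s h fun j _ =>
        G.base i (1 + j) (by push_cast; ring)
  · refine mul_ne_zero ?_ ?_
    · exact Finset.prod_ne_zero_iff.mpr fun i _ => bp_ne_zero s h fun j _ =>
        neg _ (G.base i (-1 + tot N + y i - j) (by push_cast; ring))
    · exact Finset.prod_ne_zero_iff.mpr fun i _ => bp_ne_zero s h fun j _ =>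
        neg _ (G.ne_xb i (-1 + N i - tot y - j) (by push_cast; ring))
  · refine mul_ne_zero ?_ ?_
    · exact Finset.prod_ne_zero_iff.mpr fun i _ => bp_ne_zero s h fun j _ =>
        G.base i (1 + y i + j) (by push_cast; ring)
    · exact Finset.prod_ne_zero_iff.mpr fun i _ => bp_ne_zero s h fun j _ =>
        G.ne_xb i (1 - tot y + j) (by push_cast; ring)
  · refine mul_ne_zero ?_ ?_
    · exact Finset.prod_ne_zero_iff.mpr fun i _ => bp_ne_zero s h fun j _ =>
        neg _ (G.base i (-1 + tot N - j) (by push_cast; ring))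
    · exact Finset.prod_ne_zero_iff.mpr fun i _ => bp_ne_zero s h fun j _ =>
        neg _ (G.ne_xb i (-1 + N i - j) (by push_cast; ring))

end EllipticHyp

/-! ### The middle factors of the two series are reciprocal up to a constant. -/

namespace EllipticHyp

variable {n : ℕ} {s : ℂ → ℂ} {h a b c : ℂ} {x : Fin n → ℂ} {N u y : Fin n → ℕ}

theorem bp_complement (hs : IsOddSigma s) {y z : ℂ} {P r : ℕ} (hr : r ≤ P)
    (hyz : z + y + P * h = h) : bp s h z r * bp s h y (P - r) = (-1) ^ (P - r) * bp s h z P := by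
  have := bp_reverse (h := h) hs (y := z) (z := y) (P := P) (r := P - r) (by omega)
    (by linear_combination hyz)
  rwa [Nat.sub_sub_self hr] at this

theorem mid_alg {K A₁ A₂ B₁ B₂ C₁ C₂ D₁ D₂ A₁' A₂' B₁' B₂' C₁' C₂' D₁' D₂' U₁ U₂ V₁ V₂ W₁ W₂ X₁ X₂
      e f g : ℂ} (he : e ≠ 0) (hf : f * f = 1) (a₁ : A₁ * A₁' = f * U₁) (a₂ : A₂ * A₂' = f * U₂)
    (b₁ : B₁ * B₁' = e * V₁) (b₂ : B₂ * B₂' = e * V₂) (c₁ : C₁ * C₁' = e * W₁)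
    (c₂ : C₂ * C₂' = e * W₂) (d₁ : D₁ * D₁' = g * X₁) (d₂ : D₂ * D₂' = g * X₂) (hgf : g * g = 1) :
    K * (A₁ * A₂ / (B₁ * B₂)) * (C₁ * C₂ / (D₁ * D₂))
      * (A₂' * A₁' / (B₁' * B₂') * (C₁' * C₂' / (D₁' * D₂')))
      = K * (U₁ * U₂ / (V₁ * V₂)) * (W₁ * W₂ / (X₁ * X₂)) := by
  calc _ = K * ((A₁ * A₁') * (A₂ * A₂') / ((B₁ * B₁') * (B₂ * B₂')))
        * ((C₁ * C₁') * (C₂ * C₂') / ((D₁ * D₁') * (D₂ * D₂'))) := by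
        simp only [div_eq_mul_inv, mul_inv]; ring
    _ = K * ((f * f) * (U₁ * U₂) / ((e * e) * (V₁ * V₂)))
        * ((e * e) * (W₁ * W₂) / ((g * g) * (X₁ * X₂))) := by
        rw [a₁, a₂, b₁, b₂, c₁, c₂, d₁, d₂]; ring
    _ = K * ((U₁ * U₂) / ((e * e) * (V₁ * V₂))) * ((e * e) * (W₁ * W₂) / (X₁ * X₂)) := by
        rw [hf, hgf, one_mul, one_mul]
    _ = _ := by
        have : (e * e) * (e * e)⁻¹ = 1 := mul_inv_cancel₀ (mul_ne_zero he he)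
        simp only [div_eq_mul_inv, mul_inv] at this ⊢
        linear_combination K * (U₁ * U₂ * (V₁⁻¹ * V₂⁻¹)) * (W₁ * W₂ * (X₁⁻¹ * X₂⁻¹)) * this

/-- The product of the two middle factors does not depend on the summation index. -/
theorem fMid_mul_gMid (hs : IsOddSigma s) {k : Fin n → ℕ} (hk : k ≤ N) :
    fMid s h a b c x N k * gMid s h a b c x N k = fMid s h a b c x N N := by
  have ht := tot_mono hk
  have htot : ∑ i, (N i - k i) = tot N - tot k := by
    have := tot_add (N - k) k
    rw [tsub_add_cancel_of_le hk] at this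
    have h2 : tot (N - k) = ∑ i, (N i - k i) := rfl
    omega
  -- Each symbol of length k in the first factor meets its reflected symbol of complementary length
  -- in the second, and together they fill the full length. The signs come in equal pairs and
  -- cancel.
  have prodT : ∀ z y : Fin n → ℂ, (∀ i, z i + y i + tot N * h = h) →
      (∏ i, bp s h (z i) (tot k)) * ∏ i, bp s h (y i) (tot N - tot k)
        = ((-1) ^ (tot N - tot k)) ^ n * ∏ i, bp s h (z i) (tot N) := fun z y H => by
    rw [← Finset.prod_mul_distrib, Finset.prod_congr rfl fun i _ => bp_complement hs ht (H i),
      Finset.prod_mul_distrib, Finset.prod_const, Finset.card_univ, Fintype.card_fin]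
  have prodI : ∀ z y : Fin n → ℂ, (∀ i, z i + y i + N i * h = h) →
      (∏ i, bp s h (z i) (k i)) * ∏ i, bp s h (y i) (N i - k i)
        = (-1) ^ (tot N - tot k) * ∏ i, bp s h (z i) (N i) := fun z y H => by
    rw [← Finset.prod_mul_distrib, Finset.prod_congr rfl fun i _ => bp_complement hs (hk i) (H i),
      Finset.prod_mul_distrib, Finset.prod_pow_eq_pow_sum, htot]
  have prodIJ : ∀ z y : Fin n → Fin n → ℂ, (∀ i j, z i j + y i j + N i * h = h) →
      (∏ i, ∏ j, bp s h (z i j) (k i)) * ∏ i, ∏ j, bp s h (y i j) (N i - k i)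
        = ((-1) ^ (tot N - tot k)) ^ n * ∏ i, ∏ j, bp s h (z i j) (N i) := fun z y H => by
    rw [← Finset.prod_mul_distrib]
    simp only [← Finset.prod_mul_distrib]
    rw [Finset.prod_congr rfl fun i _ => Finset.prod_congr rfl fun j _ =>
      bp_complement hs (hk i) (H i j)]
    simp only [Finset.prod_mul_distrib, Finset.prod_const, Finset.card_univ, Fintype.card_fin,
      Finset.prod_pow, Finset.prod_pow_eq_pow_sum, htot]
  have sq := neg_one_pow_mul_self (tot N - tot k)
  have sq' : (((-1 : ℂ) ^ (tot N - tot k)) ^ n) * ((-1) ^ (tot N - tot k)) ^ n = 1 := by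
    rw [← mul_pow, sq, one_pow]
  rw [fMid, gMid, fMid,
    mul_comm (∏ i, ∏ j, bp s h (h - (x i + N i * h) + (x j + N j * h)) (N i - k i))]
  exact mid_alg (by simp) sq' (prodT _ _ fun i => by ring) (prodT _ _ fun i => by ring)
    (bp_complement hs ht (by ring)) (bp_complement hs ht (by ring))
    (prodI _ _ fun i => by ring) (prodI _ _ fun i => by ring)
    (prodIJ _ _ fun i j => by ring) (prodIJ _ _ fun i j => by ring) sq'

end EllipticHyp

/-! ### The norm. -/

namespace EllipticHyp

variable {n : ℕ} {s : ℂ → ℂ} {h a b c : ℂ} {x : Fin n → ℂ} {N u y : Fin n → ℕ}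

/-- Used with κ = a - b + x i + v i h, ξ = a - b + x i and m = N i - v i. Both sides are multiplied
by s κ so that every symbol becomes part of a string starting at κ; this is why s κ must not vanish.
-/
theorem norm_aux_base (hs : IsOddSigma s) (κ ξ : ℂ) (m : ℕ) {r M : ℕ} (hr : r ≤ M) (hκ : s κ ≠ 0) :
    bp s h (M * h + κ) m * (s (κ + m * h + M * h) * bp s h (h - M * h - κ) (M - r)
        * bp s h (h + κ) r * bp s h (h - M * h - ξ) M)
      = (-1) ^ r * (bp s h (h + κ) m * s (κ + r * h) * bp s h (h + (κ + m * h)) M * bp s h ξ M) := by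
  obtain ⟨q, rfl⟩ := Nat.exists_eq_add_of_le hr
  rw [Nat.add_sub_cancel_left, bp_reflect h hs (x := h - (r + q : ℕ) * h - ξ) (y := ξ) (by ring),
    bp_reflect h hs (x := h - (r + q : ℕ) * h - κ) (y := κ + r * h) (by push_cast; ring)]
  refine mul_left_cancel₀ hκ ?_
  have e1 := bp_shift s h κ r
  have e2 := bp_add s h κ r q
  have e3 := bp_add s h κ (r + q) m
  have e4 := bp_add s h (κ + h) m (r + q)
  have e5 := bp_shift s h κ (r + q + m)
  have s1 := neg_one_pow_mul_self q
  rw [add_comm m, show κ + h + m * h = h + (κ + m * h) by ring] at e4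
  rw [e3, e2, e4, show κ + ((r + q + m : ℕ) : ℂ) * h = κ + m * h + (r + q : ℕ) * h by push_cast; ring,
    add_comm κ ((r + q : ℕ) * h)] at e5
  rw [add_comm h κ, pow_add]
  linear_combination bp s h ((r + q : ℕ) * h + κ) m * s (κ + m * h + (r + q : ℕ) * h)
    * bp s h (κ + r * h) q * bp s h ξ (r + q) * (-1) ^ r * ((-1) ^ q * (-1) ^ q * (-e1) + s1 * (bp s h κ r * s (κ + r * h)))
    + (-1) ^ r * s (κ + r * h) * bp s h ξ (r + q) * e5

theorem norm_aux_eta (hs : IsOddSigma s) (η : ℂ) {p P : ℕ} (hp : p ≤ P) :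
    s η * bp s h (h - η - P * h) (P - p) * bp s h (η + h) p
      = (-1) ^ (P - p) * (s (η + p * h) * bp s h η P) := by
  obtain ⟨q, rfl⟩ := Nat.exists_eq_add_of_le hp
  rw [Nat.add_sub_cancel_left,
    bp_reflect h hs (x := h - η - (p + q : ℕ) * h) (y := η + p * h) (by push_cast; ring), bp_add]
  linear_combination (-(-1) ^ q * bp s h (η + p * h) q) * bp_shift s h η p

theorem norm_alg {D₀ DV DX Pv PN Yv YN Z E F A₀ A₁ A₂ K C₁ C₂ BC S S' X₁ X₂ P₁ P₂ P₃ P₄ B₁ B₂ H₁ H₂ H₃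
      T₀ TN Tv R₁ R₂ R₃ e d f : ℂ} (he : e * e = 1) (hd : d * d = 1)
    (ha : A₁ = e * A₂) (hc : C₁ = d * C₂) (hb : B₁ = e * B₂) (hη : S * H₁ * H₂ = e * d * (S' * H₃))
    (hα : P₁ * (TN * R₁ * R₂ * R₃) = f * (P₂ * Tv * P₃ * P₄))
    (hx : DV * Z * E * F * (DV * Yv) = f * e * (D₀ * Pv * DX * PN * YN))
    (h₁ : DV * Yv * (A₀ * BC) * (S' * (B₂ * H₃) * P₂) ≠ 0) (h₂ : R₃ * B₁ ≠ 0) (h₃ : DX * TN ≠ 0)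
    (h₄ : D₀ * T₀ ≠ 0) (h₅ : PN * YN ≠ 0) (h₆ : R₁ * H₁ ≠ 0) (h₇ : R₂ * H₂ ≠ 0) :
    D₀ * Pv * (A₁ * K * C₁) * (S * (X₁ * X₂) * P₁)
        / (DV * Yv * (A₀ * BC) * (S' * (B₂ * H₃) * P₂))
      = D₀ * T₀ * (A₂ * Z / (R₃ * B₁)) / (DX * TN)
        * (1 / (D₀ * T₀) * (P₄ * P₃ / (A₀ * BC)) * (X₁ * X₂ / (PN * YN)))
        * (DV * Tv * (K * E / (R₁ * H₁)) * (C₂ * F / (R₂ * H₂))) := by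
  have hAB : A₀ * BC ≠ 0 := fun h => h₁ (by rw [h]; ring)
  have hr : D₀ * T₀ * (A₂ * Z / (R₃ * B₁)) / (DX * TN)
        * (1 / (D₀ * T₀) * (P₄ * P₃ / (A₀ * BC)) * (X₁ * X₂ / (PN * YN)))
        * (DV * Tv * (K * E / (R₁ * H₁)) * (C₂ * F / (R₂ * H₂)))
      = D₀ * T₀ * (A₂ * Z * (P₄ * P₃) * (X₁ * X₂) * (DV * Tv) * (K * E) * (C₂ * F))
        / (D₀ * T₀ * (R₃ * B₁ * (DX * TN) * (A₀ * BC) * (PN * YN) * (R₁ * H₁) * (R₂ * H₂))) := by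
    simp only [div_eq_mul_inv, mul_inv, one_mul]; ring
  rw [hr, mul_div_mul_left _ _ h₄, div_eq_div_iff h₁ (mul_ne_zero (mul_ne_zero (mul_ne_zero
    (mul_ne_zero (mul_ne_zero h₂ h₃) hAB) h₅) h₆) h₇)]
  calc _ = A₁ * C₁ * B₁ * (S * H₁ * H₂) * (P₁ * (TN * R₁ * R₂ * R₃)) * (D₀ * Pv * DX * PN * YN)
        * (K * X₁ * X₂ * A₀ * BC) := by ring
    _ = (e * e) * (d * d) * (A₂ * C₂ * B₂ * (S' * H₃) * (P₂ * Tv * P₃ * P₄)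
        * (f * e * (D₀ * Pv * DX * PN * YN)) * (K * X₁ * X₂ * A₀ * BC)) := by
      rw [hη, hα, ha, hb, hc]; ring
    _ = _ := by rw [he, hd, ← hx]; ring

/-- The norm in terms of the diagonal entries of the triangular factors. -/
theorem norm_eq (hs : IsOddSigma s) (G : GenericSystem s h a b c x) {v : Fin n → ℕ} (hv : v ≤ N) :
    addGammaNum s h a b c x N v / addGammaDen s h a b c x N v
      = wpFactor s h (a - b) x 0 * upperFactor s h (a - b) a x N 0 0 / wpFactor s h (a - b) x N
        * fMid s h a b c x N N * (wpFactor s h (a - b) x v * upperFactor s h (a - b) c x N v v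
          * lowerMat s h (a - b) c x v v) := by
  have ht := tot_mono hv
  have htot : ∑ i, (N i - v i) = tot N - tot v := by
    have := tot_add (N - v) v
    rw [tsub_add_cancel_of_le hv] at this
    have h2 : tot (N - v) = ∑ i, (N i - v i) := rfl
    omega
  have hsub : (-1 : ℂ) ^ (tot N - tot v) = (-1) ^ tot N * (-1) ^ tot v := by
    obtain ⟨q, hq⟩ := Nat.exists_eq_add_of_le ht
    rw [hq, Nat.add_sub_cancel_left, pow_add]
    linear_combination (-(-1) ^ q) * neg_one_pow_mul_self (tot v)
  have c2 : ∀ i, ((N i - v i : ℕ) : ℂ) = N i - v i := fun i => Nat.cast_sub (hv i)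
  have neg : ∀ w, s (-w) ≠ 0 → s w ≠ 0 := fun w hw h0 => hw (by rw [hs.neg, h0, neg_zero])
  have ha := bp_reflect (s := s) h hs (x := a + h) (y := -(tot N * h) - a) (k := tot N) (by ring)
  have hc := bp_reflect (s := s) h hs (x := (1 - 2 * tot v) * h - c) (y := c + tot v * h) (k := tot v)
    (by ring)
  have hb : ∏ i, bp s h (h - (a - b) - (x i + N i * h) + a) (N i)
      = (-1) ^ tot N * ∏ i, bp s h (x i - b) (N i) := by
    rw [Finset.prod_congr rfl fun i _ => bp_reflect h hs
      (x := h - (a - b) - (x i + N i * h) + a) (y := x i - b) (k := N i) (by ring),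
      Finset.prod_mul_distrib, Finset.prod_pow_eq_pow_sum]
    rfl
  have hη := Finset.prod_congr rfl fun i (_ : i ∈ Finset.univ) =>
    norm_aux_eta (h := h) hs (a - b + x i - c - tot v * h) (hv i)
  have hα := Finset.prod_congr rfl fun i (_ : i ∈ Finset.univ) =>
    norm_aux_base (h := h) hs (a - b + x i + v i * h) (a - b + x i) (N i - v i) ht
      (G.base i (v i) (by push_cast; ring))
  have hZ : ∏ i, ∏ j, bp s h (x j - (x i + N i * h)) (N i)
      = ((-1) ^ tot N) ^ n * ∏ i, ∏ j, bp s h (h + x i - x j) (N i) := by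
    rw [Finset.prod_congr rfl fun i _ => Finset.prod_congr rfl fun j _ => bp_reflect h hs
      (x := x j - (x i + N i * h)) (y := h + x i - x j) (k := N i) (by ring)]
    simp only [Finset.prod_mul_distrib, Finset.prod_const, Finset.card_univ, Fintype.card_fin,
      Finset.prod_pow, Finset.prod_pow_eq_pow_sum]
    rfl
  simp only [Finset.prod_mul_distrib, Finset.prod_const, Finset.card_univ, Fintype.card_fin,
    Finset.prod_pow_eq_pow_sum, htot, hsub] at hη hα
  have hx1 := vdm_complement' (x := x) (h := h) hs hv
  have hx2 := vdm_shift hs h x v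
  have hx3 := vdm_shift hs h x N
  have sq := neg_one_pow_mul_self (tot v)
  have sqN := neg_one_pow_mul_self (tot N)
  have sq' : (((-1 : ℂ) ^ tot v) ^ n) * ((-1) ^ tot v) ^ n = 1 := by rw [← mul_pow, sq, one_pow]
  have sqN' : (((-1 : ℂ) ^ tot N) ^ n) * ((-1) ^ tot N) ^ n = 1 := by rw [← mul_pow, sqN, one_pow]
  -- Besides the complement identity at v, the shift identity is used twice, at v and at N, the
  -- latter introducing the Vandermonde product of the normalization W(N).
  have hx : vdm s (fun i => x i + v i * h) * (∏ i, ∏ j, bp s h (x j - (x i + N i * h)) (N i))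
      * (∏ i, ∏ j, bp s h (x j + v j * h - (x i + N i * h)) (N i - v i))
      * (∏ i, ∏ j, bp s h (x i - (x j + v j * h)) (v i))
      * (vdm s (fun i => x i + v i * h) * ∏ i, ∏ j, bp s h (x i - (x j + N j * h)) (v i))
      = ((-1) ^ tot v) ^ n * (-1) ^ tot N * (vdm s x * (∏ i, ∏ j, bp s h (h + x i - x j) (v i))
        * vdm s (fun i => x i + N i * h) * (∏ i, ∏ j, bp s h (h + x i - x j) (N i))
        * ∏ i, ∏ j, bp s h (x i - (x j + N j * h)) (N i)) := by
    rw [hZ] at hx1 ⊢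
    generalize (∏ i, ∏ j, bp s h (h + x i - x j) (N i)) = PN at *
    generalize (∏ i, ∏ j, bp s h (h + x i - x j) (v i)) = Pv at *
    generalize vdm s (fun i => x i + v i * h) = DV at *
    generalize vdm s (fun i => x i + N i * h) = DX at *
    generalize (∏ i, ∏ j, bp s h (x i - (x j + N j * h)) (N i)) = YN at *
    generalize (∏ i, ∏ j, bp s h (x i - (x j + N j * h)) (v i)) = Yv at *
    generalize (∏ i, ∏ j, bp s h (x i - (x j + v j * h)) (v i)) = F at *
    generalize (∏ i, ∏ j, bp s h (x j + v j * h - (x i + N i * h)) (N i - v i)) = E at *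
    generalize vdm s x = D₀ at *
    generalize ((-1 : ℂ) ^ tot v) ^ n = f at *
    generalize ((-1 : ℂ) ^ tot N) ^ n = g at *
    generalize (-1 : ℂ) ^ tot v = d at *
    generalize (-1 : ℂ) ^ tot N = e at *
    calc _ = (DV * F) * (DV * (Yv * E)) * (g * PN) := by ring
      _ = (d * d) * (g * g) * (f * D₀ * D₀ * PN * PN * Pv) := by rw [hx2, hx1]; ring
      _ = (e * e) * (f * D₀ * D₀ * PN * PN * Pv) := by rw [sq, sqN', sqN, one_mul]
      _ = f * e * (D₀ * Pv * PN) * (DX * YN) := by rw [hx3]; ring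
      _ = _ := by ring
  rw [wpFactor_zero, upperFactor_zero]
  unfold addGammaNum addGammaDen wpFactor upperFactor lowerMat fMid
  simp only [Finset.prod_mul_distrib]
  simp only [c2] at hα
  simp only [
    show ∀ i j, -((N j : ℂ) * h) + x i - x j = x i - (x j + N j * h) from fun i j => by ring,
    show (-(tot v : ℂ) - tot N) * h - c = -(tot v * h) - tot N * h - c by ring,
    show ∀ i, -((tot v : ℂ) * h) + a + x i - (b + c) = a - b + x i - c - tot v * h from
      fun i => by ring,
    show ∀ i, a + (1 - (tot N : ℂ)) * h + x i - (2 * b + c)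
      = a + (1 - tot N) * h - (2 * b + c) + x i from fun i => by ring,
    show ∀ i, ((v i : ℂ) + tot N) * h + a + x i - b = tot N * h + (a - b + x i + v i * h) from
      fun i => by ring,
    show a + h - b = a - b + h by ring,
    show ∀ i, (-(tot v : ℂ) + v i) * h + a + x i - (b + c) = a - b + x i - c - tot v * h + v i * h from
      fun i => by ring,
    show ∀ i, (1 + (v i : ℂ)) * h + a + x i - b = h + (a - b + x i + v i * h) from
      fun i => by ring,
    show ∀ i, a - b + (x i + (N i : ℂ) * h) + tot N * h
      = a - b + x i + v i * h + (N i - v i) * h + tot N * h from fun i => by ring,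
    show ∀ i, a - b + h + (x i + (N i : ℂ) * h)
      = h + (a - b + x i + v i * h + (N i - v i) * h) from fun i => by ring,
    show ∀ i, a - b + (x i + (v i : ℂ) * h) + tot v * h = a - b + x i + v i * h + tot v * h from
      fun i => by ring,
    show ∀ i, h - (tot N : ℂ) * h - (a - b) - (x i + (v i : ℂ) * h)
      = h - tot N * h - (a - b + x i + v i * h) from fun i => by ring,
    show ∀ i, h - (tot N : ℂ) * h - (a - b) - x i = h - tot N * h - (a - b + x i) from
      fun i => by ring,
    show ∀ i, h - (a - b) - (x i + (N i : ℂ) * h) + tot v * h + c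
      = h - (a - b + x i - c - tot v * h) - N i * h from fun i => by ring,
    show ∀ i, a - b + h + (x i + (v i : ℂ) * h) = h + (a - b + x i + v i * h) from
      fun i => by ring,
    show ∀ i, a - b + h - (tot v : ℂ) * h + x i - c = a - b + x i - c - tot v * h + h from
      fun i => by ring]
  refine norm_alg sqN sq ha hc hb hη hα hx ?_ ?_ ?_ ?_ ?_ ?_ ?_
  · refine mul_ne_zero (mul_ne_zero (mul_ne_zero (G.params_a.vdm_ne_zero v) ?_) (mul_ne_zero ?_ ?_))
      (mul_ne_zero (mul_ne_zero ?_ (mul_ne_zero ?_ ?_)) ?_)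
    · refine Finset.prod_ne_zero_iff.mpr fun i _ => Finset.prod_ne_zero_iff.mpr fun j _ =>
        bp_ne_zero s h fun m hm => ?_
      by_cases hij : i = j
      · subst hij
        have : v i ≤ N i := hv i
        exact G.step (-N i + m) (by omega) (by push_cast; ring)
      · exact G.diff i j (-N j + m) hij (by push_cast; ring)
    · exact bp_ne_zero s h fun j _ => G.ne_ab (1 + j) (by push_cast; ring)
    · exact bp_ne_zero s h fun j _ => G.ne_bc (tot N + j) (by push_cast; ring)
    · exact Finset.prod_ne_zero_iff.mpr fun i _ => G.ne_xc i (-tot v + v i) (by push_cast; ring)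
    · exact Finset.prod_ne_zero_iff.mpr fun i _ => bp_ne_zero s h fun j _ =>
        G.ne_xb i j (by push_cast; ring)
    · exact Finset.prod_ne_zero_iff.mpr fun i _ => bp_ne_zero s h fun j _ =>
        G.ne_xc i (-tot v + j) (by push_cast; ring)
    · exact Finset.prod_ne_zero_iff.mpr fun i _ => bp_ne_zero s h fun j _ =>
        G.base i (1 + v i + j) (by push_cast; ring)
  · refine mul_ne_zero ?_ ?_
    · exact Finset.prod_ne_zero_iff.mpr fun i _ => bp_ne_zero s h fun j _ =>
        neg _ (G.base i (-1 + tot N - j) (by push_cast; ring))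
    · exact Finset.prod_ne_zero_iff.mpr fun i _ => bp_ne_zero s h fun j _ =>
        neg _ (G.ne_xb i (-1 + N i - j) (by push_cast; ring))
  · exact mul_ne_zero (G.params_a.vdm_ne_zero N) (Finset.prod_ne_zero_iff.mpr fun i _ =>
      G.base i (N i + tot N) (by push_cast; ring))
  · refine mul_ne_zero ?_ (Finset.prod_ne_zero_iff.mpr fun i _ => G.base i 0 (by push_cast; ring))
    simpa using G.params_a.vdm_ne_zero 0
  · refine mul_ne_zero ?_ ?_
    · refine Finset.prod_ne_zero_iff.mpr fun i _ => Finset.prod_ne_zero_iff.mpr fun j _ =>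
        bp_ne_zero s h fun m hm => ?_
      by_cases hij : i = j
      · subst hij
        exact G.step (1 + m) (by omega) (by push_cast; ring)
      · exact G.diff i j (1 + m) hij (by push_cast; ring)
    · refine Finset.prod_ne_zero_iff.mpr fun i _ => Finset.prod_ne_zero_iff.mpr fun j _ =>
        bp_ne_zero s h fun m hm => ?_
      by_cases hij : i = j
      · subst hij
        exact G.step (-N i + m) (by omega) (by push_cast; ring)
      · exact G.diff i j (-N j + m) hij (by push_cast; ring)
  · refine mul_ne_zero ?_ ?_
    · exact Finset.prod_ne_zero_iff.mpr fun i _ => bp_ne_zero s h fun j _ =>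
        neg _ (G.base i (-1 + tot N + v i - j) (by push_cast; ring))
    · exact Finset.prod_ne_zero_iff.mpr fun i _ => bp_ne_zero s h fun j _ =>
        neg _ (G.ne_xc i (-1 + N i - tot v - j) (by push_cast; ring))
  · refine mul_ne_zero ?_ ?_
    · exact Finset.prod_ne_zero_iff.mpr fun i _ => bp_ne_zero s h fun j _ =>
        G.base i (1 + v i + j) (by push_cast; ring)
    · exact Finset.prod_ne_zero_iff.mpr fun i _ => bp_ne_zero s h fun j _ =>
        G.ne_xc i (1 - tot v + j) (by push_cast; ring)

end EllipticHyp

/-! ### Biorthogonality for generic parameters. -/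

namespace EllipticHyp

variable {n : ℕ} {s : ℂ → ℂ} {h a b c : ℂ} {x : Fin n → ℂ} {N u v y : Fin n → ℕ}

theorem upperFactor_eq_zero (hs : IsOddSigma s) {α : ℂ} {t : Fin n → ℕ} (hv : v ≤ N) (hvt : ¬ v ≤ t) :
    upperFactor s h α c x N v t = 0 := by
  obtain ⟨l, hl⟩ : ∃ l, t l < v l := by
    by_contra hcon
    push Not at hcon
    exact hvt hcon
  have hl' : v l ≤ N l := hv l
  have : ∏ i, ∏ j, bp s h (x j + v j * h - (x i + N i * h)) (N i - t i) = 0 :=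
    Finset.prod_eq_zero (Finset.mem_univ l) (Finset.prod_eq_zero (Finset.mem_univ l)
      (bp_eq_zero s h (j := N l - v l) (by omega) (by
        rw [Nat.cast_sub hl', show x l + v l * h - (x l + N l * h) + (N l - v l) * h = 0 by ring,
          hs.zero])))
  rw [upperFactor, this, mul_zero, zero_div]

/-- Triangularity extends the range to the box [0, N], which depends on neither u nor y, so the
order of summation can be exchanged later. `addG_eq_sum` does the same after reversing the index. -/
theorem addF_eq_sum (hs : IsOddSigma s) (hu : u ≤ N) :
    addF s h a b c x N u y = ∑ k ∈ Finset.Icc 0 N, lowerMat s h (a - b) c x u k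
      * (wpFactor s h (a - b) x k * fMid s h a b c x N k) * lowerMat s h (a - b) a x y k := by
  rw [addF, Finset.sum_congr rfl fun k _ => f_term_eq k]
  refine Finset.sum_subset (Finset.Icc_subset_Icc le_rfl (inf_le_left.trans hu)) fun k _ hk => ?_
  by_cases h1 : k ≤ u
  · have h2 : ¬ k ≤ y := fun h2 => hk (Finset.mem_Icc.mpr ⟨fun i => Nat.zero_le _, le_inf h1 h2⟩)
    rw [lowerMat_eq_zero hs h2, mul_zero]
  · rw [lowerMat_eq_zero hs h1, zero_mul, zero_mul]

theorem addG_eq_sum (hs : IsOddSigma s) (hu : u ≤ N) (hy : y ≤ N) :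
    addG s h a b c x N u y = ∑ t ∈ Finset.Icc 0 N, upperFactor s h (a - b) c x N u t
      * (wpFactor s h (a - b) x t / wpFactor s h (a - b) x N * gMid s h a b c x N t)
      * upperFactor s h (a - b) a x N y t := by
  rw [addG, Finset.sum_subset (s₂ := Finset.Icc 0 N) (Finset.Icc_subset_Icc le_rfl tsub_le_self)
    fun k hk hk' => ?_]
  · refine Finset.sum_nbij' (fun k => N - k) (fun t => N - t)
      (fun k _ => Finset.mem_Icc.mpr ⟨fun i => Nat.zero_le _, tsub_le_self⟩)
      (fun k _ => Finset.mem_Icc.mpr ⟨fun i => Nat.zero_le _, tsub_le_self⟩)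
      (fun k hk => tsub_tsub_cancel_of_le (Finset.mem_Icc.mp hk).2)
      (fun k hk => tsub_tsub_cancel_of_le (Finset.mem_Icc.mp hk).2) fun k hk => ?_
    rw [← g_term_eq hs tsub_le_self, tsub_tsub_cancel_of_le (Finset.mem_Icc.mp hk).2]
  · have hkN := (Finset.mem_Icc.mp hk).2
    have e := g_term_eq (h := h) (a := a) (b := b) (c := c) (x := x) (u := u) (y := y) hs
      (k := N - k) (N := N) tsub_le_self
    rw [tsub_tsub_cancel_of_le hkN] at e
    rw [e]
    by_cases h1 : u ≤ N - k
    · have h2 : ¬ y ≤ N - k := fun h2 => hk' (Finset.mem_Icc.mpr ⟨fun i => Nat.zero_le _, fun i => by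
        have h1' : u i ≤ N i - k i := h1 i
        have h2' : y i ≤ N i - k i := h2 i
        have h3' : k i ≤ N i := hkN i
        show k i ≤ N i - (u i ⊔ y i)
        omega⟩)
      rw [upperFactor_eq_zero hs hy h2, mul_zero]
    · rw [upperFactor_eq_zero hs hu h1, zero_mul, zero_mul]

/-- Biorthogonality for generic parameters. -/
theorem sum_weight_of_generic (hs : IsOddSigma s) (G : GenericSystem s h a b c x) (hu : u ≤ N)
    (hv : v ≤ N) :
    ∑ y ∈ Finset.Icc 0 N, addWNum s h a b x N y / addWDen s h a b x N y
        * addF s h a b c x N u y * addG s h a b c x N v y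
      = if u = v then addGammaNum s h a b c x N u / addGammaDen s h a b c x N u else 0 := by
  set D := wpFactor s h (a - b) x 0 * upperFactor s h (a - b) a x N 0 0 with hD
  set W := wpFactor s h (a - b) x with hW
  set E := W v * upperFactor s h (a - b) c x N v v * lowerMat s h (a - b) c x v v with hE
  have hWN : W N ≠ 0 := G.params_a.wpFactor_ne_zero N
  have hE0 : E ≠ 0 := mul_ne_zero (mul_ne_zero (G.params_c.wpFactor_ne_zero v)
    (G.params_c.upperFactor_ne_zero hs le_rfl)) (G.params_c.lowerMat_self_ne_zero v)
  -- The weight is designed to cancel the y-dependent normalization of the inverse matrix.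
  have hwt : ∀ y ≤ N, ∀ t, addWNum s h a b x N y / addWDen s h a b x N y
      * (W t * upperFactor s h (a - b) a x N y t) = D * lowerInv s h (a - b) a x N t y := by
    intro y hy t
    by_cases hyt : y ≤ t
    · rw [lowerInv, if_pos hyt, hD, ← weight_mul hs G hy]
      have h1 := G.params_a.wpFactor_ne_zero y
      have h2 := G.params_a.upperFactor_ne_zero (N := N) hs (le_refl y)
      have h3 := G.params_a.lowerMat_self_ne_zero y
      generalize addWNum s h a b x N y / addWDen s h a b x N y = w
      rw [hW]
      field_simp
    · rw [lowerInv, if_neg hyt, upperFactor_eq_zero hs hy hyt, mul_zero, mul_zero, mul_zero]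
  -- The factor of g that depends on v is already a column of the inverse matrix, up to the constant
  -- E.
  have hct : ∀ t, upperFactor s h (a - b) c x N v t * W t = E * lowerInv s h (a - b) c x N t v := by
    intro t
    by_cases hvt : v ≤ t
    · rw [lowerInv, if_pos hvt, ← hW, ← hE, mul_div_cancel₀ _ hE0, mul_comm]
    · rw [lowerInv, if_neg hvt, upperFactor_eq_zero hs hv hvt, zero_mul, mul_zero]
  -- The sum over y is the first of the two matrix inversions, with parameter a.
  have key : ∀ k ∈ Finset.Icc 0 N, ∀ t ∈ Finset.Icc 0 N,
      ∑ y ∈ Finset.Icc 0 N, addWNum s h a b x N y / addWDen s h a b x N y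
        * (W t * upperFactor s h (a - b) a x N y t) * lowerMat s h (a - b) a x y k
      = D * if t = k then 1 else 0 := by
    intro k hk t ht
    rw [← G.params_a.sum_lowerInv_mul_lowerMat hs (Finset.mem_Icc.mp ht).2 (Finset.mem_Icc.mp hk).2,
      Finset.mul_sum]
    refine Finset.sum_congr rfl fun y hy => ?_
    rw [hwt y (Finset.mem_Icc.mp hy).2 t, mul_assoc]
  calc _ = ∑ y ∈ Finset.Icc 0 N, ∑ k ∈ Finset.Icc 0 N, ∑ t ∈ Finset.Icc 0 N,
        lowerMat s h (a - b) c x u k * (W k * fMid s h a b c x N k)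
          * (upperFactor s h (a - b) c x N v t * (gMid s h a b c x N t / W N))
          * (addWNum s h a b x N y / addWDen s h a b x N y
            * (W t * upperFactor s h (a - b) a x N y t) * lowerMat s h (a - b) a x y k) := by
        refine Finset.sum_congr rfl fun y hy => ?_
        rw [addF_eq_sum hs hu, addG_eq_sum hs hv (Finset.mem_Icc.mp hy).2, mul_assoc,
          Finset.sum_mul_sum, Finset.mul_sum]
        refine Finset.sum_congr rfl fun k _ => ?_
        rw [Finset.mul_sum]
        refine Finset.sum_congr rfl fun t _ => ?_
        ring
    _ = ∑ k ∈ Finset.Icc 0 N, ∑ t ∈ Finset.Icc 0 N,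
        lowerMat s h (a - b) c x u k * (W k * fMid s h a b c x N k)
          * (upperFactor s h (a - b) c x N v t * (gMid s h a b c x N t / W N))
          * (D * if t = k then 1 else 0) := by
        rw [Finset.sum_comm]
        refine Finset.sum_congr rfl fun k hk => ?_
        rw [Finset.sum_comm]
        refine Finset.sum_congr rfl fun t ht => ?_
        rw [← key k hk t ht, Finset.mul_sum]
    -- On the diagonal t = k the middle factors multiply to a constant, so the second inversion,
    -- with parameter c, applies.
    _ = ∑ k ∈ Finset.Icc 0 N, D / W N * fMid s h a b c x N N * E
        * (lowerMat s h (a - b) c x u k * lowerInv s h (a - b) c x N k v) := by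
        refine Finset.sum_congr rfl fun k hk => ?_
        rw [Finset.sum_eq_single k (fun t _ htk => by rw [if_neg htk]; ring)
          fun hk' => absurd hk hk', if_pos rfl, ← fMid_mul_gMid hs (Finset.mem_Icc.mp hk).2]
        rw [div_eq_mul_inv, div_eq_mul_inv]
        linear_combination lowerMat s h (a - b) c x u k * fMid s h a b c x N k
          * gMid s h a b c x N k * (W N)⁻¹ * D * hct k
    _ = _ := by
        rw [← Finset.mul_sum, G.params_c.sum_lowerMat_mul_lowerInv hs hu]
        split_ifs with huv
        · subst huv
          rw [norm_eq hs G hu, mul_one]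
        · rw [mul_zero]

end EllipticHyp

/-! ### Removing genericity by density and continuity. -/

namespace EllipticHyp

/-- The reals have infinite dimension over ℚ. The resulting direction changes every nontrivial
integer combination of the parameters. -/
theorem exists_complex_int_independent (ι : Type*) [Fintype ι] :
    ∃ l : ι → ℂ, ∀ k : ι → ℤ, k ≠ 0 → ∑ i, k i * l i ≠ 0 := by
  obtain ⟨v, hv⟩ := exists_linearIndependent_of_le_rank (R := ℚ) (M := ℝ) (n := Fintype.card ι)
    (by rw [Real.rank_rat_real]; exact (Cardinal.nat_lt_continuum _).le)
  refine ⟨fun i => (v (Fintype.equivFin ι i) : ℝ), fun k hk h0 => hk ?_⟩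
  have hv' := hv.comp _ (Fintype.equivFin ι).injective
  rw [Fintype.linearIndependent_iff] at hv'
  funext i
  have := hv' (fun i => (k i : ℚ)) (by
    have h1 : ((∑ i, (k i : ℝ) * v (Fintype.equivFin ι i) : ℝ) : ℂ) = 0 := by
      push_cast; exact h0
    have h2 := Complex.ofReal_eq_zero.mp h1
    simpa [Rat.smul_def] using h2) i
  exact_mod_cast this

namespace IsOddSigma

variable {s : ℂ → ℂ} (hs : IsOddSigma s)
include hs

/-- Along the line, each nontrivial integer combination is a nonconstant affine function of t, so it
meets the countable zero set of s for countably many t only. There are countably many combinations.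
-/
theorem dense_generic {ι : Type*} [Fintype ι] (P : ι → ℂ) {l : ι → ℂ}
    (hl : ∀ k : ι → ℤ, k ≠ 0 → ∑ i, k i * l i ≠ 0) :
    Dense {t : ℂ | ∀ k : ι → ℤ, k ≠ 0 → s (∑ i, k i * (P i + t * l i)) ≠ 0} := by
  have hc : (⋃ k ∈ {k : ι → ℤ | k ≠ 0}, {t : ℂ | s (∑ i, k i * (P i + t * l i)) = 0}).Countable := by
    refine Set.Countable.biUnion (Set.to_countable _) fun k hk => ?_
    have he : ∀ t, ∑ i, k i * (P i + t * l i) = ∑ i, k i * P i + t * ∑ i, k i * l i := fun t => by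
      rw [Finset.mul_sum, ← Finset.sum_add_distrib]
      exact Finset.sum_congr rfl fun i _ => by ring
    exact hs.countable_zeros.preimage_of_injOn (f := fun t => ∑ i, k i * (P i + t * l i))
      fun t _ t' _ htt => by
        simp only [he] at htt
        exact mul_right_cancel₀ (hl k hk) (add_left_cancel htt)
  refine (hc.dense_compl ℂ).mono ?_
  intro t ht k hk h0
  exact ht (Set.mem_biUnion (x := k) hk h0)

end IsOddSigma

/-- Every condition concerns an integer combination of h, a, b, c and the x i with a nonzero
coefficient vector. -/
theorem GenericSystem.of_forall {n : ℕ} {s : ℂ → ℂ} {h a b c : ℂ} {x : Fin n → ℂ}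
    (H : ∀ k : Fin n ⊕ Fin 4 → ℤ, k ≠ 0 →
      s (∑ i, k i * (Sum.elim x ![h, a, b, c] : Fin n ⊕ Fin 4 → ℂ) i) ≠ 0) :
    GenericSystem s h a b c x := by
  have K : ∀ {w : ℂ} (k : Fin n → ℤ) (m m₁ m₂ m₃ : ℤ), (k ≠ 0 ∨ m ≠ 0 ∨ m₁ ≠ 0 ∨ m₂ ≠ 0 ∨ m₃ ≠ 0) →
      w = ∑ i, k i * x i + (m * h + m₁ * a + m₂ * b + m₃ * c) → s w ≠ 0 := by
    intro w k m m₁ m₂ m₃ hne hw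
    have := H (Sum.elim k ![m, m₁, m₂, m₃]) fun h0 => by
      have e : ∀ j, (Sum.elim k ![m, m₁, m₂, m₃] : Fin n ⊕ Fin 4 → ℤ) j = 0 := fun j => congrFun h0 j
      rcases hne with h | h | h | h | h
      · exact h (funext fun i => e (Sum.inl i))
      · exact h (e (Sum.inr 0))
      · exact h (e (Sum.inr 1))
      · exact h (e (Sum.inr 2))
      · exact h (e (Sum.inr 3))
    rw [Fintype.sum_sum_type, Fin.sum_univ_four] at this
    rw [hw]
    simpa using this
  have hsum : ∀ i, ∑ j, ((Pi.single i 1 : Fin n → ℤ) j : ℂ) * x j = x i := fun i => by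
    rw [Finset.sum_eq_single i (fun j _ hj => by rw [Pi.single_eq_of_ne hj]; simp) (by simp)]
    simp
  constructor
  · intro w m hm hw
    exact K 0 m 0 0 0 (by simp [hm]) (by simp [hw])
  · intro w i m hw
    exact K (Pi.single i 1) m 1 (-1) 0 (by simp) (by rw [hsum, hw]; push_cast; ring)
  · intro w i j m hij hw
    refine K (Pi.single i 1 - Pi.single j 1) m 0 0 0 (Or.inl fun h => ?_) ?_
    · have := congrFun h i
      simp [hij] at this
    · simp only [Pi.sub_apply, Int.cast_sub, sub_mul, Finset.sum_sub_distrib, hsum, hw]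
      push_cast; ring
  · intro w m hw
    exact K 0 m 1 0 0 (by simp) (by simp [hw, add_comm])
  · intro w m hw
    exact K 0 m 0 0 1 (by simp) (by simp [hw, add_comm])
  · intro w m hw
    exact K 0 m 1 (-1) 0 (by simp) (by rw [hw]; simp; ring)
  · intro w m hw
    exact K 0 m 0 1 1 (by simp) (by rw [hw]; simp; ring)
  · intro w i m hw
    exact K (Pi.single i 1) m 0 (-1) 0 (by simp) (by rw [hsum, hw]; push_cast; ring)
  · intro w i m hw
    exact K (Pi.single i 1) m 1 (-1) (-1) (by simp) (by rw [hsum, hw]; push_cast; ring)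

section Continuity

variable {X : Type*} [TopologicalSpace X] {s : ℂ → ℂ}

@[fun_prop]
theorem continuous_bp (hs : Continuous s) {f g : X → ℂ} (hf : Continuous f) (hg : Continuous g)
    (k : ℕ) : Continuous fun t => bp s (f t) (g t) k := by
  unfold bp
  fun_prop

theorem continuous_vdm (hs : Continuous s) {n : ℕ} {z : X → Fin n → ℂ} (hz : Continuous z) :
    Continuous fun t => vdm s (z t) := by
  unfold vdm
  fun_prop

theorem continuous_vecCons {n : ℕ} {f : X → ℂ} {g : X → Fin n → ℂ} (hf : Continuous f)
    (hg : Continuous g) : Continuous fun t => Matrix.vecCons (f t) (g t) := by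
  refine continuous_pi fun i => ?_
  refine Fin.cases ?_ (fun j => ?_) i
  · simpa using hf
  · simpa [Function.comp_def] using (continuous_apply j).comp hg

theorem continuous_append {m n : ℕ} {f : X → Fin m → ℂ} {g : X → Fin n → ℂ} (hf : Continuous f)
    (hg : Continuous g) : Continuous fun t => Fin.append (f t) (g t) := by
  refine continuous_pi fun i => ?_
  refine Fin.addCases (fun j => ?_) (fun j => ?_) i
  · simpa [Function.comp_def] using (continuous_apply j).comp hf
  · simpa [Function.comp_def] using (continuous_apply j).comp hg

theorem continuous_addNum (hs : Continuous s) {m n : ℕ} {h A : X → ℂ} {B : X → Fin (m + 2) → ℂ}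
    {C : X → Fin (m + n + 2) → ℂ} {z : X → Fin n → ℂ} (hh : Continuous h) (hA : Continuous A)
    (hB : Continuous B) (hC : Continuous C) (hz : Continuous z) (k : Fin n → ℕ) :
    Continuous fun t => addNum s (h t) (A t) (B t) (C t) (z t) k := by
  have := continuous_vdm hs (z := fun t i => z t i + k i * h t) (by fun_prop)
  unfold addNum
  fun_prop

theorem continuous_addDen (hs : Continuous s) {m n : ℕ} {h A : X → ℂ} {B : X → Fin (m + 2) → ℂ}
    {C : X → Fin (m + n + 2) → ℂ} {z : X → Fin n → ℂ} (hh : Continuous h) (hA : Continuous A)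
    (hB : Continuous B) (hC : Continuous C) (hz : Continuous z) (k : Fin n → ℕ) :
    Continuous fun t => addDen s (h t) (A t) (B t) (C t) (z t) k := by
  have := continuous_vdm hs hz
  unfold addDen
  fun_prop

variable {n : ℕ} {h a b c : X → ℂ} {x : X → Fin n → ℂ} {N u v y : Fin n → ℕ}

theorem continuousAt_addF (hs : Continuous s) (hh : Continuous h) (ha : Continuous a)
    (hb : Continuous b) (hc : Continuous c) (hx : Continuous x) {t₀ : X}
    (hne : ∀ k ≤ u ⊓ y, addDen s (h t₀) (a t₀ - b t₀) (addFB (h t₀) (a t₀) (b t₀) (c t₀) (x t₀) N u y)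
      (addFC (h t₀) (a t₀) (b t₀) (c t₀) (x t₀) N u y) (x t₀) k ≠ 0) :
    ContinuousAt (fun t => addF s (h t) (a t) (b t) (c t) (x t) N u y) t₀ := by
  have hB : Continuous fun t => addFB (h t) (a t) (b t) (c t) (x t) N u y :=
    continuous_vecCons (by fun_prop) (continuous_vecCons (by fun_prop) (by fun_prop))
  have hC : Continuous fun t => addFC (h t) (a t) (b t) (c t) (x t) N u y :=
    continuous_vecCons (by fun_prop) (continuous_vecCons (by fun_prop)
      (continuous_append (by fun_prop) (by fun_prop)))
  unfold addF
  refine tendsto_finsetSum _ fun k hk => ?_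
  exact (continuous_addNum hs hh (ha.sub hb) hB hC hx k).continuousAt.div
    (continuous_addDen hs hh (ha.sub hb) hB hC hx k).continuousAt (hne k (Finset.mem_Icc.mp hk).2)

theorem continuousAt_addG (hs : Continuous s) (hh : Continuous h) (ha : Continuous a)
    (hb : Continuous b) (hc : Continuous c) (hx : Continuous x) {t₀ : X}
    (hne : ∀ k ≤ N - u ⊔ y, addDen s (h t₀) (addGA (h t₀) (a t₀) (b t₀) N)
      (addGB (h t₀) (a t₀) (b t₀) (c t₀) (x t₀) N u y)
      (addGC (h t₀) (a t₀) (b t₀) (c t₀) (x t₀) N u y) (addGZ (h t₀) (x t₀) N) k ≠ 0) :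
    ContinuousAt (fun t => addG s (h t) (a t) (b t) (c t) (x t) N u y) t₀ := by
  have hA : Continuous fun t => addGA (h t) (a t) (b t) N := by unfold addGA; fun_prop
  have hz : Continuous fun t => addGZ (h t) (x t) N := by unfold addGZ; fun_prop
  have hB : Continuous fun t => addGB (h t) (a t) (b t) (c t) (x t) N u y :=
    continuous_vecCons (by fun_prop) (continuous_vecCons (by fun_prop) (by fun_prop))
  have hC : Continuous fun t => addGC (h t) (a t) (b t) (c t) (x t) N u y :=
    continuous_vecCons (by fun_prop) (continuous_vecCons (by fun_prop)
      (continuous_append (by fun_prop) (by fun_prop)))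
  unfold addG
  refine tendsto_finsetSum _ fun k hk => ?_
  exact (continuous_addNum hs hh hA hB hC hz k).continuousAt.div
    (continuous_addDen hs hh hA hB hC hz k).continuousAt (hne k (Finset.mem_Icc.mp hk).2)

theorem continuousAt_addW (hs : Continuous s) (hh : Continuous h) (ha : Continuous a)
    (hb : Continuous b) (hx : Continuous x) {t₀ : X}
    (hne : addWDen s (h t₀) (a t₀) (b t₀) (x t₀) N y ≠ 0) :
    ContinuousAt (fun t => addWNum s (h t) (a t) (b t) (x t) N y
      / addWDen s (h t) (a t) (b t) (x t) N y) t₀ := by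
  have h1 := continuous_vdm hs (z := fun t i => x t i + y i * h t) (by fun_prop)
  have h2 := continuous_vdm hs hx
  refine ContinuousAt.div (Continuous.continuousAt ?_) (Continuous.continuousAt ?_) hne
  · unfold addWNum
    fun_prop
  · unfold addWDen
    fun_prop

theorem continuousAt_addGamma (hs : Continuous s) (hh : Continuous h) (ha : Continuous a)
    (hb : Continuous b) (hc : Continuous c) (hx : Continuous x) {t₀ : X}
    (hne : addGammaDen s (h t₀) (a t₀) (b t₀) (c t₀) (x t₀) N u ≠ 0) :
    ContinuousAt (fun t => addGammaNum s (h t) (a t) (b t) (c t) (x t) N u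
      / addGammaDen s (h t) (a t) (b t) (c t) (x t) N u) t₀ := by
  have h1 := continuous_vdm hs (z := fun t i => x t i + u i * h t) (by fun_prop)
  have h2 := continuous_vdm hs hx
  refine ContinuousAt.div (Continuous.continuousAt ?_) (Continuous.continuousAt ?_) hne
  · unfold addGammaNum
    fun_prop
  · unfold addGammaDen
    fun_prop

end Continuity

/-- Biorthogonality whenever no denominator vanishes. -/
theorem sum_weight {n : ℕ} {s : ℂ → ℂ} {h a b c : ℂ} {x : Fin n → ℂ} {N u v : Fin n → ℕ}
    (hs : IsOddSigma s) (hu : u ≤ N) (hv : v ≤ N) (hw : ∀ y ≤ N, addWDen s h a b x N y ≠ 0)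
    (hf : ∀ y ≤ N, ∀ k ≤ u ⊓ y, addDen s h (a - b) (addFB h a b c x N u y)
      (addFC h a b c x N u y) x k ≠ 0)
    (hg : ∀ y ≤ N, ∀ k ≤ N - v ⊔ y, addDen s h (addGA h a b N) (addGB h a b c x N v y)
      (addGC h a b c x N v y) (addGZ h x N) k ≠ 0)
    (hΓ : addGammaDen s h a b c x N u ≠ 0) :
    ∑ y ∈ Finset.Icc 0 N, addWNum s h a b x N y / addWDen s h a b x N y
        * addF s h a b c x N u y * addG s h a b c x N v y
      = if u = v then addGammaNum s h a b c x N u / addGammaDen s h a b c x N u else 0 := by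
  -- The parameters are moved along a line that passes through the given ones at t = 0.
  obtain ⟨l, hl⟩ := exists_complex_int_independent (Fin n ⊕ Fin 4)
  have hd := hs.dense_generic (Sum.elim x ![h, a, b, c] : Fin n ⊕ Fin 4 → ℂ) hl
  set h' : ℂ → ℂ := fun t => h + t * l (Sum.inr 0) with hh'
  set a' : ℂ → ℂ := fun t => a + t * l (Sum.inr 1) with ha'
  set b' : ℂ → ℂ := fun t => b + t * l (Sum.inr 2) with hb'
  set c' : ℂ → ℂ := fun t => c + t * l (Sum.inr 3) with hc'
  set x' : ℂ → Fin n → ℂ := fun t i => x i + t * l (Sum.inl i) with hx'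
  have h0 : h' 0 = h := by simp [hh']
  have a0 : a' 0 = a := by simp [ha']
  have b0 : b' 0 = b := by simp [hb']
  have c0 : c' 0 = c := by simp [hc']
  have x0 : x' 0 = x := by simp [hx']
  have ch : Continuous h' := by fun_prop
  have ca : Continuous a' := by fun_prop
  have cb : Continuous b' := by fun_prop
  have cc : Continuous c' := by fun_prop
  have cx : Continuous x' := by fun_prop
  set L : ℂ → ℂ := fun t => ∑ y ∈ Finset.Icc 0 N,
    addWNum s (h' t) (a' t) (b' t) (x' t) N y / addWDen s (h' t) (a' t) (b' t) (x' t) N y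
      * addF s (h' t) (a' t) (b' t) (c' t) (x' t) N u y
      * addG s (h' t) (a' t) (b' t) (c' t) (x' t) N v y with hL
  set R : ℂ → ℂ := fun t => if u = v then addGammaNum s (h' t) (a' t) (b' t) (c' t) (x' t) N u
    / addGammaDen s (h' t) (a' t) (b' t) (c' t) (x' t) N u else 0 with hR
  have hLR : Set.EqOn L R {t : ℂ | ∀ k : Fin n ⊕ Fin 4 → ℤ, k ≠ 0 →
      s (∑ i, k i * ((Sum.elim x ![h, a, b, c] : Fin n ⊕ Fin 4 → ℂ) i + t * l i)) ≠ 0} := by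
    intro t ht
    refine sum_weight_of_generic hs (GenericSystem.of_forall fun k hk => ?_) hu hv
    convert ht k hk using 4 with i
    rcases i with i | i
    · simp [hx']
    · fin_cases i <;> simp [hh', ha', hb', hc']
  have cL : ContinuousAt L 0 := by
    refine tendsto_finsetSum _ fun y hy => ?_
    have hyN := (Finset.mem_Icc.mp hy).2
    refine ContinuousAt.mul (ContinuousAt.mul ?_ ?_) ?_
    · exact continuousAt_addW hs.continuous ch ca cb cx (by rw [h0, a0, b0, x0]; exact hw y hyN)
    · exact continuousAt_addF hs.continuous ch ca cb cc cx
        (by rw [h0, a0, b0, c0, x0]; exact hf y hyN)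
    · exact continuousAt_addG hs.continuous ch ca cb cc cx
        (by rw [h0, a0, b0, c0, x0]; exact hg y hyN)
  have cR : ContinuousAt R 0 := by
    by_cases huv : u = v
    · simp only [hR, if_pos huv]
      exact continuousAt_addGamma hs.continuous ch ca cb cc cx (by rw [h0, a0, b0, c0, x0]; exact hΓ)
    · simp only [hR, if_neg huv]
      exact continuousAt_const
  -- Both sides are continuous at 0 because the stated denominators do not vanish there, and they
  -- agree on a set having 0 in its closure.
  have hne := mem_closure_iff_nhdsWithin_neBot.mp (hd 0)
  have hlim := tendsto_nhds_unique_of_eventuallyEq (cL.mono_left nhdsWithin_le_nhds)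
    (cR.mono_left nhdsWithin_le_nhds) (hLR.eventuallyEq_of_mem self_mem_nhdsWithin)
  simpa only [hL, hR, h0, a0, b0, c0, x0] using hlim

end EllipticHyp

/-! ### From multiplicative to additive notation: the series. -/

namespace EllipticHyp

/-- The exponent of the factor that relates `(e^ξ)_k` to its additive form. -/
noncomputable def pochExp (h ξ : ℂ) (k : ℕ) : ℂ := (k * ξ + h * (k * (k - 1)) / 2) / 2

theorem theta_eq_exp {p w ξ : ℂ} (hw : w = Complex.exp ξ) :
    theta p w = Complex.exp (ξ / 2) * oddTheta p ξ := by
  rw [hw, theta_exp]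

theorem poch_eq_exp {p h w ξ : ℂ} (hw : w = Complex.exp ξ) (k : ℕ) :
    poch p (Complex.exp h) w k = Complex.exp (pochExp h ξ k) * bp (oddTheta p) h ξ k := by
  induction k with
  | zero => simp [poch, pochExp]
  | succ k ih =>
    have : poch p (Complex.exp h) w (k + 1)
        = poch p (Complex.exp h) w k * theta p (Complex.exp h ^ k * w) :=
      Finset.prod_range_succ _ _
    rw [this, ih, theta_eq_exp (ξ := ξ + k * h) (by rw [hw, ← Complex.exp_nat_mul, ← Complex.exp_add,
      add_comm]), bp_succ, show pochExp h ξ (k + 1) = pochExp h ξ k + (ξ + k * h) / 2 by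
        unfold pochExp; push_cast; ring, Complex.exp_add]
    ring

theorem prod_exp_mul {ι : Type*} (S : Finset ι) (e f : ι → ℂ) :
    ∏ i ∈ S, (Complex.exp (e i) * f i) = Complex.exp (∑ i ∈ S, e i) * ∏ i ∈ S, f i := by
  rw [Finset.prod_mul_distrib, Complex.exp_sum]

/-- Each index belongs to n - 1 pairs. -/
theorem sum_sum_Ioi {n : ℕ} (z : Fin n → ℂ) :
    ∑ j, ∑ k ∈ Finset.Ioi j, (z j + z k) = (n - 1) * ∑ i, z i := by
  have h1 : ∑ j, ∑ k ∈ Finset.Ioi j, z k = ∑ k, ∑ _j ∈ Finset.Iio k, z k :=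
    Finset.sum_comm' (by simp)
  simp only [Finset.sum_add_distrib]
  rw [h1, ← Finset.sum_add_distrib, Finset.mul_sum]
  refine Finset.sum_congr rfl fun i _ => ?_
  have : i.1 + 1 ≤ n := i.2
  rw [Finset.sum_const, Finset.sum_const, Fin.card_Ioi, Fin.card_Iio, nsmul_eq_mul, nsmul_eq_mul,
    show n - 1 - i.1 = n - (i.1 + 1) by omega, Nat.cast_sub this]
  push_cast; ring

/-- The monomial z_j in Δ makes each factor symmetric up to s: it equals e^{(z_j + z_k)/2} s(z_k -
z_j) in logarithms. So the prefactor depends only on the sum of the z_i. -/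
theorem Delta_eq_exp {n : ℕ} {p : ℂ} {w z : Fin n → ℂ} (hw : ∀ i, w i = Complex.exp (z i)) :
    Delta p w = Complex.exp ((n - 1) / 2 * ∑ i, z i) * vdm (oddTheta p) z := by
  unfold Delta vdm
  have : ∀ j k, w j * theta p (w k / w j)
      = Complex.exp ((z j + z k) / 2) * oddTheta p (z k - z j) := fun j k => by
    rw [hw, hw, theta_eq_exp (ξ := z k - z j) (Complex.exp_sub _ _).symm, ← mul_assoc,
      ← Complex.exp_add]
    congr 2; ring
  simp only [this, prod_exp_mul]
  congr 2
  simp only [← Finset.sum_div]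
  rw [sum_sum_Ioi]; ring

theorem sum_pochExp {ι : Type*} [Fintype ι] (h ξ ε : ℂ) (r : ι → ℂ) (k : ℕ) :
    ∑ j, pochExp h (ξ + ε * r j) k
      = (k * (Fintype.card ι * ξ + ε * ∑ j, r j) + Fintype.card ι * (h * (k * (k - 1)) / 2)) / 2 := by
  unfold pochExp
  rw [← Finset.sum_div, Finset.sum_add_distrib, ← Finset.mul_sum, Finset.sum_add_distrib,
    ← Finset.mul_sum]
  simp

theorem sum_linear {n : ℕ} (k : Fin n → ℕ) (z : Fin n → ℂ) (α β γ : ℂ) :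
    ∑ i, (α * k i + β * (k i * z i) + γ * (k i : ℂ) ^ 2)
      = α * tot k + β * ∑ i, k i * z i + γ * ∑ i, (k i : ℂ) ^ 2 := by
  rw [Finset.sum_add_distrib, Finset.sum_add_distrib, ← Finset.mul_sum, ← Finset.mul_sum,
    ← Finset.mul_sum, tot, Nat.cast_sum]

section Series

variable {m n : ℕ} {p h A : ℂ} {B : Fin (m + 2) → ℂ} {C : Fin (m + n + 2) → ℂ} {z : Fin n → ℂ}
  {a : ℂ} {b : Fin (m + 2) → ℂ} {c : Fin (m + n + 2) → ℂ} {w : Fin n → ℂ}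

theorem vNum_eq_exp (ha : a = Complex.exp A) (hb : ∀ j, b j = Complex.exp (B j))
    (hc : ∀ j, c j = Complex.exp (C j)) (hw : ∀ i, w i = Complex.exp (z i)) (k : Fin n → ℕ) :
    vNum p (Complex.exp h) a b c w k
      = Complex.exp ((n - 1) / 2 * ∑ i, (z i + k i * h) + tot k * h
          + ∑ i, (A + z i + (k i + tot k) * h) / 2 + ∑ i, pochExp h (A + z i) (tot k)
          + ∑ j, pochExp h (B j) (tot k) + ∑ i, ∑ j, pochExp h (C j + z i) (k i))
        * addNum (oddTheta p) h A B C z k := by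
  unfold vNum addNum
  have t1 := Delta_eq_exp (p := p) (w := qshift (Complex.exp h) w k) (z := fun i => z i + k i * h)
    fun i => by rw [qshift, hw, ← Complex.exp_nat_mul, ← Complex.exp_add]
  have t2 : ∀ i, theta p (a * w i * Complex.exp h ^ (k i + tot k)) = _ := fun i =>
    theta_eq_exp (ξ := A + z i + (k i + tot k) * h) (by
      rw [ha, hw, ← Complex.exp_nat_mul, ← Complex.exp_add, ← Complex.exp_add]; push_cast; rfl)
  have t3 : ∀ i, poch p (Complex.exp h) (a * w i) (tot k) = _ := fun i =>
    poch_eq_exp (ξ := A + z i) (by rw [ha, hw, ← Complex.exp_add]) _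
  have t4 : ∀ j, poch p (Complex.exp h) (b j) (tot k) = _ := fun j => poch_eq_exp (hb j) _
  have t5 : ∀ i j, poch p (Complex.exp h) (c j * w i) (k i) = _ := fun i j =>
    poch_eq_exp (ξ := C j + z i) (by rw [hc, hw, ← Complex.exp_add]) _
  rw [t1, ← Complex.exp_nat_mul]
  simp only [t2, t3, t4, t5, prod_exp_mul, Complex.exp_add]
  ring

theorem vDen_eq_exp (ha : a = Complex.exp A) (hb : ∀ j, b j = Complex.exp (B j))
    (hc : ∀ j, c j = Complex.exp (C j)) (hw : ∀ i, w i = Complex.exp (z i)) (k : Fin n → ℕ) :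
    vDen p (Complex.exp h) a b c w k
      = Complex.exp ((n - 1) / 2 * ∑ i, z i + ∑ i, (A + z i) / 2
          + ∑ j, pochExp h (A + h - C j) (tot k) + ∑ i, (∑ j, pochExp h (h + z i - z j) (k i)
          + ∑ j, pochExp h (A + h + z i - B j) (k i)))
        * addDen (oddTheta p) h A B C z k := by
  unfold vDen addDen
  have t1 := Delta_eq_exp (p := p) hw
  have t2 : ∀ i, theta p (a * w i) = _ := fun i =>
    theta_eq_exp (ξ := A + z i) (by rw [ha, hw, ← Complex.exp_add])
  have t3 : ∀ j, poch p (Complex.exp h) (a * Complex.exp h / c j) (tot k) = _ := fun j =>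
    poch_eq_exp (ξ := A + h - C j) (by rw [ha, hc, ← Complex.exp_add, ← Complex.exp_sub]) _
  have t4 : ∀ i j, poch p (Complex.exp h) (Complex.exp h * w i / w j) (k i) = _ := fun i j =>
    poch_eq_exp (ξ := h + z i - z j) (by rw [hw, hw, ← Complex.exp_add, ← Complex.exp_sub]) _
  have t5 : ∀ i j, poch p (Complex.exp h) (a * Complex.exp h * w i / b j) (k i) = _ := fun i j =>
    poch_eq_exp (ξ := A + h + z i - B j)
      (by rw [ha, hw, hb, ← Complex.exp_add, ← Complex.exp_add, ← Complex.exp_sub]) _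
  have t6 : ∀ α β u v : ℂ, Complex.exp α * u * (Complex.exp β * v)
      = Complex.exp (α + β) * (u * v) := fun α β u v => by rw [Complex.exp_add]; ring
  rw [t1]
  simp only [t2, t3, t4, t5, t6, prod_exp_mul]

theorem vDen_ne_zero_iff (ha : a = Complex.exp A) (hb : ∀ j, b j = Complex.exp (B j))
    (hc : ∀ j, c j = Complex.exp (C j)) (hw : ∀ i, w i = Complex.exp (z i)) (k : Fin n → ℕ) :
    vDen p (Complex.exp h) a b c w k ≠ 0 ↔ addDen (oddTheta p) h A B C z k ≠ 0 := by
  rw [vDen_eq_exp ha hb hc hw, mul_ne_zero_iff, and_iff_right (Complex.exp_ne_zero _)]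

/-- Balanced summands agree with their additive form. -/
theorem v_term_eq (ha : a = Complex.exp A) (hb : ∀ j, b j = Complex.exp (B j))
    (hc : ∀ j, c j = Complex.exp (C j)) (hw : ∀ i, w i = Complex.exp (z i))
    (hbal : ∑ i, z i + ∑ j, B j + ∑ j, C j = (m + 2) * A + (m + 1) * h) (k : Fin n → ℕ) :
    vNum p (Complex.exp h) a b c w k / vDen p (Complex.exp h) a b c w k
      = addNum (oddTheta p) h A B C z k / addDen (oddTheta p) h A B C z k := by
  rw [vNum_eq_exp ha hb hc hw, vDen_eq_exp ha hb hc hw, mul_div_mul_comm, ← Complex.exp_sub]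
  have e : ∀ {α β : ℂ}, α = 0 → Complex.exp α * β = β := fun hα => by
    rw [hα, Complex.exp_zero, one_mul]
  refine e ?_
  have s1 : ∑ i, (z i + k i * h) = ∑ i, z i + tot k * h := by
    rw [Finset.sum_add_distrib, ← Finset.sum_mul, tot, Nat.cast_sum]
  have s2 : ∑ i, (A + z i + (k i + tot k) * h) / 2
      = (n * A + ∑ i, z i + tot k * h + n * tot k * h) / 2 := by
    rw [← Finset.sum_div, Finset.sum_add_distrib, Finset.sum_add_distrib, ← Finset.sum_mul,
      Finset.sum_add_distrib, ← Nat.cast_sum, ← tot]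
    simp; ring
  have s3 := sum_pochExp h A 1 z (tot k)
  have s4 := sum_pochExp h 0 1 B (tot k)
  have s5 : ∑ i, ∑ j, pochExp h (C j + z i) (k i) = (tot k * ∑ j, C j + (m + n + 2) * ∑ i, k i * z i
      + (m + n + 2) * h * (∑ i, (k i : ℂ) ^ 2 - tot k) / 2) / 2 := by
    rw [Finset.sum_congr rfl fun i _ => (Finset.sum_congr rfl fun j _ => by
        rw [show C j + z i = z i + 1 * C j by ring]).trans (sum_pochExp h (z i) 1 C (k i)),
      Fintype.card_fin]
    have := sum_linear k z ((∑ j, C j) / 2 - (m + n + 2) * h / 4) ((m + n + 2) / 2)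
      ((m + n + 2) * h / 4)
    refine Eq.trans (Finset.sum_congr rfl fun i _ => ?_) (this.trans ?_)
    · push_cast; ring
    · ring
  have d1 : ∑ i, (A + z i) / 2 = (n * A + ∑ i, z i) / 2 := by
    rw [← Finset.sum_div, Finset.sum_add_distrib]; simp
  have d2 := sum_pochExp h (A + h) (-1) C (tot k)
  have d3 : ∑ i, (∑ j, pochExp h (h + z i - z j) (k i) + ∑ j, pochExp h (A + h + z i - B j) (k i))
      = (n * (tot k * h + ∑ i, k i * z i) - tot k * ∑ i, z i
          + n * h * (∑ i, (k i : ℂ) ^ 2 - tot k) / 2) / 2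
        + ((m + 2) * (tot k * (A + h) + ∑ i, k i * z i) - tot k * ∑ j, B j
          + (m + 2) * h * (∑ i, (k i : ℂ) ^ 2 - tot k) / 2) / 2 := by
    rw [Finset.sum_congr rfl fun i _ => congrArg₂ (· + ·)
      ((Finset.sum_congr rfl fun j _ => by
        rw [show h + z i - z j = h + z i + -1 * z j by ring]).trans
          (sum_pochExp h (h + z i) (-1) z (k i)))
      ((Finset.sum_congr rfl fun j _ => by
        rw [show A + h + z i - B j = A + h + z i + -1 * B j by ring]).trans
          (sum_pochExp h (A + h + z i) (-1) B (k i))),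
      Fintype.card_fin, Fintype.card_fin]
    have := sum_linear k z ((n * h - ∑ i, z i + (m + 2) * (A + h) - ∑ j, B j) / 2
      - (n + m + 2) * h / 4) ((n + m + 2) / 2) ((n + m + 2) * h / 4)
    refine Eq.trans (Finset.sum_congr rfl fun i _ => ?_) (this.trans ?_)
    · push_cast; ring
    · ring
  simp only [one_mul, zero_add, neg_mul, ← sub_eq_add_neg, Fintype.card_fin] at s3 s4 d2
  rw [s1, s2, s3, s4, s5, d1, d2, d3]
  push_cast
  -- All terms in k i z i and k i ² cancel identically; the remainder is |k| times the balancing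
  -- condition.
  linear_combination (tot k : ℂ) * hbal

end Series

end EllipticHyp

/-! ### From multiplicative to additive notation: weight and norm. -/

namespace EllipticHyp

theorem pochExp_sub (h ξ η : ℂ) (k : ℕ) : pochExp h ξ k - pochExp h η k = k * (ξ - η) / 2 := by
  unfold pochExp; ring

section Conversion

variable {n : ℕ} {p h A B C : ℂ} {X : Fin n → ℂ} {a b c : ℂ} {x : Fin n → ℂ} {N u y : Fin n → ℕ}

theorem sum_cast_eq_tot (y : Fin n → ℕ) : ∑ i, (y i : ℂ) = tot y := by rw [tot, Nat.cast_sum]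

theorem sum_sum_pochExp_sub (h : ℂ) (X : Fin n → ℂ) (N y : Fin n → ℕ) :
    ∑ i, ∑ j, pochExp h (-(N j * h) + X i - X j) (y i) - ∑ i, ∑ j, pochExp h (h + X i - X j) (y i)
      = -((tot N + n) * tot y * h / 2) := by
  simp only [← Finset.sum_sub_distrib, pochExp_sub]
  have : ∀ i j, (y i : ℂ) * (-(N j * h) + X i - X j - (h + X i - X j)) / 2
      = -(h / 2) * (y i * (N j + 1)) := fun i j => by ring
  simp only [this, ← Finset.mul_sum, Finset.sum_add_distrib, sum_cast_eq_tot]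
  rw [← Finset.sum_mul, sum_cast_eq_tot]
  simp; ring

theorem wNum_eq_exp (ha : a = Complex.exp A) (hb : b = Complex.exp B)
    (hx : ∀ i, x i = Complex.exp (X i)) :
    wNum p (Complex.exp h) a b x N y
      = Complex.exp ((n - 1) / 2 * ∑ i, (X i + y i * h) + tot y * h + (A + 2 * tot y * h) / 2
          + pochExp h A (tot y) + ∑ i, ∑ j, pochExp h (-(N j * h) + X i - X j) (y i)
          + ∑ i, ((B + (tot y - y i) * h - X i) / 2 + pochExp h (B - X i) (tot y)
            + pochExp h (tot N * h + A + X i - B) (y i)))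
        * addWNum (oddTheta p) h A B X N y := by
  unfold wNum addWNum
  have t1 := Delta_eq_exp (p := p) (w := qshift (Complex.exp h) x y) (z := fun i => X i + y i * h)
    fun i => by rw [qshift, hx, ← Complex.exp_nat_mul, ← Complex.exp_add]
  have t2 := theta_eq_exp (p := p) (w := a * Complex.exp h ^ (2 * tot y)) (ξ := A + 2 * tot y * h) (by
    rw [ha, ← Complex.exp_nat_mul, ← Complex.exp_add]; push_cast; rfl)
  have t3 := poch_eq_exp (p := p) (h := h) ha (tot y)
  have t4 : ∀ i j, poch p (Complex.exp h) (Complex.exp h ^ (-(N j : ℤ)) * x i / x j) (y i) = _ :=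
    fun i j => poch_eq_exp (ξ := -(N j * h) + X i - X j) (by
      rw [hx, hx, ← Complex.exp_int_mul, ← Complex.exp_add, ← Complex.exp_sub]
      push_cast; congr 1; ring) _
  have t5 : ∀ i, theta p (b * Complex.exp h ^ ((tot y : ℤ) - (y i : ℤ)) / x i) = _ := fun i =>
    theta_eq_exp (ξ := B + (tot y - y i) * h - X i) (by
      rw [hb, hx, ← Complex.exp_int_mul, ← Complex.exp_add, ← Complex.exp_sub]; push_cast; rfl)
  have t6 : ∀ i, poch p (Complex.exp h) (b / x i) (tot y) = _ := fun i =>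
    poch_eq_exp (ξ := B - X i) (by rw [hb, hx, ← Complex.exp_sub]) _
  have t7 : ∀ i, poch p (Complex.exp h) (Complex.exp h ^ tot N * a * x i / b) (y i) = _ := fun i =>
    poch_eq_exp (ξ := tot N * h + A + X i - B) (by
      rw [ha, hb, hx, ← Complex.exp_nat_mul, ← Complex.exp_add, ← Complex.exp_add,
        ← Complex.exp_sub]) _
  have t8 : ∀ α β u v : ℂ, Complex.exp α * u * (Complex.exp β * v)
      = Complex.exp (α + β) * (u * v) := fun α β u v => by rw [Complex.exp_add]; ring
  rw [t1, t2, t3, ← Complex.exp_nat_mul]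
  simp only [t4, t5, t6, t7, t8, prod_exp_mul]
  simp only [Complex.exp_add]
  ring

theorem wDen_eq_exp (ha : a = Complex.exp A) (hb : b = Complex.exp B)
    (hx : ∀ i, x i = Complex.exp (X i)) :
    wDen p (Complex.exp h) a b x N y
      = Complex.exp ((n - 1) / 2 * ∑ i, X i + A / 2
          + pochExp h (A + (1 + tot N) * h) (tot y) + ∑ i, ∑ j, pochExp h (h + X i - X j) (y i)
          + ∑ i, ((B - X i) / 2 + pochExp h (B + (1 - N i) * h - X i) (tot y)
            + pochExp h (A + h + X i - B) (y i)))
        * addWDen (oddTheta p) h A B X N y := by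
  unfold wDen addWDen
  have t1 := Delta_eq_exp (p := p) hx
  have t2 := theta_eq_exp (p := p) ha
  have t3 := poch_eq_exp (p := p) (h := h) (w := a * Complex.exp h ^ (1 + tot N))
    (ξ := A + (1 + tot N) * h) (by
      rw [ha, ← Complex.exp_nat_mul, ← Complex.exp_add]; push_cast; rfl) (tot y)
  have t4 : ∀ i j, poch p (Complex.exp h) (Complex.exp h * x i / x j) (y i) = _ :=
    fun i j => poch_eq_exp (ξ := h + X i - X j) (by
      rw [hx, hx, ← Complex.exp_add, ← Complex.exp_sub]) _
  have t5 : ∀ i, theta p (b / x i) = _ := fun i =>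
    theta_eq_exp (ξ := B - X i) (by rw [hb, hx, ← Complex.exp_sub])
  have t6 : ∀ i, poch p (Complex.exp h) (b * Complex.exp h ^ (1 - (N i : ℤ)) / x i) (tot y) = _ :=
    fun i => poch_eq_exp (ξ := B + (1 - N i) * h - X i) (by
      rw [hb, hx, ← Complex.exp_int_mul, ← Complex.exp_add, ← Complex.exp_sub]; push_cast; rfl) _
  have t7 : ∀ i, poch p (Complex.exp h) (a * Complex.exp h * x i / b) (y i) = _ := fun i =>
    poch_eq_exp (ξ := A + h + X i - B) (by
      rw [ha, hb, hx, ← Complex.exp_add, ← Complex.exp_add, ← Complex.exp_sub]) _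
  have t8 : ∀ α β u v : ℂ, Complex.exp α * u * (Complex.exp β * v)
      = Complex.exp (α + β) * (u * v) := fun α β u v => by rw [Complex.exp_add]; ring
  rw [t1, t2, t3]
  simp only [t4, t5, t6, t7, t8, prod_exp_mul]

theorem exp_mul_div_exp_mul {α β : ℂ} (h : α = β) (u v : ℂ) :
    Complex.exp α * u / (Complex.exp β * v) = u / v := by
  rw [h, mul_div_mul_left _ _ (Complex.exp_ne_zero _)]

/-- The prefactor q^{|y|} is what makes the exponents of numerator and denominator equal. -/
theorem w_eq_add (ha : a = Complex.exp A) (hb : b = Complex.exp B)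
    (hx : ∀ i, x i = Complex.exp (X i)) :
    w p (Complex.exp h) a b x N y
      = addWNum (oddTheta p) h A B X N y / addWDen (oddTheta p) h A B X N y := by
  rw [w, wNum_eq_exp ha hb hx, wDen_eq_exp ha hb hx]
  refine exp_mul_div_exp_mul ?_ _ _
  have e1 := sum_sum_pochExp_sub h X N y
  have e2 := pochExp_sub h A (A + (1 + tot N) * h) (tot y)
  have e3 : ∑ i, ((B + (tot y - y i) * h - X i) / 2 + pochExp h (B - X i) (tot y)
        + pochExp h (tot N * h + A + X i - B) (y i))
      - ∑ i, ((B - X i) / 2 + pochExp h (B + (1 - N i) * h - X i) (tot y)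
        + pochExp h (A + h + X i - B) (y i))
      = h / 2 * ((tot N - 2) * tot y + tot y * tot N) := by
    rw [← Finset.sum_sub_distrib]
    refine Eq.trans (Finset.sum_congr rfl fun i _ => show _ = h / 2 * ((tot N - 2) * y i
      + tot y * N i) from ?_) ?_
    · linear_combination pochExp_sub h (B - X i) (B + (1 - N i) * h - X i) (tot y)
        + pochExp_sub h (tot N * h + A + X i - B) (A + h + X i - B) (y i)
    · rw [← Finset.mul_sum, Finset.sum_add_distrib, ← Finset.mul_sum, ← Finset.mul_sum,
        sum_cast_eq_tot, sum_cast_eq_tot]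
  have e4 : ∑ i, (X i + y i * h) = ∑ i, X i + tot y * h := by
    rw [Finset.sum_add_distrib, ← Finset.sum_mul, sum_cast_eq_tot]
  rw [e4]
  linear_combination e1 + e2 + e3

theorem wDen_ne_zero_iff (ha : a = Complex.exp A) (hb : b = Complex.exp B)
    (hx : ∀ i, x i = Complex.exp (X i)) :
    wDen p (Complex.exp h) a b x N y ≠ 0 ↔ addWDen (oddTheta p) h A B X N y ≠ 0 := by
  rw [wDen_eq_exp ha hb hx, mul_ne_zero_iff, and_iff_right (Complex.exp_ne_zero _)]

theorem GammaNum_eq_exp (ha : a = Complex.exp A) (hb : b = Complex.exp B) (hc : c = Complex.exp C)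
    (hx : ∀ i, x i = Complex.exp (X i)) :
    GammaNum p (Complex.exp h) a b c x N u
      = Complex.exp (tot N * C + (tot N ^ 2 - tot u) * h + (n - 1) / 2 * ∑ i, X i
          + ∑ i, ∑ j, pochExp h (h + X i - X j) (u i)
          + (pochExp h (A + h) (tot N) + pochExp h ((-tot u - tot N) * h - C) (tot N - tot u)
            + pochExp h ((1 - 2 * tot u) * h - C) (tot u))
          + ∑ i, ((-(tot u * h) + A + X i - (B + C)) / 2
            + (pochExp h (X i) (N i) + pochExp h (A + (1 - tot N) * h + X i - (2 * B + C)) (N i))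
            + pochExp h ((u i + tot N) * h + A + X i - B) (N i - u i)))
        * addGammaNum (oddTheta p) h A B C X N u := by
  unfold GammaNum addGammaNum
  have t1 := Delta_eq_exp (p := p) hx
  have t2 : ∀ i j, poch p (Complex.exp h) (Complex.exp h * x i / x j) (u i) = _ :=
    fun i j => poch_eq_exp (ξ := h + X i - X j) (by
      rw [hx, hx, ← Complex.exp_add, ← Complex.exp_sub]) _
  have t3 := poch_eq_exp (p := p) (h := h) (w := a * Complex.exp h) (ξ := A + h)
    (by rw [ha, ← Complex.exp_add]) (tot N)
  have t4 := poch_eq_exp (p := p) (h := h) (w := Complex.exp h ^ (-(tot u : ℤ) - (tot N : ℤ)) / c)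
    (ξ := (-tot u - tot N) * h - C)
    (by rw [hc, ← Complex.exp_int_mul, ← Complex.exp_sub]; push_cast; rfl) (tot N - tot u)
  have t5 := poch_eq_exp (p := p) (h := h) (w := Complex.exp h ^ (1 - 2 * (tot u : ℤ)) / c)
    (ξ := (1 - 2 * tot u) * h - C)
    (by rw [hc, ← Complex.exp_int_mul, ← Complex.exp_sub]; push_cast; rfl) (tot u)
  have t6 : ∀ i, theta p (Complex.exp h ^ (-(tot u : ℤ)) * a * x i / (b * c)) = _ := fun i =>
    theta_eq_exp (ξ := -(tot u * h) + A + X i - (B + C)) (by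
      rw [ha, hb, hc, hx, ← Complex.exp_int_mul, ← Complex.exp_add, ← Complex.exp_add,
        ← Complex.exp_add, ← Complex.exp_sub]
      push_cast; congr 1; ring)
  have t7 : ∀ i, poch p (Complex.exp h) (x i) (N i) = _ := fun i => poch_eq_exp (hx i) _
  have t8 : ∀ i, poch p (Complex.exp h) (a * Complex.exp h ^ (1 - (tot N : ℤ)) * x i / (b ^ 2 * c))
      (N i) = _ := fun i =>
    poch_eq_exp (ξ := A + (1 - tot N) * h + X i - (2 * B + C)) (by
      rw [ha, hb, hc, hx, ← Complex.exp_int_mul, ← Complex.exp_nat_mul, ← Complex.exp_add,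
        ← Complex.exp_add, ← Complex.exp_add, ← Complex.exp_sub]
      push_cast; rfl) _
  have t9 : ∀ i, poch p (Complex.exp h) (Complex.exp h ^ (u i + tot N) * a * x i / b) (N i - u i)
      = _ := fun i =>
    poch_eq_exp (ξ := (u i + tot N) * h + A + X i - B) (by
      rw [ha, hb, hx, ← Complex.exp_nat_mul, ← Complex.exp_add, ← Complex.exp_add,
        ← Complex.exp_sub]
      push_cast; rfl) _
  have t10 : ∀ α β u v : ℂ, Complex.exp α * u * (Complex.exp β * v)
      = Complex.exp (α + β) * (u * v) := fun α β u v => by rw [Complex.exp_add]; ring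
  have t11 : c ^ tot N = Complex.exp (tot N * C) := by rw [hc, ← Complex.exp_nat_mul]
  have t12 : Complex.exp h ^ ((tot N : ℤ) ^ 2 - (tot u : ℤ))
      = Complex.exp ((tot N ^ 2 - tot u) * h) := by
    rw [← Complex.exp_int_mul]; push_cast; rfl
  rw [t1, t3, t4, t5, t11, t12]
  simp only [t2, t6, t7, t8, t9, t10, prod_exp_mul]
  simp only [Complex.exp_add]
  ring

theorem GammaDen_eq_exp (ha : a = Complex.exp A) (hb : b = Complex.exp B) (hc : c = Complex.exp C)
    (hx : ∀ i, x i = Complex.exp (X i)) :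
    GammaDen p (Complex.exp h) a b c x N u
      = Complex.exp ((n - 1) / 2 * ∑ i, (X i + u i * h)
          + ∑ i, ∑ j, pochExp h (-(N j * h) + X i - X j) (u i)
          + (pochExp h (A + h - B) (tot N) + pochExp h (B + C + tot N * h) (tot N))
          + ∑ i, (((-tot u + u i) * h + A + X i - (B + C)) / 2
            + (pochExp h (X i - B) (N i) + pochExp h (-(tot u * h) + A + X i - (B + C)) (N i))
            + pochExp h ((1 + u i) * h + A + X i - B) (N i - u i)))
        * addGammaDen (oddTheta p) h A B C X N u := by
  unfold GammaDen addGammaDen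
  have t1 := Delta_eq_exp (p := p) (w := qshift (Complex.exp h) x u) (z := fun i => X i + u i * h)
    fun i => by rw [qshift, hx, ← Complex.exp_nat_mul, ← Complex.exp_add]
  have t2 : ∀ i j, poch p (Complex.exp h) (Complex.exp h ^ (-(N j : ℤ)) * x i / x j) (u i) = _ :=
    fun i j => poch_eq_exp (ξ := -(N j * h) + X i - X j) (by
      rw [hx, hx, ← Complex.exp_int_mul, ← Complex.exp_add, ← Complex.exp_sub]
      push_cast; congr 1; ring) _
  have t3 := poch_eq_exp (p := p) (h := h) (w := a * Complex.exp h / b) (ξ := A + h - B)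
    (by rw [ha, hb, ← Complex.exp_add, ← Complex.exp_sub]) (tot N)
  have t4 := poch_eq_exp (p := p) (h := h) (w := b * c * Complex.exp h ^ tot N)
    (ξ := B + C + tot N * h)
    (by rw [hb, hc, ← Complex.exp_nat_mul, ← Complex.exp_add, ← Complex.exp_add]) (tot N)
  have t6 : ∀ i, theta p (Complex.exp h ^ (-(tot u : ℤ) + (u i : ℤ)) * a * x i / (b * c)) = _ :=
    fun i => theta_eq_exp (ξ := (-tot u + u i) * h + A + X i - (B + C)) (by
      rw [ha, hb, hc, hx, ← Complex.exp_int_mul, ← Complex.exp_add, ← Complex.exp_add,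
        ← Complex.exp_add, ← Complex.exp_sub]
      push_cast; rfl)
  have t7 : ∀ i, poch p (Complex.exp h) (x i / b) (N i) = _ := fun i =>
    poch_eq_exp (ξ := X i - B) (by rw [hx, hb, ← Complex.exp_sub]) _
  have t8 : ∀ i, poch p (Complex.exp h) (Complex.exp h ^ (-(tot u : ℤ)) * a * x i / (b * c))
      (N i) = _ := fun i =>
    poch_eq_exp (ξ := -(tot u * h) + A + X i - (B + C)) (by
      rw [ha, hb, hc, hx, ← Complex.exp_int_mul, ← Complex.exp_add, ← Complex.exp_add,
        ← Complex.exp_add, ← Complex.exp_sub]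
      push_cast; congr 1; ring) _
  have t9 : ∀ i, poch p (Complex.exp h) (Complex.exp h ^ (1 + u i) * a * x i / b) (N i - u i)
      = _ := fun i =>
    poch_eq_exp (ξ := (1 + u i) * h + A + X i - B) (by
      rw [ha, hb, hx, ← Complex.exp_nat_mul, ← Complex.exp_add, ← Complex.exp_add,
        ← Complex.exp_sub]
      push_cast; rfl) _
  have t10 : ∀ α β u v : ℂ, Complex.exp α * u * (Complex.exp β * v)
      = Complex.exp (α + β) * (u * v) := fun α β u v => by rw [Complex.exp_add]; ring
  rw [t1, t3, t4]
  simp only [t2, t6, t7, t8, t9, t10, prod_exp_mul]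

theorem GammaDen_ne_zero_iff (ha : a = Complex.exp A) (hb : b = Complex.exp B)
    (hc : c = Complex.exp C) (hx : ∀ i, x i = Complex.exp (X i)) :
    GammaDen p (Complex.exp h) a b c x N u ≠ 0 ↔ addGammaDen (oddTheta p) h A B C X N u ≠ 0 := by
  rw [GammaDen_eq_exp ha hb hc hx, mul_ne_zero_iff, and_iff_right (Complex.exp_ne_zero _)]

/-- The prefactor c^{|N|} q^{|N|² - |u|} compensates the exponents left by the theta factors; the
lengths N - u must be true differences, hence u ≤ N. -/
theorem Gamma_eq_add (hu : u ≤ N) (ha : a = Complex.exp A) (hb : b = Complex.exp B)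
    (hc : c = Complex.exp C) (hx : ∀ i, x i = Complex.exp (X i)) :
    Gamma p (Complex.exp h) a b c x N u
      = addGammaNum (oddTheta p) h A B C X N u / addGammaDen (oddTheta p) h A B C X N u := by
  rw [Gamma, GammaNum_eq_exp ha hb hc hx, GammaDen_eq_exp ha hb hc hx]
  refine exp_mul_div_exp_mul ?_ _ _
  have e1 := sum_sum_pochExp_sub h X N u
  have e2 := pochExp_sub h (A + h) (A + h - B) (tot N)
  have e3 : ∑ i, ((-(tot u * h) + A + X i - (B + C)) / 2
            + (pochExp h (X i) (N i) + pochExp h (A + (1 - tot N) * h + X i - (2 * B + C)) (N i))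
            + pochExp h ((u i + tot N) * h + A + X i - B) (N i - u i))
      - ∑ i, (((-tot u + u i) * h + A + X i - (B + C)) / 2
            + (pochExp h (X i - B) (N i) + pochExp h (-(tot u * h) + A + X i - (B + C)) (N i))
            + pochExp h ((1 + u i) * h + A + X i - B) (N i - u i))
      = h / 2 * (tot u * tot N - tot N * tot u) := by
    rw [← Finset.sum_sub_distrib]
    refine Eq.trans (Finset.sum_congr rfl fun i _ => show _ = h / 2 * (tot u * N i
      - tot N * u i) from ?_) ?_
    · have h1 := pochExp_sub h (X i) (X i - B) (N i)
      have h2 := pochExp_sub h (A + (1 - tot N) * h + X i - (2 * B + C))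
        (-(tot u * h) + A + X i - (B + C)) (N i)
      have h3 := pochExp_sub h ((u i + tot N) * h + A + X i - B) ((1 + u i) * h + A + X i - B)
        (N i - u i)
      rw [Nat.cast_sub (hu i)] at h3
      linear_combination h1 + h2 + h3
    · rw [← Finset.mul_sum, Finset.sum_sub_distrib, ← Finset.mul_sum, ← Finset.mul_sum,
        sum_cast_eq_tot, sum_cast_eq_tot]
  have e4 : ∑ i, (X i + u i * h) = ∑ i, X i + tot u * h := by
    rw [Finset.sum_add_distrib, ← Finset.sum_mul, sum_cast_eq_tot]
  have e5 : pochExp h ((-tot u - tot N) * h - C) (tot N - tot u)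
      + pochExp h ((1 - 2 * tot u) * h - C) (tot u) - pochExp h (B + C + tot N * h) (tot N)
      = (-2 * tot N ^ 2 + tot u - tot N * tot u) * h / 2 - tot N * C - tot N * B / 2 := by
    unfold pochExp
    rw [Nat.cast_sub (tot_mono hu)]
    ring
  rw [e4]
  linear_combination e2 + e3 + e5 - e1

end Conversion

end EllipticHyp

/-! ### Balancing and termination of the two series. -/

namespace EllipticHyp

theorem addNum_eq_zero {m n : ℕ} {s : ℂ → ℂ} (hs : IsOddSigma s) {h A : ℂ} {B : Fin (m + 2) → ℂ}
    {C : Fin (m + n + 2) → ℂ} {z : Fin n → ℂ} {k : Fin n → ℕ} (i : Fin n) (j : Fin (m + n + 2))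
    {r : ℕ} (hr : r < k i) (hC : C j + z i + r * h = 0) : addNum s h A B C z k = 0 := by
  have : ∏ i, ∏ j, bp s h (C j + z i) (k i) = 0 :=
    Finset.prod_eq_zero (Finset.mem_univ i) (Finset.prod_eq_zero (Finset.mem_univ j)
      (bp_eq_zero s h hr (by rw [hC, hs.zero])))
  rw [addNum, this, mul_zero]

section Conversion

variable {n : ℕ} {p h A B C : ℂ} {X : Fin n → ℂ} {a b c : ℂ} {x : Fin n → ℂ} {N u y : Fin n → ℕ}

theorem fB_eq_exp (ha : a = Complex.exp A) (hb : b = Complex.exp B) (hc : c = Complex.exp C)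
    (hx : ∀ i, x i = Complex.exp (X i)) (j : Fin (n + 2)) :
    fB (Complex.exp h) a b c x N u y j = Complex.exp (addFB h A B C X N u y j) := by
  unfold fB addFB
  refine Fin.cases ?_ (fun j => Fin.cases ?_ (fun j => ?_) j) j
  · simp only [Matrix.cons_val_zero]
    rw [ha, ← Complex.exp_nat_mul, ← Complex.exp_add]
  · simp only [Matrix.cons_val_succ, Matrix.cons_val_zero]
    rw [hc, ← Complex.exp_nat_mul, ← Complex.exp_add]
  · simp only [Matrix.cons_val_succ]
    rw [ha, hb, hx, ← Complex.exp_nat_mul, ← Complex.exp_add, ← Complex.exp_add, ← Complex.exp_sub]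
    push_cast; rfl

theorem fC_eq_exp (ha : a = Complex.exp A) (hb : b = Complex.exp B) (hc : c = Complex.exp C)
    (hx : ∀ i, x i = Complex.exp (X i)) (j : Fin (n + n + 2)) :
    fC (Complex.exp h) a b c x N u y j = Complex.exp (addFC h A B C X N u y j) := by
  unfold fC addFC
  refine Fin.cases ?_ (fun j => Fin.cases ?_ (fun j => Fin.addCases (fun j => ?_) (fun j => ?_) j) j) j
  · simp only [Matrix.cons_val_zero, Complex.exp_zero]
  · simp only [Matrix.cons_val_succ, Matrix.cons_val_zero]
    rw [ha, hb, hc, ← Complex.exp_int_mul, ← Complex.exp_nat_mul, ← Complex.exp_add,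
      ← Complex.exp_add, ← Complex.exp_sub]
    push_cast; rfl
  · simp only [Matrix.cons_val_succ, Fin.append_left]
    rw [hx, ← Complex.exp_int_mul, ← Complex.exp_sub]
    push_cast; congr 1; ring
  · simp only [Matrix.cons_val_succ, Fin.append_right]
    rw [hx, ← Complex.exp_int_mul, ← Complex.exp_sub]
    push_cast; congr 1; ring

theorem gA_eq_exp (ha : a = Complex.exp A) (hb : b = Complex.exp B) :
    gA (Complex.exp h) a b N = Complex.exp (addGA h A B N) := by
  unfold gA addGA
  rw [ha, hb, ← Complex.exp_int_mul, ← Complex.exp_add, ← Complex.exp_sub]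
  push_cast; congr 1; ring

theorem gB_eq_exp (ha : a = Complex.exp A) (hb : b = Complex.exp B) (hc : c = Complex.exp C)
    (hx : ∀ i, x i = Complex.exp (X i)) (j : Fin (n + 2)) :
    gB (Complex.exp h) a b c x N u y j = Complex.exp (addGB h A B C X N u y j) := by
  unfold gB addGB
  refine Fin.cases ?_ (fun j => Fin.cases ?_ (fun j => ?_) j) j
  · simp only [Matrix.cons_val_zero]
    rw [ha, ← Complex.exp_int_mul, ← Complex.exp_sub]
    push_cast; rfl
  · simp only [Matrix.cons_val_succ, Matrix.cons_val_zero]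
    rw [hc, ← Complex.exp_int_mul, ← Complex.exp_sub]
    push_cast; rfl
  · simp only [Matrix.cons_val_succ]
    rw [ha, hb, hx, ← Complex.exp_int_mul, ← Complex.exp_add, ← Complex.exp_add, ← Complex.exp_sub]
    push_cast; rfl

theorem gC_eq_exp (ha : a = Complex.exp A) (hb : b = Complex.exp B) (hc : c = Complex.exp C)
    (hx : ∀ i, x i = Complex.exp (X i)) (j : Fin (n + n + 2)) :
    gC (Complex.exp h) a b c x N u y j = Complex.exp (addGC h A B C X N u y j) := by
  unfold gC addGC
  refine Fin.cases ?_ (fun j => Fin.cases ?_ (fun j => Fin.addCases (fun j => ?_) (fun j => ?_) j) j) j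
  · simp only [Matrix.cons_val_zero]
  · simp only [Matrix.cons_val_succ, Matrix.cons_val_zero]
    rw [ha, hb, hc, ← Complex.exp_nat_mul, ← Complex.exp_nat_mul, ← Complex.exp_add,
      ← Complex.exp_add, ← Complex.exp_sub]
    push_cast; rfl
  · simp only [Matrix.cons_val_succ, Fin.append_left]
    rw [hx, ← Complex.exp_nat_mul, ← Complex.exp_add]
  · simp only [Matrix.cons_val_succ, Fin.append_right]
    rw [hx, ← Complex.exp_nat_mul, ← Complex.exp_add]

theorem gZ_eq_exp (hx : ∀ i, x i = Complex.exp (X i)) (i : Fin n) :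
    gZ (Complex.exp h) x N i = Complex.exp (addGZ h X N i) := by
  unfold gZ addGZ
  rw [hx, ← Complex.exp_int_mul, ← Complex.exp_sub]
  push_cast; congr 1; ring

theorem sum_fin_add_two {m : ℕ} (f g : ℂ) (r : Fin m → ℂ) :
    ∑ j, Matrix.vecCons f (Matrix.vecCons g r) j = f + (g + ∑ i, r i) := by
  rw [Fin.sum_univ_succ, Fin.sum_univ_succ]
  simp

theorem sum_fin_append {m k : ℕ} (r : Fin m → ℂ) (t : Fin k → ℂ) :
    ∑ j, Fin.append r t j = ∑ i, r i + ∑ i, t i := by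
  rw [Fin.sum_univ_add]
  simp

theorem balanced_f : ∑ i, X i + ∑ j, addFB h A B C X N u y j + ∑ j, addFC h A B C X N u y j
    = (n + 2) * (A - B) + (n + 1) * h := by
  unfold addFB addFC
  rw [sum_fin_add_two, sum_fin_add_two, sum_fin_append]
  simp only [Finset.sum_add_distrib, Finset.sum_sub_distrib, ← Finset.sum_mul, Finset.sum_neg_distrib,
    sum_cast_eq_tot, Finset.sum_const, Finset.card_univ, Fintype.card_fin, nsmul_eq_mul]
  ring

theorem balanced_g : ∑ i, addGZ h X N i + ∑ j, addGB h A B C X N u y j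
      + ∑ j, addGC h A B C X N u y j
    = (n + 2) * addGA h A B N + (n + 1) * h := by
  unfold addGZ addGB addGC addGA
  rw [sum_fin_add_two, sum_fin_add_two, sum_fin_append]
  simp only [Finset.sum_add_distrib, Finset.sum_sub_distrib, ← Finset.sum_mul, Finset.sum_neg_distrib,
    sum_cast_eq_tot, Finset.sum_const, Finset.card_univ, Fintype.card_fin, nsmul_eq_mul]
  ring

theorem f_eq_add (hp : ‖p‖ < 1) (ha : a = Complex.exp A) (hb : b = Complex.exp B)
    (hc : c = Complex.exp C) (hx : ∀ i, x i = Complex.exp (X i)) :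
    f p (Complex.exp h) a b c x N u y = addF (oddTheta p) h A B C X N u y := by
  have hab : a / b = Complex.exp (A - B) := by rw [ha, hb, ← Complex.exp_sub]
  rw [f, V]
  simp only [v_term_eq hab (fB_eq_exp ha hb hc hx) (fC_eq_exp ha hb hc hx) hx balanced_f]
  rw [addF]
  refine tsum_eq_sum fun k hk => ?_
  obtain ⟨l, hl⟩ : ∃ l, min (u l) (y l) < k l := by
    by_contra hcon
    push Not at hcon
    exact hk (Finset.mem_Icc.mpr ⟨fun i => Nat.zero_le _, hcon⟩)
  -- Outside the box a terminating factor makes the numerator zero. The denominator may vanish there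
  -- too, but a quotient with numerator 0 is 0, as the convention on the series requires.
  rw [div_eq_zero_iff]
  left
  rcases min_lt_iff.mp hl with hl | hl
  · refine addNum_eq_zero (isOddSigma_oddTheta hp) l (Fin.natAdd n l).succ.succ hl ?_
    simp only [addFC, Matrix.cons_val_succ, Fin.append_right]
    ring
  · refine addNum_eq_zero (isOddSigma_oddTheta hp) l (Fin.castAdd n l).succ.succ hl ?_
    simp only [addFC, Matrix.cons_val_succ, Fin.append_left]
    ring

theorem g_eq_add (hp : ‖p‖ < 1) (hu : u ≤ N) (hy : y ≤ N) (ha : a = Complex.exp A)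
    (hb : b = Complex.exp B) (hc : c = Complex.exp C) (hx : ∀ i, x i = Complex.exp (X i)) :
    g p (Complex.exp h) a b c x N u y = addG (oddTheta p) h A B C X N u y := by
  rw [g, V]
  simp only [v_term_eq (gA_eq_exp ha hb) (gB_eq_exp ha hb hc hx) (gC_eq_exp ha hb hc hx)
    (gZ_eq_exp hx) balanced_g]
  rw [addG]
  refine tsum_eq_sum fun k hk => ?_
  obtain ⟨l, hl⟩ : ∃ l, N l - max (u l) (y l) < k l := by
    by_contra hcon
    push Not at hcon
    exact hk (Finset.mem_Icc.mpr ⟨fun i => Nat.zero_le _, hcon⟩)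
  have h1 : u l ≤ N l := hu l
  have h2 : y l ≤ N l := hy l
  rw [div_eq_zero_iff]
  left
  rcases (show N l - u l < k l ∨ N l - y l < k l by omega) with hl | hl
  · refine addNum_eq_zero (isOddSigma_oddTheta hp) l (Fin.natAdd n l).succ.succ hl ?_
    simp only [addGC, addGZ, Matrix.cons_val_succ, Fin.append_right]
    rw [Nat.cast_sub h1]; ring
  · refine addNum_eq_zero (isOddSigma_oddTheta hp) l (Fin.castAdd n l).succ.succ hl ?_
    simp only [addGC, addGZ, Matrix.cons_val_succ, Fin.append_left]
    rw [Nat.cast_sub h2]; ring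

end Conversion

end EllipticHyp

/-! ### The theorem. -/

theorem theorem6p2 {n : ℕ} (p q a b c : ℂ) (x : Fin n → ℂ) (N u v : Fin n → ℕ)
    (hp : ‖p‖ < 1) (hq : q ≠ 0) (ha : a ≠ 0) (hb : b ≠ 0) (hc : c ≠ 0) (hx : ∀ i, x i ≠ 0)
    (hu : u ≤ N) (hv : v ≤ N)
    (hw : ∀ y ≤ N, EllipticHyp.wDen p q a b x N y ≠ 0)
    (hf : ∀ y ≤ N, ∀ s : Fin n → ℕ, s ≤ u → s ≤ y →
      EllipticHyp.vDen p q (a / b) (EllipticHyp.fB q a b c x N u y)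
        (EllipticHyp.fC q a b c x N u y) x s ≠ 0)
    (hg : ∀ y ≤ N, ∀ s : Fin n → ℕ, s + v ≤ N → s + y ≤ N →
      EllipticHyp.vDen p q (EllipticHyp.gA q a b N) (EllipticHyp.gB q a b c x N v y)
        (EllipticHyp.gC q a b c x N v y) (EllipticHyp.gZ q x N) s ≠ 0)
    (hΓ : EllipticHyp.GammaDen p q a b c x N u ≠ 0) :
    ∑ y ∈ Finset.Icc 0 N, EllipticHyp.w p q a b x N y * EllipticHyp.f p q a b c x N u y
        * EllipticHyp.g p q a b c x N v y
      = if u = v then EllipticHyp.Gamma p q a b c x N u else 0 := by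
  open EllipticHyp in
  -- Any choice of logarithms serves: the conversion lemmas only require each parameter to be the
  -- exponential of its additive form.
  obtain ⟨h, rfl⟩ : ∃ h, q = Complex.exp h := ⟨_, (Complex.exp_log hq).symm⟩
  have ea := (Complex.exp_log ha).symm
  have eb := (Complex.exp_log hb).symm
  have ec := (Complex.exp_log hc).symm
  have ex := fun i => (Complex.exp_log (hx i)).symm
  have eab : a / b = Complex.exp (Complex.log a - Complex.log b) := by
    rw [Complex.exp_sub, ← ea, ← eb]
  have key := sum_weight (isOddSigma_oddTheta hp) (h := h) (a := Complex.log a)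
    (b := Complex.log b) (c := Complex.log c) (x := fun i => Complex.log (x i)) hu hv
    (fun y hy => (wDen_ne_zero_iff ea eb ex).mp (hw y hy))
    (fun y hy k hk => (vDen_ne_zero_iff eab (fB_eq_exp ea eb ec ex) (fC_eq_exp ea eb ec ex) ex k).mp
      (hf y hy k (hk.trans inf_le_left) (hk.trans inf_le_right)))
    (fun y hy k hk => (vDen_ne_zero_iff (gA_eq_exp ea eb) (gB_eq_exp ea eb ec ex)
      (gC_eq_exp ea eb ec ex) (gZ_eq_exp ex) k).mp (hg y hy k
        ((add_le_add_left (hk.trans (tsub_le_tsub_left le_sup_left N)) v).trans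
          (tsub_add_cancel_of_le hv).le)
        ((add_le_add_left (hk.trans (tsub_le_tsub_left le_sup_right N)) y).trans
          (tsub_add_cancel_of_le hy).le)))
    ((GammaDen_ne_zero_iff ea eb ec ex).mp hΓ)
  rw [← Gamma_eq_add hu ea eb ec ex] at key
  rw [← key]
  refine Finset.sum_congr rfl fun y hy => ?_
  rw [w_eq_add ea eb ex, f_eq_add hp ea eb ec ex,
    g_eq_add hp hv (Finset.mem_Icc.mp hy).2 ea eb ec ex]
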